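/- Let $H\in(0,1)$ and $R(s,t)=\tfrac12\big(s^{2H}+t^{2H}-|s-t|^{2H}\big)$. For $T>0$ let $\mathfrak H$ be the canonical Hilbert space of fractional Brownian motion with Hurst parameter $H$ on $[0,T]$, that is, the completion of the step functions on $[0,T]$ for the inner product determined by $\langle \mathbf 1_{[0,s]},\mathbf 1_{[0,t]}\rangle_{\mathfrak H}=R(s,t)$, and let $\mathfrak H^{\otimes 2}$ be its Hilbert tensor square; a function $f\in L^2([0,T]^2)$ is an element of $\mathfrak H^{\otimes2}$ if it is the $L^2$-limit of a sequence of step functions (linear combinations of $\mathbf 1_{[0,a]}\otimes\mathbf 1_{[0,b]}$, $a,b\in[0,T]$) that is Cauchy in $\mathfrak H^{\otimes 2}$, and its norm is then the limit of their norms. Let $$f_T(t,s)=e^{-|t-s|}\mathbf 1_{\{0\le s,t\le T\}}.$$ Then $f_T$ is a symmetric element of $\mathfrak H^{\otimes 2}$ with a well-defined norm, and, as $T\to\infty$, the following hold. If $H\ne\frac34$, then $$\begin{aligned}\|f_T\|^2_{\mathfrak H^{\otimes2}}={}&2H^2\Gamma^2(2H)\Big[(4H-1)\Big(1-\frac{1}{\cos(2H\pi)}\Big)\Big(T-\frac{4H-1}{2}\Big)-(2H-1)(2H+1)\Big]\\&+H^2\Big[\frac{4(2H-1)}{4H-3}T^{4H-2}-\frac{8(2H-1)^2}{4H-3}T^{4H-3}\Big]+O(T^{4H-4}),\end{aligned}$$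 where for $H=\frac14$ the term $\frac{4H-1}{-\cos(2H\pi)}$ is read as its limit $\frac2\pi$ as $H\to\frac14$. If $H=\frac34$, then $$\|f_T\|^2_{\mathfrak H^{\otimes2}}=\frac98\Big[(T-1)\log T+\Big(c+\frac{\pi-3}{2}\Big)T+1-c-\frac{13\pi}{16}+\frac1T\Big]+O(T^{-2}),$$ where $c=2\log2+\gamma$ and $\gamma$ is Euler's constant. -/

import Mathlib

open Filter Topology MeasureTheory Asymptotics

namespace FBM

/-- Covariance function `R(s,t) = (s^{2H} + t^{2H} - |s-t|^{2H}) / 2` (for `s, t ≥ 0`) of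
fractional Brownian motion with Hurst parameter `H`. -/
noncomputable def cov (H s t : ℝ) : ℝ :=
  (s ^ (2 * H) + t ^ (2 * H) - |s - t| ^ (2 * H)) / 2

/-- Formal real linear combinations `∑ w • (1_{[0,a]} ⊗ 1_{[0,b]})` with `a, b ∈ [0,T]`: the
coefficient of `1_{[0,a]} ⊗ 1_{[0,b]}` is the value at `(a, b)`. -/
abbrev Step (T : ℝ) : Type := (Set.Icc (0 : ℝ) T × Set.Icc (0 : ℝ) T) →₀ ℝ

/-- The step function of two variables `(t,s) ↦ ∑ w * 1_{[0,a]}(t) * 1_{[0,b]}(s)`. -/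
noncomputable def Step.toFun {T : ℝ} (φ : Step T) (p : ℝ × ℝ) : ℝ :=
  φ.sum fun ab w =>
    w * (Set.Icc (0 : ℝ) ab.1).indicator 1 p.1 * (Set.Icc (0 : ℝ) ab.2).indicator 1 p.2

/-- The inner product of the tensor square of the canonical Hilbert space `𝔥` of fractional
Brownian motion on `[0,T]`, on step functions. In `𝔥` one has `⟨1_{[0,a]}, 1_{[0,a']}⟩ = R(a,a')`,
so in `𝔥 ⊗ 𝔥` one has
`⟨1_{[0,a]} ⊗ 1_{[0,b]}, 1_{[0,a']} ⊗ 1_{[0,b']}⟩ = R(a,a') R(b,b')`, extended bilinearly. -/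
noncomputable def stepInner (H : ℝ) {T : ℝ} (φ ψ : Step T) : ℝ :=
  φ.sum fun ab w => ψ.sum fun ab' w' =>
    w * w' * (cov H ab.1 ab'.1 * cov H ab.2 ab'.2)

/-- `HasTensorNormSq H T f x`: the function `f` on `[0,T]²` is an element of `𝔥 ⊗ 𝔥` (the
completion of the step functions for `stepInner`) and its squared norm there is `x`.
That is, `f` is the limit in `L²([0,T]²)` of step functions which form a Cauchy sequence
for the norm of `𝔥 ⊗ 𝔥` and whose squared norms converge to `x`. -/
def HasTensorNormSq (H T : ℝ) (f : ℝ × ℝ → ℝ) (x : ℝ) : Prop :=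
  ∃ φ : ℕ → Step T,
    Tendsto (fun n => eLpNorm (fun p => (φ n).toFun p - f p) 2
      (volume.restrict (Set.Icc (0 : ℝ) T ×ˢ Set.Icc (0 : ℝ) T))) atTop (𝓝 0) ∧
    Tendsto (fun mn : ℕ × ℕ => stepInner H (φ mn.1 - φ mn.2) (φ mn.1 - φ mn.2))
      atTop (𝓝 0) ∧
    Tendsto (fun n => stepInner H (φ n) (φ n)) atTop (𝓝 x)

/-- `f_T(t,s) = e^{-|t-s|} 1_{0 ≤ s, t ≤ T}`. -/
noncomputable def fT (T : ℝ) : ℝ × ℝ → ℝ :=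
  (Set.Icc (0 : ℝ) T ×ˢ Set.Icc (0 : ℝ) T).indicator fun p => Real.exp (-|p.1 - p.2|)

/-- The factor `(4H-1)(1 - 1/cos(2Hπ)) = (4H-1) + (4H-1)/(-cos(2Hπ))`, where the quotient is read
as its limit `2/π` at `H = 1/4`. -/
noncomputable def slopeFactor (H : ℝ) : ℝ :=
  (4 * H - 1) +
    if H = 1 / 4 then 2 / Real.pi else (4 * H - 1) / (-Real.cos (2 * H * Real.pi))

end FBM

namespace FBM
open Real Set

/-! Put α = 2H. With C = `specConst α`, sending 1_{[0,a]} to C^{-1/2} |ξ|^{(1-α)/2} ∫_0^a e^{itξ} dt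
realises the covariance R inside L²(ℝ) (`integral_specInd_mul_conj`), so tensor norms of step
functions become L² norms over the frequency plane (`stepInner_self`). L² convergence on the bounded
square forces pointwise convergence of Fourier transforms. A Cauchy sequence of step functions
tending to f can therefore only converge, on the frequency side, to the weighted transform of f, and
the norm of f is determined if it exists (`integral_specFun_of_hasTensorNormSq`). It exists for f_T
because explicit grid approximations have transforms dominated by one square integrable function
(`norm_specStep_gridStep_sq_le`).

The kernel is a mixture of squares: e^{-|t-s|} = ∫ u_a(t) u_a(s) dm(a) with u_a(t) = e^{-(a-t)}
1_{[0,a]}(t) and m = δ_T + 2 da on (0,T]. Hence the squared norm is ∬ ρ(a,b)² dm(a) dm(b), where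
ρ(a,b) = ⟨u_a, u_b⟩ is the covariance of the fractional Ornstein-Uhlenbeck process started at zero,
a combination of exponentials and the stationary covariance c = `specCov α`
(`integral_norm_specFun_fT_sq`, `hasTensorNormSq_fT_iff_normSqFT`).

On (0,∞) one has c'' = c - κ with κ homogeneous of degree α-2. Homogeneity reduces the integrals
which occur to c, c', incomplete gamma integrals and I(T) = ∫_0^T c², except for one convolution
that is constant up to O(T e^{-T}) (`normSqFT_sub_normSqMain`). The result is 8T I - 4(2α-1) I plus
terms that expand by repeated integration by parts (`normSqMain_expansion`), so everything rests on
I.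

Since c² = k² x^{2α-4} + O(x^{2α-6}) with k = α(α-1)/2, for α ≠ 3/2 one has I(T) = k²
T^{2α-3}/(2α-3) + L + O(T^{2α-5}). For α < 3/2, Plancherel and a beta integral give L
(`tendsto_covSqInt_of_lt`). For α > 3/2, c is no longer square integrable but c' is, and an identity
between ∫ c² and ∫ c'² yields the same formula (`tendsto_covSqInt_of_gt`); the reflection formula
then produces the cosine (`covSqLimit_eq`). At α = 3/2 the leading power becomes a logarithm, and
the constant is found by letting α increase to 3/2 in error bounds that are explicit in α: two poles
cancel, and the derivatives of Γ at 1/2 and 1 leave 2 log 2 + γ (`tendsto_covSqLimit_add`). -/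

/-! ### Beta integrals and Plancherel's theorem on the line. -/

theorem integrableOn_rpow_mul_exp_neg_mul_sq {b t : ℝ} (hb : -1 < b) (ht : 0 < t) :
    IntegrableOn (fun x : ℝ => x ^ b * Real.exp (-t * x ^ 2)) (Ioi 0) := by
  simpa using _root_.integrableOn_rpow_mul_exp_neg_mul_sq ht hb

/-- Insert Γ(n) (1+x²)^{-n} = ∫ t^{n-1} e^{-(1+x²)t} dt and exchange the integrals: the x-integral
is Gaussian and the t-integral is a gamma integral. The case n = 1 gives the variance c(0), and n =
2 gives the Plancherel integrals of c and c'. -/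
theorem integral_rpow_div_one_add_sq_pow {b : ℝ} {n : ℕ} (hb : -1 < b) (hn : b + 1 < 2 * n) :
    IntegrableOn (fun x : ℝ => x ^ b / (1 + x ^ 2) ^ n) (Ioi 0) ∧
    ∫ x in Ioi (0 : ℝ), x ^ b / (1 + x ^ 2) ^ n =
      Real.Gamma ((b + 1) / 2) * Real.Gamma (n - (b + 1) / 2) / (2 * Real.Gamma n) := by
  have hn0 : (0 : ℝ) < n := by linarith
  have hG : 0 < Real.Gamma n := Real.Gamma_pos_of_pos hn0
  let F : ℝ × ℝ → ℝ := fun z => z.1 ^ b * (z.2 ^ ((n : ℝ) - 1) * Real.exp (-((1 + z.1 ^ 2) * z.2)))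
  have hFm : Measurable F := by fun_prop
  have hx : ∀ x : ℝ, ∫ t in Ioi (0 : ℝ), F (x, t) = Real.Gamma n * (x ^ b / (1 + x ^ 2) ^ n) := by
    intro x
    have hp : 0 < 1 + x ^ 2 := by positivity
    simp only [F]
    rw [integral_const_mul, Real.integral_rpow_mul_exp_neg_mul_Ioi hn0 hp, Real.rpow_natCast]
    rw [one_div, inv_pow]; ring
  have ht : ∀ t ∈ Ioi (0 : ℝ), ∫ x in Ioi (0 : ℝ), F (x, t) =
      Real.Gamma ((b + 1) / 2) / 2 * (t ^ ((n : ℝ) - (b + 1) / 2 - 1) * Real.exp (-t)) := by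
    intro t ht
    have ht' : 0 < t := ht
    have := integral_rpow_mul_exp_neg_mul_rpow (p := 2) (by norm_num) hb ht'
    have e : ∀ x : ℝ, F (x, t) =
        (t ^ ((n : ℝ) - 1) * Real.exp (-t)) * (x ^ b * Real.exp (-t * x ^ (2 : ℝ))) := by
      intro x
      simp only [F]
      rw [show -((1 + x ^ 2) * t) = -t + -t * x ^ (2 : ℝ) by rw [Real.rpow_two]; ring, Real.exp_add]
      ring
    simp_rw [e]
    rw [integral_const_mul, this]
    rw [show (n : ℝ) - (b + 1) / 2 - 1 = ((n : ℝ) - 1) + -(b + 1) / 2 by ring, Real.rpow_add ht']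
    ring
  have hint : Integrable F ((volume.restrict (Ioi 0)).prod (volume.restrict (Ioi 0))) := by
    rw [integrable_prod_iff' hFm.aestronglyMeasurable]
    constructor
    · filter_upwards [ae_restrict_mem measurableSet_Ioi] with t ht'
      have ht' : 0 < t := ht'
      have e : ∀ x : ℝ, F (x, t) =
          (t ^ ((n : ℝ) - 1) * Real.exp (-t)) * (x ^ b * Real.exp (-t * x ^ 2)) := by
        intro x
        simp only [F]
        rw [show -((1 + x ^ 2) * t) = -t + -t * x ^ 2 by ring, Real.exp_add]
        ring
      simp_rw [e]
      exact (integrableOn_rpow_mul_exp_neg_mul_sq hb ht').const_mul _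
    · have hI : IntegrableOn (fun t : ℝ => Real.Gamma ((b + 1) / 2) / 2 *
          (t ^ ((n : ℝ) - (b + 1) / 2 - 1) * Real.exp (-t))) (Ioi 0) := by
        refine Integrable.const_mul ?_ _
        have := Real.GammaIntegral_convergent (s := (n : ℝ) - (b + 1) / 2) (by linarith)
        refine this.congr_fun (fun x _ => ?_) measurableSet_Ioi
        simp [mul_comm]
      refine hI.congr_fun (fun t ht' => ?_) measurableSet_Ioi
      simp only
      rw [← ht t ht']
      refine setIntegral_congr_fun measurableSet_Ioi (fun x hx' => ?_)
      have h1 : 0 < x := hx'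
      have h2 : 0 < t := ht'
      rw [Real.norm_of_nonneg]
      simp only [F]; positivity
  have hswap := integral_integral_swap (f := fun x t => F (x, t)) hint
  have h1 : IntegrableOn (fun x : ℝ => x ^ b / (1 + x ^ 2) ^ n) (Ioi 0) := by
    have := hint.integral_prod_left
    simp only [hx] at this
    have h2 := this.const_mul (Real.Gamma n)⁻¹
    refine h2.congr (Eventually.of_forall fun x => ?_)
    simp only; field_simp
  refine ⟨h1, ?_⟩
  simp only [hx] at hswap
  rw [integral_const_mul] at hswap
  rw [setIntegral_congr_fun measurableSet_Ioi ht, integral_const_mul] at hswap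
  have hg := Real.Gamma_eq_integral (s := (n : ℝ) - (b + 1) / 2) (by linarith)
  have : ∫ t in Ioi (0 : ℝ), t ^ ((n : ℝ) - (b + 1) / 2 - 1) * Real.exp (-t) =
      Real.Gamma ((n : ℝ) - (b + 1) / 2) := by
    rw [hg]; congr 1; ext x; ring
  rw [this] at hswap
  rw [eq_div_iff (by positivity)]
  linarith

/-- The Fourier transform on L² is isometric, so what needs proof is that on L¹ ∩ L² it agrees
almost everywhere with the integral formula. Both have the same pairing with Schwartz functions, by
self-adjointness of the transform. -/
theorem integral_norm_fourier_sq {f : ℝ → ℂ} (h1 : MemLp f 1) (h2 : MemLp f 2) :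
    MemLp (FourierTransform.fourier f) 2 ∧
    ∫ x, ‖FourierTransform.fourier f x‖ ^ 2 = ∫ x, ‖f x‖ ^ 2 := by
  have hf1 : Integrable f := memLp_one_iff_integrable.1 h1
  let G : Lp (α := ℝ) ℂ 2 := FourierTransform.fourier (h2.toLp f)
  have hcont : Continuous (FourierTransform.fourier f : ℝ → ℂ) :=
    VectorFourier.fourierIntegral_continuous Real.continuous_fourierChar
      (by fun_prop) hf1
  have key : ∀ g : SchwartzMap ℝ ℂ, ∫ x, g x • G x = ∫ x, g x • FourierTransform.fourier f x := by
    intro g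
    have e1 := DFunLike.congr_fun (Lp.fourier_toTemperedDistribution_eq (h2.toLp f)) g
    rw [Lp.toTemperedDistribution_apply] at e1
    rw [← e1, TemperedDistribution.fourier_apply, Lp.toTemperedDistribution_apply]
    have e2 : ∫ x, (FourierTransform.fourier g) x • (h2.toLp f) x
        = ∫ x, (FourierTransform.fourier g) x • f x := by
      refine integral_congr_ae ?_
      filter_upwards [h2.coeFn_toLp] with x hx
      rw [hx]
    rw [e2]
    have := VectorFourier.integral_fourierIntegral_smul_eq_flip (μ := volume) (ν := volume)
      (e := Real.fourierChar) (L := (innerₗ ℝ)) (f := (g : ℝ → ℂ)) (g := f)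
      Real.continuous_fourierChar (by fun_prop) g.integrable hf1
    rw [flip_innerₗ] at this
    exact this
  have hG : (G : ℝ → ℂ) =ᵐ[volume] FourierTransform.fourier f := by
    have hl : LocallyIntegrable (fun x => G x - FourierTransform.fourier f x) :=
      ((Lp.memLp G).locallyIntegrable (by norm_num)).sub hcont.locallyIntegrable
    have := ae_eq_zero_of_integral_contDiff_smul_eq_zero hl ?_
    · filter_upwards [this] with x hx
      exact sub_eq_zero.1 hx
    intro g hg hgc
    -- A smooth compactly supported test function is Schwartz, so `key` applies to it.
    let g' : SchwartzMap ℝ ℂ := (hgc.comp_left (g := ((↑) : ℝ → ℂ)) (by simp)).toSchwartzMap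
      (Complex.ofRealCLM.contDiff.comp hg)
    have hk := key g'
    have hg' : ∀ x, g' x = (g x : ℂ) := fun x => rfl
    simp only [hg'] at hk
    have i1 : Integrable (fun x => g x • G x) := by
      have := ((Lp.memLp G).locallyIntegrable (by norm_num)).integrable_smul_left_of_hasCompactSupport
        hg.continuous hgc
      exact this
    have i2 : Integrable (fun x => g x • FourierTransform.fourier f x) :=
      (hcont.locallyIntegrable).integrable_smul_left_of_hasCompactSupport hg.continuous hgc
    simp only [smul_sub]
    rw [integral_sub i1 i2, sub_eq_zero]
    simpa using hk
  have hGm : MemLp (FourierTransform.fourier f) 2 := (memLp_congr_ae hG).1 (Lp.memLp G)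
  refine ⟨hGm, ?_⟩
  have n1 : ‖G‖ = ‖h2.toLp f‖ := Lp.norm_fourier_eq _
  have sq : ∀ (F : Lp (α := ℝ) ℂ 2), ‖F‖ ^ 2 = ∫ x, ‖F x‖ ^ 2 := by
    intro F
    have h := @L2.inner_def ℝ ℂ ℂ _ _ _ _ _ F F
    have h3 := congrArg Complex.re h
    rw [inner_self_eq_norm_sq_to_K] at h3
    have : ∀ x, inner ℂ (F x) (F x) = ((‖F x‖ ^ 2 : ℝ) : ℂ) := by
      intro x; rw [inner_self_eq_norm_sq_to_K]; norm_cast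
    simp only [this] at h3
    rw [integral_complex_ofReal] at h3
    norm_cast at h3
  have a1 : ∫ x, ‖FourierTransform.fourier f x‖ ^ 2 = ∫ x, ‖G x‖ ^ 2 :=
    integral_congr_ae (by filter_upwards [hG] with x hx; rw [hx])
  have a2 : ∫ x, ‖(h2.toLp f) x‖ ^ 2 = ∫ x, ‖f x‖ ^ 2 :=
    integral_congr_ae (by filter_upwards [h2.coeFn_toLp] with x hx; rw [hx])
  rw [a1, ← a2, ← sq, ← sq, n1]

theorem integrable_comp_abs_of_integrableOn {f : ℝ → ℝ} (hf : IntegrableOn f (Ioi 0)) :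
    Integrable (fun x => f |x|) := by
  have h1 : IntegrableOn (fun x => f |x|) (Ioi 0) :=
    hf.congr_fun (fun x hx => by rw [abs_of_pos hx]) measurableSet_Ioi
  have h2 : IntegrableOn (fun x => f |x|) (Iic 0) := by
    rw [← Measure.map_neg_eq_self (volume : Measure ℝ)]
    have m : MeasurableEmbedding fun x : ℝ => -x := (Homeomorph.neg ℝ).measurableEmbedding
    rw [m.integrableOn_map_iff]
    simp only [Function.comp_def, abs_neg, Set.neg_preimage, Set.neg_Iic, neg_zero]
    rw [integrableOn_Ici_iff_integrableOn_Ioi]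
    exact h1
  have := h2.union h1
  rwa [Iic_union_Ioi, integrableOn_univ] at this

/-! ### The spectral isometry of fractional Brownian motion. -/

/-- Up to normalisation, the spectral density of the stationary fractional Ornstein-Uhlenbeck
process. -/
noncomputable def specDensity (α ξ : ℝ) : ℝ := |ξ| ^ (1 - α) / (1 + ξ ^ 2)

theorem specDensity_nonneg (α ξ : ℝ) : 0 ≤ specDensity α ξ := by
  unfold specDensity; positivity

theorem measurable_specDensity (α : ℝ) : Measurable (specDensity α) := by
  unfold specDensity; fun_prop

theorem specDensity_neg (α ξ : ℝ) : specDensity α (-ξ) = specDensity α ξ := by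
  simp [specDensity]

theorem integrable_specDensity {α : ℝ} (h0 : 0 < α) (h2 : α < 2) : Integrable (specDensity α) := by
  have := (integral_rpow_div_one_add_sq_pow (b := 1 - α) (n := 1) (by linarith)
    (by push_cast; linarith)).1
  refine (integrable_comp_abs_of_integrableOn this).congr (Eventually.of_forall fun x => ?_)
  simp [specDensity]

/-- The Fourier transform of the indicator function of `[0, a]`. -/
noncomputable def indHat (a ξ : ℝ) : ℂ := ∫ t in (0 : ℝ)..a, Complex.exp (t * ξ * Complex.I)

theorem norm_cexp_mul_I (t ξ : ℝ) : ‖Complex.exp (t * ξ * Complex.I)‖ = 1 := by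
  rw [← Complex.ofReal_mul]; exact Complex.norm_exp_ofReal_mul_I _

theorem continuous_indHat (a : ℝ) : Continuous (indHat a) := by
  unfold indHat
  apply intervalIntegral.continuous_parametric_intervalIntegral_of_continuous'
  fun_prop

theorem indHat_eq (a : ℝ) {ξ : ℝ} (hξ : ξ ≠ 0) :
    indHat a ξ = (Complex.exp (a * ξ * Complex.I) - 1) / (ξ * Complex.I) := by
  have hc : (ξ * Complex.I : ℂ) ≠ 0 := by simp [hξ]
  have := integral_exp_mul_complex (a := 0) (b := a) hc
  unfold indHat
  simp only [mul_comm (ξ * Complex.I : ℂ), ← mul_assoc] at this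
  rw [this]; simp

theorem indHat_neg (a ξ : ℝ) : indHat a (-ξ) = starRingEnd ℂ (indHat a ξ) := by
  unfold indHat
  rw [← intervalIntegral.intervalIntegral_conj]
  congr 1; ext t
  rw [← Complex.exp_conj]; simp

theorem norm_indHat_le {a : ℝ} (ha : 0 ≤ a) (ξ : ℝ) : ‖indHat a ξ‖ ≤ a := by
  have := intervalIntegral.norm_integral_le_of_norm_le_const (a := 0) (b := a) (C := 1)
    (f := fun t : ℝ => Complex.exp (t * ξ * Complex.I)) (fun t _ => (norm_cexp_mul_I t ξ).le)
  unfold indHat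
  simpa [abs_of_nonneg ha] using this

theorem norm_indHat_sq_le {a : ℝ} (ha : 0 ≤ a) (ξ : ℝ) :
    ‖indHat a ξ‖ ^ 2 ≤ (a ^ 2 + 4) / (1 + ξ ^ 2) := by
  have h1 := norm_indHat_le ha ξ
  have h2 : ‖indHat a ξ‖ * |ξ| ≤ 2 := by
    rcases eq_or_ne ξ 0 with rfl | hξ
    · simp
    rw [indHat_eq a hξ, norm_div, norm_mul, Complex.norm_I, mul_one, Complex.norm_real,
      Real.norm_eq_abs, div_mul_cancel₀ _ (abs_ne_zero.2 hξ)]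
    refine (norm_sub_le _ _).trans ?_
    rw [norm_cexp_mul_I]; norm_num
  rw [le_div_iff₀ (by positivity)]
  have h3 : (‖indHat a ξ‖ * |ξ|) ^ 2 ≤ 2 ^ 2 := pow_le_pow_left₀ (by positivity) h2 2
  rw [mul_pow, sq_abs] at h3
  have h4 := pow_le_pow_left₀ (norm_nonneg _) h1 2
  nlinarith

theorem abs_rpow_mul_norm_indHat_sq_le {α a : ℝ} (ha : 0 ≤ a) (ξ : ℝ) :
    |ξ| ^ (1 - α) * ‖indHat a ξ‖ ^ 2 ≤ (a ^ 2 + 4) * specDensity α ξ := by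
  calc |ξ| ^ (1 - α) * ‖indHat a ξ‖ ^ 2 ≤ |ξ| ^ (1 - α) * ((a ^ 2 + 4) / (1 + ξ ^ 2)) := by
        gcongr; exact norm_indHat_sq_le ha ξ
    _ = _ := by unfold specDensity; ring

/-- Comes from |e^{itξ} - 1|² = 2(1 - cos tξ). It transfers the bounds on `indHat` to the integrand
that represents |t|^α. -/
theorem one_sub_cos_eq (t : ℝ) {ξ : ℝ} (hξ : ξ ≠ 0) (α : ℝ) :
    (1 - Real.cos (t * ξ)) * |ξ| ^ (-1 - α) = |ξ| ^ (1 - α) * ‖indHat t ξ‖ ^ 2 / 2 := by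
  have hx : 0 < |ξ| := abs_pos.2 hξ
  rw [indHat_eq t hξ, norm_div, norm_mul, Complex.norm_I, mul_one, Complex.norm_real,
      Real.norm_eq_abs, div_pow, sq_abs]
  have : ‖Complex.exp (t * ξ * Complex.I) - 1‖ ^ 2 = 2 * (1 - Real.cos (t * ξ)) := by
    rw [← Complex.ofReal_mul, Complex.sq_norm, Complex.normSq_apply]
    simp only [Complex.sub_re, Complex.sub_im, Complex.exp_ofReal_mul_I_re,
      Complex.exp_ofReal_mul_I_im, Complex.one_re, Complex.one_im]
    nlinarith [Real.sin_sq_add_cos_sq (t * ξ)]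
  rw [this, ← sq_abs ξ, show (1 - α) = (-1 - α) + 2 by ring, Real.rpow_add hx, Real.rpow_two]
  field_simp

theorem integrable_one_sub_cos {α : ℝ} (h0 : 0 < α) (h2 : α < 2) (t : ℝ) :
    Integrable (fun ξ => (1 - Real.cos (t * ξ)) * |ξ| ^ (-1 - α)) := by
  wlog ht : 0 ≤ t generalizing t
  · have := this (-t) (by linarith)
    simpa using this
  refine ((integrable_specDensity h0 h2).const_mul (t ^ 2 + 4)).mono' (by fun_prop) ?_
  have : ∀ᵐ ξ : ℝ, ξ ≠ 0 := by simp [ae_iff, measure_singleton]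
  filter_upwards [this] with ξ hξ
  rw [one_sub_cos_eq t hξ, Real.norm_of_nonneg (by positivity)]
  have := abs_rpow_mul_norm_indHat_sq_le (α := α) ht ξ
  have h3 : 0 ≤ |ξ| ^ (1 - α) * ‖indHat t ξ‖ ^ 2 := by positivity
  linarith

/-- The normalising constant of the spectral representation of fractional Brownian motion. -/
noncomputable def specConst (α : ℝ) : ℝ := 2 * ∫ ξ, (1 - Real.cos ξ) * |ξ| ^ (-1 - α)

theorem specConst_pos {α : ℝ} (h0 : 0 < α) (h2 : α < 2) : 0 < specConst α := by
  have hi := integrable_one_sub_cos h0 h2 1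
  simp only [one_mul] at hi
  have hn : ∀ ξ : ℝ, 0 ≤ (1 - Real.cos ξ) * |ξ| ^ (-1 - α) := fun ξ =>
    mul_nonneg (by linarith [Real.cos_le_one ξ]) (by positivity)
  unfold specConst
  refine mul_pos two_pos ((integral_pos_iff_support_of_nonneg hn hi).2 ?_)
  refine lt_of_lt_of_le ?_ (measure_mono (s := Ioo (0 : ℝ) 1) ?_)
  · simp
  intro x hx
  have h1 : Real.cos x < 1 := by
    have := Real.cos_lt_cos_of_nonneg_of_le_pi_div_two (x := 0) (y := x) le_rfl
      (by linarith [hx.2, Real.pi_gt_three]) hx.1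
    simpa using this
  have hx0 : 0 < |x| := abs_pos.2 hx.1.ne'
  exact (mul_pos (by linarith) (by positivity)).ne'

/-- Substituting ξ ↦ tξ shows that the integral is homogeneous of degree α in |t|; this is why the
power |t|^α has a spectral representation. -/
theorem integral_one_sub_cos {α : ℝ} (h0 : 0 < α) (t : ℝ) :
    ∫ ξ, (1 - Real.cos (t * ξ)) * |ξ| ^ (-1 - α) = |t| ^ α * (specConst α / 2) := by
  rcases eq_or_ne t 0 with rfl | ht
  · simp [Real.zero_rpow h0.ne']
  have ht' : 0 < |t| := abs_pos.2 ht
  have := Measure.integral_comp_mul_left (fun ξ => (1 - Real.cos ξ) * |ξ| ^ (-1 - α)) t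
  have e : ∀ ξ : ℝ, (1 - Real.cos (t * ξ)) * |ξ| ^ (-1 - α) =
      |t| ^ (1 + α) * ((1 - Real.cos (t * ξ)) * |t * ξ| ^ (-1 - α)) := by
    intro ξ
    rw [abs_mul, Real.mul_rpow (abs_nonneg _) (abs_nonneg _)]
    have : |t| ^ (1 + α) * |t| ^ (-1 - α) = 1 := by
      rw [← Real.rpow_add ht']; norm_num
    calc _ = (|t| ^ (1 + α) * |t| ^ (-1 - α)) * ((1 - Real.cos (t * ξ)) * |ξ| ^ (-1 - α)) := by
            rw [this, one_mul]
      _ = _ := by ring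
  simp_rw [e]
  rw [integral_const_mul, this, specConst, abs_inv, smul_eq_mul, Real.rpow_add ht', Real.rpow_one]
  field_simp

/-- The image of the indicator function of `[0, a]` under the spectral isometry. -/
noncomputable def specInd (α a ξ : ℝ) : ℂ :=
  (((Real.sqrt (specConst α))⁻¹ * |ξ| ^ ((1 - α) / 2) : ℝ) : ℂ) * indHat a ξ

theorem specWeight_sq {α : ℝ} (h0 : 0 < α) (h2 : α < 2) (ξ : ℝ) :
    ((Real.sqrt (specConst α))⁻¹ * |ξ| ^ ((1 - α) / 2)) ^ 2 = (specConst α)⁻¹ * |ξ| ^ (1 - α) := by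
  rw [mul_pow, inv_pow, Real.sq_sqrt (specConst_pos h0 h2).le, ← Real.rpow_natCast (|ξ| ^ _),
    ← Real.rpow_mul (abs_nonneg _)]
  norm_num

theorem measurable_specInd (α a : ℝ) : Measurable (specInd α a) := by
  have := (continuous_indHat a).measurable
  unfold specInd
  fun_prop

theorem memLp_specInd {α : ℝ} (h0 : 0 < α) (h2 : α < 2) {a : ℝ} (ha : 0 ≤ a) :
    MemLp (specInd α a) 2 := by
  rw [memLp_two_iff_integrable_sq_norm (measurable_specInd α a).aestronglyMeasurable]
  refine ((integrable_specDensity h0 h2).const_mul ((specConst α)⁻¹ * (a ^ 2 + 4))).mono'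
    (((measurable_specInd α a).norm.pow_const 2).aestronglyMeasurable) ?_
  refine Eventually.of_forall fun ξ => ?_
  rw [Real.norm_of_nonneg (by positivity), specInd, norm_mul, mul_pow, Complex.norm_real,
    Real.norm_eq_abs, sq_abs, specWeight_sq h0 h2, mul_assoc, mul_assoc]
  have := (specConst_pos h0 h2)
  exact mul_le_mul_of_nonneg_left (abs_rpow_mul_norm_indHat_sq_le ha ξ) (by positivity)

/-- The real part of (e^{isξ} - 1) times the conjugate of (e^{itξ} - 1) is (1 - cos sξ) + (1 - cos
tξ) - (1 - cos (s-t)ξ), and each piece integrates to a power. The imaginary part is odd in ξ and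
drops out. -/
theorem integral_specInd_mul_conj {α : ℝ} (h0 : 0 < α) (h2 : α < 2) {s t : ℝ} (hs : 0 ≤ s)
    (ht : 0 ≤ t) :
    ∫ ξ, specInd α s ξ * starRingEnd ℂ (specInd α t ξ) =
      (((s ^ α + t ^ α - |s - t| ^ α) / 2 : ℝ) : ℂ) := by
  have hC := specConst_pos h0 h2
  have hi : Integrable (fun ξ => specInd α s ξ * starRingEnd ℂ (specInd α t ξ)) :=
    (memLp_specInd h0 h2 hs).integrable_mul (memLp_specInd h0 h2 ht).star
  have hneg : ∀ a ξ : ℝ, specInd α a (-ξ) = starRingEnd ℂ (specInd α a ξ) := by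
    intro a ξ
    simp [specInd, indHat_neg]
  have him : (∫ ξ, specInd α s ξ * starRingEnd ℂ (specInd α t ξ)).im = 0 := by
    rw [← Complex.conj_eq_iff_im, ← integral_conj,
      ← integral_neg_eq_self (fun ξ => specInd α s ξ * starRingEnd ℂ (specInd α t ξ))]
    congr 1; ext ξ
    simp [hneg]
  have hre : ∀ ξ : ℝ, ξ ≠ 0 → (specInd α s ξ * starRingEnd ℂ (specInd α t ξ)).re =
      (specConst α)⁻¹ * ((1 - Real.cos (s * ξ)) * |ξ| ^ (-1 - α) +
        (1 - Real.cos (t * ξ)) * |ξ| ^ (-1 - α) -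
        (1 - Real.cos ((s - t) * ξ)) * |ξ| ^ (-1 - α)) := by
    intro ξ hξ
    have hx : 0 < |ξ| := abs_pos.2 hξ
    have e1 : specInd α s ξ * starRingEnd ℂ (specInd α t ξ) =
        ((((specConst α)⁻¹ * |ξ| ^ (1 - α)) : ℝ) : ℂ) *
          (indHat s ξ * starRingEnd ℂ (indHat t ξ)) := by
      rw [← specWeight_sq h0 h2]
      simp only [specInd, map_mul, Complex.conj_ofReal]
      push_cast; ring
    have e2 : indHat s ξ * starRingEnd ℂ (indHat t ξ) = (((ξ ^ 2)⁻¹ : ℝ) : ℂ) *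
        ((Complex.exp (s * ξ * Complex.I) - 1) *
          starRingEnd ℂ (Complex.exp (t * ξ * Complex.I) - 1)) := by
      have : (ξ : ℂ) ≠ 0 := by exact_mod_cast hξ
      rw [indHat_eq s hξ, indHat_eq t hξ, map_div₀, map_mul, Complex.conj_ofReal, Complex.conj_I]
      push_cast
      rw [div_mul_div_comm, inv_mul_eq_div]
      congr 1
      ring_nf; simp
    rw [e1, e2, ← mul_assoc, ← Complex.ofReal_mul, Complex.re_ofReal_mul, ← Complex.ofReal_mul,
      ← Complex.ofReal_mul]
    simp only [Complex.mul_re, Complex.conj_re, Complex.conj_im, Complex.sub_re, Complex.sub_im,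
      Complex.exp_ofReal_mul_I_re, Complex.exp_ofReal_mul_I_im, Complex.one_re, Complex.one_im]
    rw [sub_mul s t ξ, Real.cos_sub, show (1 - α) = (-1 - α) + 2 by ring, Real.rpow_add hx,
      Real.rpow_two, sq_abs]
    field_simp
    ring
  apply Complex.ext
  · rw [Complex.ofReal_re]
    have : (∫ ξ, specInd α s ξ * starRingEnd ℂ (specInd α t ξ)).re =
        ∫ ξ, (specInd α s ξ * starRingEnd ℂ (specInd α t ξ)).re := (integral_re hi).symm
    rw [this]
    have hae : ∀ᵐ ξ : ℝ, ξ ≠ 0 := by simp [ae_iff, measure_singleton]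
    rw [integral_congr_ae (hae.mono hre), integral_const_mul, integral_sub, integral_add,
      integral_one_sub_cos h0, integral_one_sub_cos h0, integral_one_sub_cos h0,
      abs_of_nonneg hs, abs_of_nonneg ht]
    · field_simp
    · exact integrable_one_sub_cos h0 h2 s
    · exact integrable_one_sub_cos h0 h2 t
    · exact (integrable_one_sub_cos h0 h2 s).add (integrable_one_sub_cos h0 h2 t)
    · exact integrable_one_sub_cos h0 h2 (s - t)
  · rw [him, Complex.ofReal_im]

/-! ### Tensor norms of step functions as L² norms over the frequency plane. -/

theorem integral_norm_sq_eq {X : Type*} [MeasurableSpace X] {μ : Measure X} {g : X → ℂ}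
    (hg : MemLp g 2 μ) : ∫ x, ‖g x‖ ^ 2 ∂μ = (eLpNorm g 2 μ).toReal ^ 2 := by
  rw [hg.eLpNorm_eq_integral_rpow_norm (by norm_num) (by norm_num)]
  have h : 0 ≤ ∫ x, ‖g x‖ ^ 2 ∂μ := integral_nonneg fun x => by positivity
  rw [ENNReal.toReal_ofReal (by positivity)]
  norm_num
  rw [← Real.sqrt_eq_rpow, Real.sq_sqrt h]

theorem tendsto_integral_norm_sq {X : Type*} [MeasurableSpace X] {μ : Measure X} {g : ℕ → X → ℂ}
    {G : X → ℂ} (hg : ∀ n, MemLp (g n) 2 μ) (hG : MemLp G 2 μ)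
    (h : Tendsto (fun n => eLpNorm (g n - G) 2 μ) atTop (𝓝 0)) :
    Tendsto (fun n => ∫ x, ‖g n x‖ ^ 2 ∂μ) atTop (𝓝 (∫ x, ‖G x‖ ^ 2 ∂μ)) := by
  simp_rw [fun n => integral_norm_sq_eq (hg n), integral_norm_sq_eq hG]
  refine Tendsto.pow ?_ 2
  have h1 : Tendsto (fun n => (eLpNorm (g n - G) 2 μ).toReal) atTop (𝓝 0) := by
    simpa [Function.comp_def] using (ENNReal.tendsto_toReal ENNReal.zero_ne_top).comp h
  rw [tendsto_iff_dist_tendsto_zero]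
  refine squeeze_zero (fun _ => dist_nonneg) (fun n => ?_) h1
  have a1 := (hg n).eLpNorm_ne_top
  have a2 := hG.eLpNorm_ne_top
  have a3 := ((hg n).sub hG).eLpNorm_ne_top
  rw [Real.dist_eq, abs_le]
  constructor
  · have : eLpNorm G 2 μ ≤ eLpNorm (g n) 2 μ + eLpNorm (g n - G) 2 μ := by
      have := eLpNorm_sub_le (p := 2) (hg n).1 ((hg n).sub hG).1 (by norm_num)
      simpa using this
    have := ENNReal.toReal_mono (by finiteness) this
    rw [ENNReal.toReal_add a1 a3] at this
    linarith
  · have : eLpNorm (g n) 2 μ ≤ eLpNorm G 2 μ + eLpNorm (g n - G) 2 μ := by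
      have := eLpNorm_add_le (p := 2) hG.1 ((hg n).sub hG).1 (by norm_num)
      simpa using this
    have := ENNReal.toReal_mono (by finiteness) this
    rw [ENNReal.toReal_add a2 a3] at this
    linarith

/-- The image of a step function under the spectral isometry. -/
noncomputable def specStep (α : ℝ) {T : ℝ} (φ : Step T) (z : ℝ × ℝ) : ℂ :=
  φ.sum fun ab w => (w : ℂ) * (specInd α ab.1 z.1 * specInd α ab.2 z.2)

theorem specStep_sub (α : ℝ) {T : ℝ} (φ ψ : Step T) :
    specStep α (φ - ψ) = specStep α φ - specStep α ψ := by
  ext z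
  simp only [specStep, Pi.sub_apply]
  rw [Finsupp.sum_sub_index]
  intro a b c; push_cast; ring

theorem memLp_specInd_mul {α : ℝ} (h0 : 0 < α) (h2 : α < 2) {a b : ℝ} (ha : 0 ≤ a)
    (hb : 0 ≤ b) : MemLp (fun z : ℝ × ℝ => specInd α a z.1 * specInd α b z.2) 2 := by
  have hmeas : Measurable fun z : ℝ × ℝ => specInd α a z.1 * specInd α b z.2 :=
    ((measurable_specInd α a).comp measurable_fst).mul
      ((measurable_specInd α b).comp measurable_snd)
  rw [memLp_two_iff_integrable_sq_norm hmeas.aestronglyMeasurable]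
  have h1 := (memLp_two_iff_integrable_sq_norm (measurable_specInd α a).aestronglyMeasurable).1
    (memLp_specInd h0 h2 ha)
  have h2 := (memLp_two_iff_integrable_sq_norm (measurable_specInd α b).aestronglyMeasurable).1
    (memLp_specInd h0 h2 hb)
  refine (h1.mul_prod h2).congr (Eventually.of_forall fun z => ?_)
  simp [mul_pow]

theorem memLp_specStep {α : ℝ} (h0 : 0 < α) (h2 : α < 2) {T : ℝ} (φ : Step T) :
    MemLp (specStep α φ) 2 := by
  unfold specStep Finsupp.sum
  exact memLp_finsetSum _ fun ab _ =>
    (memLp_specInd_mul h0 h2 ab.1.2.1 ab.2.2.1).const_mul _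

/-- Expanding the square gives a double sum of integrals over the plane, and each factors into two
one-variable integrals equal to covariances. -/
theorem stepInner_self {H : ℝ} (h0 : 0 < H) (h1 : H < 1) {T : ℝ} (φ : Step T) :
    stepInner H φ φ = ∫ z, ‖specStep (2 * H) φ z‖ ^ 2 := by
  have hα0 : 0 < 2 * H := by linarith
  have hα2 : 2 * H < 2 := by linarith
  set u := specInd (2 * H)
  have hterm : ∀ ab ab' : Set.Icc (0 : ℝ) T × Set.Icc (0 : ℝ) T,
      ∫ z : ℝ × ℝ, (u ab.1 z.1 * u ab.2 z.2) * starRingEnd ℂ (u ab'.1 z.1 * u ab'.2 z.2) =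
        ((cov H ab.1 ab'.1 * cov H ab.2 ab'.2 : ℝ) : ℂ) := by
    intro ab ab'
    have := integral_prod_mul (μ := volume) (ν := volume)
      (fun ξ => u ab.1 ξ * starRingEnd ℂ (u ab'.1 ξ))
      (fun ξ => u ab.2 ξ * starRingEnd ℂ (u ab'.2 ξ))
    rw [integral_specInd_mul_conj hα0 hα2 ab.1.2.1 ab'.1.2.1,
      integral_specInd_mul_conj hα0 hα2 ab.2.2.1 ab'.2.2.1] at this
    rw [Complex.ofReal_mul]
    unfold cov
    rw [← this, Measure.volume_eq_prod]
    congr 1; ext z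
    simp only [map_mul]; ring
  have hint : ∀ ab ab' : Set.Icc (0 : ℝ) T × Set.Icc (0 : ℝ) T, Integrable fun z : ℝ × ℝ =>
      (u ab.1 z.1 * u ab.2 z.2) * starRingEnd ℂ (u ab'.1 z.1 * u ab'.2 z.2) := fun ab ab' =>
    (memLp_specInd_mul hα0 hα2 ab.1.2.1 ab.2.2.1).integrable_mul
      (memLp_specInd_mul hα0 hα2 ab'.1.2.1 ab'.2.2.1).star
  have hexp : ∀ z, ((‖specStep (2 * H) φ z‖ ^ 2 : ℝ) : ℂ) = ∑ ab ∈ φ.support, ∑ ab' ∈ φ.support,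
      ((φ ab * φ ab' : ℝ) : ℂ) *
        ((u ab.1 z.1 * u ab.2 z.2) * starRingEnd ℂ (u ab'.1 z.1 * u ab'.2 z.2)) := by
    intro z
    rw [Complex.ofReal_pow, ← Complex.mul_conj']
    unfold specStep Finsupp.sum
    rw [map_sum, Finset.sum_mul_sum]
    refine Finset.sum_congr rfl fun ab _ => Finset.sum_congr rfl fun ab' _ => ?_
    simp only [map_mul, Complex.conj_ofReal]; push_cast; ring
  have : ((∫ z, ‖specStep (2 * H) φ z‖ ^ 2 : ℝ) : ℂ) = ((stepInner H φ φ : ℝ) : ℂ) := by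
    rw [← integral_complex_ofReal]
    simp_rw [hexp]
    rw [integral_finsetSum _ fun ab _ => integrable_finsetSum _ fun ab' _ =>
      (hint ab ab').const_mul _]
    unfold stepInner Finsupp.sum
    push_cast
    refine Finset.sum_congr rfl fun ab _ => ?_
    rw [integral_finsetSum _ fun ab' _ => (hint ab ab').const_mul _]
    refine Finset.sum_congr rfl fun ab' _ => ?_
    rw [integral_const_mul, hterm]
    push_cast; ring
  exact_mod_cast this.symm

/-! ### Characterising the norm of a function by its weighted Fourier transform. -/

/-- The square `[0, T]²`. -/
abbrev sq (T : ℝ) : Set (ℝ × ℝ) := Set.Icc (0 : ℝ) T ×ˢ Set.Icc (0 : ℝ) T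

theorem volume_sq_lt_top (T : ℝ) : volume (sq T) < ⊤ :=
  (isCompact_Icc.prod isCompact_Icc).measure_lt_top

/-- The character `e^{i(p₁z₁ + p₂z₂)}`. -/
noncomputable def char2 (z p : ℝ × ℝ) : ℂ :=
  Complex.exp (p.1 * z.1 * Complex.I) * Complex.exp (p.2 * z.2 * Complex.I)

theorem norm_char2 (z p : ℝ × ℝ) : ‖char2 z p‖ = 1 := by
  rw [char2, norm_mul, norm_cexp_mul_I, norm_cexp_mul_I, one_mul]

theorem continuous_char2 (z : ℝ × ℝ) : Continuous (char2 z) := by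
  unfold char2; fun_prop

/-- The product of the spectral weights in the two variables. -/
noncomputable def specWeight (α : ℝ) (z : ℝ × ℝ) : ℝ :=
  ((Real.sqrt (specConst α))⁻¹ * |z.1| ^ ((1 - α) / 2)) *
    ((Real.sqrt (specConst α))⁻¹ * |z.2| ^ ((1 - α) / 2))

/-- The image of a function on `[0, T]²` under the spectral isometry. -/
noncomputable def specFun (α T : ℝ) (f : ℝ × ℝ → ℝ) (z : ℝ × ℝ) : ℂ :=
  (specWeight α z : ℂ) * ∫ p in sq T, (f p : ℂ) * char2 z p

theorem measurable_toFun {T : ℝ} (φ : Step T) : Measurable φ.toFun := by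
  unfold Step.toFun Finsupp.sum
  have h : ∀ a : ℝ, Measurable ((Set.Icc (0 : ℝ) a).indicator (1 : ℝ → ℝ)) := fun a =>
    measurable_one.indicator measurableSet_Icc
  exact Finset.measurable_fun_sum _ fun ab _ =>
    (measurable_const.mul ((h _).comp measurable_fst)).mul ((h _).comp measurable_snd)

theorem integral_indicator_mul_cexp {a T : ℝ} (ha : a ∈ Set.Icc (0 : ℝ) T) (ξ : ℝ) :
    ∫ t in Set.Icc (0 : ℝ) T, (((Set.Icc (0 : ℝ) a).indicator (1 : ℝ → ℝ) t : ℝ) : ℂ) *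
      Complex.exp (t * ξ * Complex.I) = indHat a ξ := by
  have : ∀ t : ℝ, (((Set.Icc (0 : ℝ) a).indicator (1 : ℝ → ℝ) t : ℝ) : ℂ) *
      Complex.exp (t * ξ * Complex.I) =
      (Set.Icc (0 : ℝ) a).indicator (fun t : ℝ => Complex.exp (t * ξ * Complex.I)) t := by
    intro t
    by_cases ht : t ∈ Set.Icc (0 : ℝ) a <;> simp [ht]
  simp_rw [this]
  rw [setIntegral_indicator measurableSet_Icc,
    Set.inter_eq_self_of_subset_right (Set.Icc_subset_Icc_right ha.2), indHat,
    intervalIntegral.integral_of_le ha.1, integral_Icc_eq_integral_Ioc]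

theorem specStep_eq_specFun (α : ℝ) {T : ℝ} (φ : Step T) (z : ℝ × ℝ) :
    specStep α φ z = specFun α T φ.toFun z := by
  have hI : ∀ ab ∈ φ.support, Integrable (fun p : ℝ × ℝ => (φ ab : ℂ) *
      (((((Set.Icc (0 : ℝ) ab.1).indicator (1 : ℝ → ℝ) p.1 : ℝ) : ℂ) *
        Complex.exp (p.1 * z.1 * Complex.I)) *
      ((((Set.Icc (0 : ℝ) ab.2).indicator (1 : ℝ → ℝ) p.2 : ℝ) : ℂ) *
        Complex.exp (p.2 * z.2 * Complex.I)))) (volume.restrict (sq T)) := by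
    intro ab _
    refine Integrable.const_mul ?_ _
    rw [Measure.volume_eq_prod, ← Measure.prod_restrict]
    have h1 : ∀ a ξ : ℝ, IntegrableOn (fun t : ℝ =>
        (((Set.Icc (0 : ℝ) a).indicator (1 : ℝ → ℝ) t : ℝ) : ℂ) *
        Complex.exp (t * ξ * Complex.I)) (Set.Icc 0 T) := by
      intro a ξ
      refine Measure.integrableOn_of_bounded (M := 1) measure_Icc_lt_top.ne ?_ ?_
      · have : Measurable ((Set.Icc (0 : ℝ) a).indicator (1 : ℝ → ℝ)) :=
          measurable_one.indicator measurableSet_Icc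
        exact (by fun_prop : Measurable _).aestronglyMeasurable
      · refine Eventually.of_forall fun t => ?_
        rw [norm_mul, norm_cexp_mul_I, mul_one, Complex.norm_real]
        by_cases ht : t ∈ Set.Icc (0 : ℝ) a <;> simp [ht]
    exact (h1 _ _).mul_prod (h1 _ _)
  have e : ∀ p : ℝ × ℝ, (φ.toFun p : ℂ) * char2 z p = ∑ ab ∈ φ.support, (φ ab : ℂ) *
      (((((Set.Icc (0 : ℝ) ab.1).indicator (1 : ℝ → ℝ) p.1 : ℝ) : ℂ) *
        Complex.exp (p.1 * z.1 * Complex.I)) *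
      ((((Set.Icc (0 : ℝ) ab.2).indicator (1 : ℝ → ℝ) p.2 : ℝ) : ℂ) *
        Complex.exp (p.2 * z.2 * Complex.I))) := by
    intro p
    unfold Step.toFun Finsupp.sum char2
    rw [Complex.ofReal_sum, Finset.sum_mul]
    refine Finset.sum_congr rfl fun ab _ => ?_
    push_cast; ring
  unfold specFun
  simp_rw [e]
  rw [integral_finsetSum _ hI, Finset.mul_sum]
  unfold specStep Finsupp.sum
  refine Finset.sum_congr rfl fun ab _ => ?_
  rw [integral_const_mul, Measure.volume_eq_prod]
  rw [setIntegral_prod_mul (μ := volume) (ν := volume)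
    (fun t : ℝ => (((Set.Icc (0 : ℝ) ab.1).indicator (1 : ℝ → ℝ) t : ℝ) : ℂ) *
        Complex.exp (t * z.1 * Complex.I))
    (fun t : ℝ => (((Set.Icc (0 : ℝ) ab.2).indicator (1 : ℝ → ℝ) t : ℝ) : ℂ) *
        Complex.exp (t * z.2 * Complex.I)), integral_indicator_mul_cexp ab.1.2,
    integral_indicator_mul_cexp ab.2.2]
  simp only [specInd, specWeight]; push_cast; ring

theorem memLp_toFun {T : ℝ} (φ : Step T) : MemLp φ.toFun 2 (volume.restrict (sq T)) := by
  have : IsFiniteMeasure (volume.restrict (sq T)) := ⟨by simpa using volume_sq_lt_top T⟩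
  refine MemLp.of_bound (measurable_toFun φ).aestronglyMeasurable
    (∑ ab ∈ φ.support, |φ ab|) (Eventually.of_forall fun p => ?_)
  unfold Step.toFun Finsupp.sum
  refine (norm_sum_le _ _).trans (Finset.sum_le_sum fun ab _ => ?_)
  rw [norm_mul, norm_mul, Real.norm_eq_abs]
  have h : ∀ a t : ℝ, ‖(Set.Icc (0 : ℝ) a).indicator (1 : ℝ → ℝ) t‖ ≤ 1 := by
    intro a t
    by_cases ht : t ∈ Set.Icc (0 : ℝ) a <;> simp [ht]
  have h1 := h ab.1 p.1
  have h2 := h ab.2 p.2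
  calc _ ≤ |φ ab| * 1 * 1 := by gcongr
    _ = _ := by ring

/-- The square has finite measure, so L² convergence implies L¹ convergence, and the characters are
bounded by 1. Convergence holds at every frequency, which later identifies the L² limit without
passing to subsequences. -/
theorem tendsto_specFun {α T : ℝ} {f : ℝ × ℝ → ℝ} (hf : MemLp f 2 (volume.restrict (sq T)))
    {φ : ℕ → Step T}
    (h : Tendsto (fun n => eLpNorm (fun p => (φ n).toFun p - f p) 2 (volume.restrict (sq T)))
      atTop (𝓝 0)) (z : ℝ × ℝ) :
    Tendsto (fun n => specStep α (φ n) z) atTop (𝓝 (specFun α T f z)) := by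
  have : IsFiniteMeasure (volume.restrict (sq T)) := ⟨by simpa using volume_sq_lt_top T⟩
  simp_rw [specStep_eq_specFun]
  unfold specFun
  refine Tendsto.const_mul _ ?_
  have hi : ∀ g : ℝ × ℝ → ℝ, MemLp g 2 (volume.restrict (sq T)) →
      Integrable (fun p => (g p : ℂ) * char2 z p) (volume.restrict (sq T)) := by
    intro g hg
    have h1 : Integrable g (volume.restrict (sq T)) := hg.integrable (by norm_num)
    exact h1.ofReal.mul_bdd (c := 1) (continuous_char2 z).aestronglyMeasurable
      (Eventually.of_forall fun p => (norm_char2 z p).le)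
  refine tendsto_integral_of_L1 _ (hi f hf).1
    (Eventually.of_forall fun n => hi _ (memLp_toFun (φ n))) ?_
  have hb : ∀ n, ∫⁻ p in sq T, ‖((φ n).toFun p : ℂ) * char2 z p - (f p : ℂ) * char2 z p‖ₑ ≤
      eLpNorm (fun p => (φ n).toFun p - f p) 2 (volume.restrict (sq T)) *
        (volume.restrict (sq T)) Set.univ ^ ((1 : ℝ) / 2) := by
    intro n
    have hm : AEStronglyMeasurable (fun p => (φ n).toFun p - f p) (volume.restrict (sq T)) :=
      ((memLp_toFun (φ n)).sub hf).1
    have := eLpNorm_le_eLpNorm_mul_rpow_measure_univ (p := 1) (q := 2) (by norm_num) hm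
    rw [eLpNorm_one_eq_lintegral_enorm] at this
    refine le_trans (le_of_eq ?_) (this.trans (le_of_eq ?_))
    · refine lintegral_congr fun p => ?_
      rw [← sub_mul, enorm_mul, ← Complex.ofReal_sub]
      have : ‖char2 z p‖ₑ = 1 := by
        rw [← ofReal_norm, norm_char2]; simp
      rw [this, mul_one]
      rw [← ofReal_norm, ← ofReal_norm, Complex.norm_real]
    · norm_num
  have hfin : (volume.restrict (sq T)) Set.univ ^ ((1 : ℝ) / 2) ≠ ⊤ :=
    ENNReal.rpow_ne_top_of_nonneg (by norm_num) (measure_ne_top _ _)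
  have h3 := ENNReal.Tendsto.mul_const h (Or.inr hfin)
  rw [zero_mul] at h3
  exact tendsto_of_tendsto_of_tendsto_of_le_of_le tendsto_const_nhds h3 (fun _ => zero_le) hb

/-- Fatou's lemma: for fixed n, the difference from G is the pointwise limit over m of the
differences of the n-th and m-th terms, whose norms are small by the Cauchy condition. -/
theorem tendsto_eLpNorm_specStep_of_cauchy {H T : ℝ} (h0 : 0 < H) (h1 : H < 1) {φ : ℕ → Step T}
    {G : ℝ × ℝ → ℂ} (hlim : ∀ z, Tendsto (fun n => specStep (2 * H) (φ n) z) atTop (𝓝 (G z)))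
    (hc : Tendsto (fun mn : ℕ × ℕ => stepInner H (φ mn.1 - φ mn.2) (φ mn.1 - φ mn.2))
      atTop (𝓝 0)) :
    Tendsto (fun n => eLpNorm (specStep (2 * H) (φ n) - G) 2 volume) atTop (𝓝 0) := by
  have hα0 : 0 < 2 * H := by linarith
  have hα2 : 2 * H < 2 := by linarith
  have hm := fun n => memLp_specStep hα0 hα2 (φ n)
  rw [ENNReal.tendsto_atTop_zero]
  intro ε hε
  obtain ⟨δ, hδ0, hδε⟩ : ∃ δ : ℝ, 0 < δ ∧ ENNReal.ofReal δ ≤ ε := by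
    rcases eq_or_ne ε ⊤ with rfl | ht
    · exact ⟨1, one_pos, le_top⟩
    · exact ⟨ε.toReal, ENNReal.toReal_pos hε.ne' ht, by rw [ENNReal.ofReal_toReal ht]⟩
  have hc' := (hc.eventually_lt_const (pow_pos hδ0 2))
  rw [eventually_atTop] at hc'
  obtain ⟨⟨N1, N2⟩, hN⟩ := hc'
  refine ⟨N1, fun n hn => ?_⟩
  refine le_trans ?_ hδε
  refine Lp.eLpNorm_le_of_ae_tendsto (u := atTop)
    (f := fun m => specStep (2 * H) (φ n) - specStep (2 * H) (φ m)) ?_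
    (fun m => ((hm n).sub (hm m)).1) (Eventually.of_forall fun z => ?_)
  · filter_upwards [eventually_ge_atTop N2] with m hmN
    have h := hN (n, m) ⟨hn, hmN⟩
    simp only at h
    rw [stepInner_self h0 h1, specStep_sub, integral_norm_sq_eq ((hm n).sub (hm m))] at h
    have h2 := lt_of_pow_lt_pow_left₀ 2 hδ0.le h
    rw [← ENNReal.ofReal_toReal ((hm n).sub (hm m)).eLpNorm_ne_top]
    exact ENNReal.ofReal_le_ofReal h2.le
  · exact (hlim z).const_sub _

/-- This makes the norm well defined: its value depends on f alone and not on the approximating step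
functions. -/
theorem integral_specFun_of_hasTensorNormSq {H T x : ℝ} (h0 : 0 < H) (h1 : H < 1)
    {f : ℝ × ℝ → ℝ} (hf : MemLp f 2 (volume.restrict (sq T))) (h : HasTensorNormSq H T f x) :
    x = ∫ z, ‖specFun (2 * H) T f z‖ ^ 2 := by
  obtain ⟨φ, hL, hc, hx⟩ := h
  have hα0 : 0 < 2 * H := by linarith
  have hα2 : 2 * H < 2 := by linarith
  have hm := fun n => memLp_specStep hα0 hα2 (φ n)
  have hlim := tendsto_specFun (α := 2 * H) hf hL
  have ht := tendsto_eLpNorm_specStep_of_cauchy h0 h1 hlim hc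
  have hGm : AEStronglyMeasurable (specFun (2 * H) T f) volume :=
    aestronglyMeasurable_of_tendsto_ae atTop (fun n => (hm n).1) (Eventually.of_forall hlim)
  have hG := Lp.memLp_of_cauchy_tendsto (by norm_num) hm _ hGm ht
  have := tendsto_integral_norm_sq hm hG ht
  simp_rw [← fun n => stepInner_self h0 h1 (φ n)] at this
  exact tendsto_nhds_unique hx this

/-- Given pointwise convergence of the transforms, one dominating function yields both the Cauchy
property and the limit of the norms. Only frequency-side bounds are needed, so the cases H < 1/2 and
H > 1/2 are treated alike. -/
theorem hasTensorNormSq_of_dominated {H T : ℝ} (h0 : 0 < H) (h1 : H < 1)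
    {f : ℝ × ℝ → ℝ} (hf : MemLp f 2 (volume.restrict (sq T))) {φ : ℕ → Step T}
    (hL : Tendsto (fun n => eLpNorm (fun p => (φ n).toFun p - f p) 2 (volume.restrict (sq T)))
      atTop (𝓝 0)) {V : ℝ × ℝ → ℝ} (hV : Integrable V)
    (hb : ∀ n, ∀ z, ‖specStep (2 * H) (φ n) z‖ ^ 2 ≤ V z) :
    HasTensorNormSq H T f (∫ z, ‖specFun (2 * H) T f z‖ ^ 2) := by
  have hα0 : 0 < 2 * H := by linarith
  have hα2 : 2 * H < 2 := by linarith
  have hm := fun n => memLp_specStep hα0 hα2 (φ n)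
  have hlim := tendsto_specFun (α := 2 * H) hf hL
  set G := specFun (2 * H) T f
  have hGm : AEStronglyMeasurable G volume :=
    aestronglyMeasurable_of_tendsto_ae atTop (fun n => (hm n).1) (Eventually.of_forall hlim)
  have hGb : ∀ z, ‖G z‖ ^ 2 ≤ V z := fun z =>
    le_of_tendsto' ((hlim z).norm.pow 2) fun n => hb n z
  refine ⟨φ, hL, ?_, ?_⟩
  · have key : Tendsto (fun mn : ℕ × ℕ => ∫ z, ‖specStep (2 * H) (φ mn.1 - φ mn.2) z‖ ^ 2)
        atTop (𝓝 (∫ _z : ℝ × ℝ, (0 : ℝ))) := by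
      refine tendsto_integral_filter_of_dominated_convergence (fun z => 4 * V z)
        (Eventually.of_forall fun mn => ((memLp_specStep hα0 hα2 _).1.norm.pow 2))
        (Eventually.of_forall fun mn => Eventually.of_forall fun z => ?_) (hV.const_mul 4)
        (Eventually.of_forall fun z => ?_)
      · rw [Real.norm_of_nonneg (by positivity), specStep_sub, Pi.sub_apply]
        have a := hb mn.1 z
        have b := hb mn.2 z
        have c := norm_sub_le (specStep (2 * H) (φ mn.1) z) (specStep (2 * H) (φ mn.2) z)
        have d := pow_le_pow_left₀ (norm_nonneg _) c 2
        nlinarith [sq_nonneg (‖specStep (2 * H) (φ mn.1) z‖ - ‖specStep (2 * H) (φ mn.2) z‖)]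
      · rw [← prod_atTop_atTop_eq]
        have a := (hlim z).comp (tendsto_fst (f := atTop (α := ℕ)) (g := atTop (α := ℕ)))
        have b := (hlim z).comp (tendsto_snd (f := atTop (α := ℕ)) (g := atTop (α := ℕ)))
        have c := ((a.sub b).norm.pow 2)
        simp only [sub_self, norm_zero] at c
        simpa [specStep_sub] using c
    simp_rw [← stepInner_self h0 h1] at key
    simpa using key
  · simp_rw [stepInner_self h0 h1]
    refine tendsto_integral_of_dominated_convergence V (fun n => ((hm n).1.norm.pow 2)) hV
      (fun n => Eventually.of_forall fun z => ?_)
      (Eventually.of_forall fun z => (hlim z).norm.pow 2)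
    rw [Real.norm_of_nonneg (by positivity)]
    exact hb n z

/-! ### Grid approximations of the exponential kernel. -/

/-- The discretisation of `g ↦ ∫ e^{-(a-t)} dg(t)` over a grid: each step damps by `q` and adds the
increment of `g`. -/
def dampedSum {A : Type*} [Ring A] [Algebra ℝ A] (q : ℝ) (g : ℕ → A) : ℕ → A
  | 0 => 0
  | k + 1 => q • dampedSum q g k + (g (k + 1) - g k)

/-- The coefficient of `g i` in `dampedSum q g k`. -/
def dampedCoeff (q : ℝ) : ℕ → ℕ → ℝ
  | 0, _ => 0
  | k + 1, i => q * dampedCoeff q k i + ((if i = k + 1 then 1 else 0) - if i = k then 1 else 0)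

theorem sum_dampedCoeff {A : Type*} [Ring A] [Algebra ℝ A] (q : ℝ) (g : ℕ → A) {N k : ℕ}
    (hk : k ≤ N) : ∑ i ∈ Finset.range (N + 1), dampedCoeff q k i • g i = dampedSum q g k := by
  induction k with
  | zero => simp [dampedCoeff, dampedSum]
  | succ k ih =>
    simp only [dampedCoeff, dampedSum, add_smul, sub_smul, ite_smul, one_smul, zero_smul,
      Finset.sum_add_distrib, Finset.sum_sub_distrib, mul_smul]
    rw [← Finset.smul_sum, ih (by omega), Finset.sum_ite_eq' (Finset.range (N + 1)) (k + 1),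
      Finset.sum_ite_eq' (Finset.range (N + 1)) k, if_pos (by simp; omega), if_pos (by simp; omega)]

/-- Discrete integration by parts: the difference of g k and the damped sum is updated by a convex
combination with g k, so it never exceeds M. The bound does not grow with the number of grid points,
although the total variation of g may. -/
theorem norm_dampedSum_le {q M : ℝ} (hq0 : 0 ≤ q) (hq1 : q ≤ 1) {g : ℕ → ℂ}
    (hg : ∀ i, ‖g i‖ ≤ M) (k : ℕ) : ‖dampedSum q g k‖ ≤ 2 * M := by
  have h : ‖g k - dampedSum q g k‖ ≤ M := by
    induction k with
    | zero => simpa [dampedSum] using hg 0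
    | succ k ih =>
      have e : g (k + 1) - dampedSum q g (k + 1) =
          q • (g k - dampedSum q g k) + (1 - q) • g k := by
        simp only [dampedSum, Complex.real_smul]; push_cast; ring
      rw [e]
      refine (norm_add_le _ _).trans ?_
      rw [norm_smul, norm_smul, Real.norm_of_nonneg hq0, Real.norm_of_nonneg (by linarith)]
      nlinarith [hg k]
  have := norm_sub_le (g k) (g k - dampedSum q g k)
  rw [sub_sub_cancel] at this
  linarith [hg k]

/-- The only jump, from index j to j + 1, enters with weight 1 and is then damped once per step. -/
theorem dampedSum_indicator (q : ℝ) (j k : ℕ) :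
    dampedSum q (fun i => if j < i then (1 : ℝ) else 0) k =
      if j < k then q ^ (k - 1 - j) else 0 := by
  induction k with
  | zero => simp [dampedSum]
  | succ k ih =>
    rw [dampedSum, ih]
    rcases lt_trichotomy j k with h | h | h
    · rw [if_pos h, if_pos (by omega), if_pos h, if_pos (by omega),
        show k + 1 - 1 - j = (k - 1 - j) + 1 by omega, pow_succ]
      simp only [smul_eq_mul]; ring
    · subst h; simp
    · rw [if_neg (by omega), if_neg (by omega), if_neg (by omega), if_neg (by omega)]; simp

/-- Discrete form of the mixture formula for e^{-|t-s|}. Raising N by one multiplies the boundary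
term by q², and the new summand with weight 1 - q² restores exactly what is lost. -/
theorem sum_dampedSum_indicator_of_le (q : ℝ) {i j N : ℕ} (hij : i ≤ j) (hN : j < N) :
    (∑ k ∈ Finset.range N, (1 - q ^ 2) *
        ((if i < k then q ^ (k - 1 - i) else 0) * if j < k then q ^ (k - 1 - j) else 0)) +
      ((if i < N then q ^ (N - 1 - i) else 0) * if j < N then q ^ (N - 1 - j) else 0) =
      q ^ (j - i) := by
  induction N, hN using Nat.le_induction with
  | base =>
    rw [Finset.sum_eq_zero]
    · rw [if_pos (by omega), if_pos (by omega)]; simp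
    · intro k hk
      rw [Finset.mem_range] at hk
      rw [if_neg (show ¬ j < k by omega)]; simp
  | succ N hN ih =>
    rw [Finset.sum_range_succ, ← ih, if_pos (show i < N by omega), if_pos (show j < N by omega),
      if_pos (show i < N + 1 by omega), if_pos (show j < N + 1 by omega),
      show N + 1 - 1 - i = (N - 1 - i) + 1 by omega, show N + 1 - 1 - j = (N - 1 - j) + 1 by omega]
    ring

theorem sum_dampedSum_indicator (q : ℝ) {i j N : ℕ} (hi : i < N) (hj : j < N) :
    (∑ k ∈ Finset.range N, (1 - q ^ 2) *
        ((if i < k then q ^ (k - 1 - i) else 0) * if j < k then q ^ (k - 1 - j) else 0)) +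
      ((if i < N then q ^ (N - 1 - i) else 0) * if j < N then q ^ (N - 1 - j) else 0) =
      q ^ (Int.natAbs (i - j)) := by
  rcases le_total i j with h | h
  · rw [sum_dampedSum_indicator_of_le q h hj]; congr 1; omega
  · have := sum_dampedSum_indicator_of_le q h hi
    rw [show Int.natAbs ((i : ℤ) - j) = i - j by omega, ← this]
    congr 1
    · exact Finset.sum_congr rfl fun k _ => by ring
    · ring

/-- The step function `e^{-|t' - s'|}`, where `t'` and `s'` are `t` and `s` rounded to the grid
of mesh `T / N`. -/
noncomputable def gridStep {T : ℝ} (hT : 0 ≤ T) (N : ℕ) : Step T :=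
  let q := Real.exp (-(T / N))
  let x : ℕ → Set.Icc (0 : ℝ) T := fun i => Set.projIcc 0 T hT (i * (T / N))
  ∑ k ∈ Finset.range (N + 1), (if k = N then 1 else 1 - q ^ 2) •
    ∑ i ∈ Finset.range (N + 1), ∑ j ∈ Finset.range (N + 1),
      Finsupp.single (x i, x j) (dampedCoeff q k i * dampedCoeff q k j)

/-- Stated for a general algebra so that it serves twice: with real indicators it evaluates the step
function, and with complex transforms it evaluates its spectral image. -/
theorem sum_gridStep {A : Type*} [CommRing A] [Algebra ℝ A] {T : ℝ} (hT : 0 ≤ T) (N : ℕ)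
    (u v : Set.Icc (0 : ℝ) T → A) :
    ((gridStep hT N).sum fun ab w => w • (u ab.1 * v ab.2)) =
      (∑ k ∈ Finset.range N, (1 - Real.exp (-(T / N)) ^ 2) •
        (dampedSum (Real.exp (-(T / N))) (fun i => u (Set.projIcc 0 T hT (i * (T / N)))) k *
        dampedSum (Real.exp (-(T / N))) (fun i => v (Set.projIcc 0 T hT (i * (T / N)))) k)) +
      dampedSum (Real.exp (-(T / N))) (fun i => u (Set.projIcc 0 T hT (i * (T / N)))) N *
        dampedSum (Real.exp (-(T / N))) (fun i => v (Set.projIcc 0 T hT (i * (T / N)))) N := by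
  rw [← Finsupp.linearCombination_apply]
  unfold gridStep
  set q := Real.exp (-(T / N))
  have key : ∀ k ≤ N, ∑ i ∈ Finset.range (N + 1), ∑ j ∈ Finset.range (N + 1),
      (dampedCoeff q k i * dampedCoeff q k j) • (u (Set.projIcc 0 T hT (i * (T / N))) *
        v (Set.projIcc 0 T hT (j * (T / N)))) =
      dampedSum q (fun i => u (Set.projIcc 0 T hT (i * (T / N)))) k *
        dampedSum q (fun i => v (Set.projIcc 0 T hT (i * (T / N)))) k := by
    intro k hk
    rw [← sum_dampedCoeff q _ hk, ← sum_dampedCoeff q _ hk, Finset.sum_mul_sum]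
    refine Finset.sum_congr rfl fun i _ => Finset.sum_congr rfl fun j _ => ?_
    rw [smul_mul_smul_comm]
  simp only [map_sum, map_smul, Finsupp.linearCombination_single]
  rw [Finset.sum_range_succ]
  congr 1
  · refine Finset.sum_congr rfl fun k hk => ?_
    rw [Finset.mem_range] at hk
    rw [key k hk.le, if_neg hk.ne]
  · rw [key N le_rfl, if_pos rfl, one_smul]

theorem projIcc_grid {T : ℝ} (hT : 0 ≤ T) {N i : ℕ} (hi : i ≤ N) :
    ((Set.projIcc 0 T hT (i * (T / N)) : Set.Icc (0 : ℝ) T) : ℝ) = i * (T / N) := by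
  rcases Nat.eq_zero_or_pos N with rfl | hN
  · simp [Set.projIcc, hT]
  have hN' : (0 : ℝ) < N := by exact_mod_cast hN
  have hi' : (i : ℝ) ≤ N := by exact_mod_cast hi
  rw [Set.projIcc_of_mem hT ⟨by positivity, ?_⟩]
  calc (i : ℝ) * (T / N) ≤ N * (T / N) := by gcongr
    _ = T := by field_simp

theorem dampedSum_congr {A : Type*} [Ring A] [Algebra ℝ A] (q : ℝ) {g g' : ℕ → A} {k : ℕ}
    (h : ∀ i ≤ k, g i = g' i) : dampedSum q g k = dampedSum q g' k := by
  induction k with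
  | zero => rfl
  | succ k ih =>
    rw [dampedSum, dampedSum, ih fun i hi => h i (by omega), h _ le_rfl, h k (by omega)]

theorem exists_grid_cell {T t : ℝ} (ht : t ∈ Set.Ioc 0 T) {N : ℕ} (hN : 0 < N) :
    -- Cells are open on the left: the indicator of [0, x_i] contains t exactly when j < i, matching
    -- `dampedSum_indicator`.
    ∃ j : ℕ, j < N ∧ j * (T / N) < t ∧ t ≤ (j + 1) * (T / N) := by
  have hN' : (0 : ℝ) < N := by exact_mod_cast hN
  have hT : 0 < T := ht.1.trans_le ht.2
  have hh : 0 < T / N := by positivity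
  have h1 : 0 < ⌈t / (T / N)⌉₊ := Nat.ceil_pos.2 (div_pos ht.1 hh)
  obtain ⟨j, hj⟩ := Nat.exists_eq_succ_of_ne_zero h1.ne'
  have h2 : t / (T / N) ≤ j + 1 := by
    have := Nat.le_ceil (t / (T / N)); rw [hj] at this; exact_mod_cast this
  have h3 : (j : ℝ) < t / (T / N) := by
    apply Nat.lt_ceil.1; rw [hj]; exact Nat.lt_succ_self j
  refine ⟨j, ?_, (lt_div_iff₀ hh).1 h3, (div_le_iff₀ hh).1 h2⟩
  have : (j : ℝ) < N := by
    refine h3.trans_le ?_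
    rw [div_le_iff₀ hh]
    calc t ≤ T := ht.2
      _ = N * (T / N) := by field_simp
  exact_mod_cast this

theorem dampedSum_grid_indicator {T t : ℝ} (hT : 0 ≤ T) {N j : ℕ} (q : ℝ)
    (h1 : j * (T / N) < t) (h2 : t ≤ (j + 1) * (T / N)) {k : ℕ} (hk : k ≤ N) :
    dampedSum q (fun i => (Set.Icc (0 : ℝ)
      (Set.projIcc 0 T hT (i * (T / N)) : Set.Icc (0 : ℝ) T)).indicator (1 : ℝ → ℝ) t) k =
      if j < k then q ^ (k - 1 - j) else 0 := by
  rw [← dampedSum_indicator]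
  refine dampedSum_congr q fun i hi => ?_
  have hh : 0 ≤ T / N := by positivity
  have ht : 0 < t := lt_of_le_of_lt (by positivity) h1
  rw [projIcc_grid hT (hi.trans hk)]
  by_cases hji : j < i
  · have : ((j : ℝ) + 1) ≤ i := by exact_mod_cast hji
    rw [if_pos hji, Set.indicator_of_mem]
    · rfl
    · exact ⟨ht.le, h2.trans (by gcongr)⟩
  · have : (i : ℝ) ≤ j := by exact_mod_cast not_lt.1 hji
    rw [if_neg hji, Set.indicator_of_notMem]
    rintro ⟨_, h⟩
    have : (i : ℝ) * (T / N) ≤ j * (T / N) := by gcongr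
    linarith

theorem abs_exp_neg_sub_exp_neg_le {x y : ℝ} (hx : 0 ≤ x) (hy : 0 ≤ y) :
    |Real.exp (-x) - Real.exp (-y)| ≤ |x - y| := by
  wlog h : x ≤ y generalizing x y
  · rw [abs_sub_comm, abs_sub_comm x y]; exact this hy hx (le_of_not_ge h)
  have h1 : Real.exp (-y) ≤ Real.exp (-x) := Real.exp_le_exp.2 (by linarith)
  have h2 : Real.exp (-y) = Real.exp (-x) * Real.exp (-(y - x)) := by
    rw [← Real.exp_add]; congr 1; ring
  have h3 := Real.add_one_le_exp (-(y - x))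
  have h4 : Real.exp (-x) ≤ 1 := Real.exp_le_one_iff.2 (by linarith)
  rw [abs_of_nonneg (by linarith), abs_of_nonpos (by linarith), h2]
  nlinarith [Real.exp_pos (-x)]

/-- Both coordinates are rounded down, by at most one mesh each, so their difference moves by at
most one mesh; and e^{-|·|} is 1-Lipschitz. -/
theorem abs_gridStep_sub_fT_le {T : ℝ} (hT : 0 ≤ T) {N : ℕ} (hN : 0 < N) {p : ℝ × ℝ}
    (h1 : p.1 ∈ Set.Ioc 0 T) (h2 : p.2 ∈ Set.Ioc 0 T) :
    |(gridStep hT N).toFun p - fT T p| ≤ T / N := by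
  obtain ⟨i, hiN, hi1, hi2⟩ := exists_grid_cell h1 hN
  obtain ⟨j, hjN, hj1, hj2⟩ := exists_grid_cell h2 hN
  have hh : 0 ≤ T / N := by positivity
  have hval : (gridStep hT N).toFun p = Real.exp (-|(i : ℝ) * (T / N) - j * (T / N)|) := by
    have := sum_gridStep hT N
      (fun a => (Set.Icc (0 : ℝ) a).indicator (1 : ℝ → ℝ) p.1)
      (fun a => (Set.Icc (0 : ℝ) a).indicator (1 : ℝ → ℝ) p.2)
    have e : (gridStep hT N).toFun p = (gridStep hT N).sum fun ab w =>
        w • ((Set.Icc (0 : ℝ) ab.1).indicator (1 : ℝ → ℝ) p.1 *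
          (Set.Icc (0 : ℝ) ab.2).indicator (1 : ℝ → ℝ) p.2) := by
      unfold Step.toFun
      refine Finsupp.sum_congr fun ab _ => ?_
      rw [smul_eq_mul, mul_assoc]
    rw [e, this, dampedSum_grid_indicator hT _ hi1 hi2 le_rfl,
      dampedSum_grid_indicator hT _ hj1 hj2 le_rfl]
    have e2 := sum_dampedSum_indicator (Real.exp (-(T / N))) hiN hjN
    have e3 : ∀ k ∈ Finset.range N, (1 - Real.exp (-(T / N)) ^ 2) •
        (dampedSum (Real.exp (-(T / N))) (fun i => (Set.Icc (0 : ℝ)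
          (Set.projIcc 0 T hT (i * (T / N)) : Set.Icc (0 : ℝ) T)).indicator (1 : ℝ → ℝ) p.1) k *
        dampedSum (Real.exp (-(T / N))) (fun i => (Set.Icc (0 : ℝ)
          (Set.projIcc 0 T hT (i * (T / N)) : Set.Icc (0 : ℝ) T)).indicator (1 : ℝ → ℝ) p.2) k) =
        (1 - Real.exp (-(T / N)) ^ 2) *
        ((if i < k then Real.exp (-(T / N)) ^ (k - 1 - i) else 0) *
          if j < k then Real.exp (-(T / N)) ^ (k - 1 - j) else 0) := by
      intro k hk
      rw [Finset.mem_range] at hk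
      rw [dampedSum_grid_indicator hT _ hi1 hi2 hk.le, dampedSum_grid_indicator hT _ hj1 hj2 hk.le,
        smul_eq_mul]
    rw [Finset.sum_congr rfl e3, e2, ← Real.exp_nat_mul]
    congr 1
    have : ((Int.natAbs ((i : ℤ) - j) : ℕ) : ℝ) = |(i : ℝ) - j| := by
      rw [← Int.cast_natCast, Int.natCast_natAbs]; push_cast; ring
    rw [this, ← sub_mul, abs_mul, abs_of_nonneg hh]; ring
  have hf : fT T p = Real.exp (-|p.1 - p.2|) := by
    unfold fT
    exact Set.indicator_of_mem (Set.mk_mem_prod (Set.Ioc_subset_Icc_self h1)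
      (Set.Ioc_subset_Icc_self h2)) _
  rw [hval, hf]
  refine (abs_exp_neg_sub_exp_neg_le (abs_nonneg _) (abs_nonneg _)).trans ?_
  refine (abs_abs_sub_abs_le _ _).trans ?_
  rw [abs_le]
  constructor <;> nlinarith

theorem measurable_fT (T : ℝ) : Measurable (fT T) := by
  unfold fT
  exact (by fun_prop : Measurable fun p : ℝ × ℝ => Real.exp (-|p.1 - p.2|)).indicator
    (measurableSet_Icc.prod measurableSet_Icc)

theorem memLp_fT (T : ℝ) : MemLp (fT T) 2 (volume.restrict (sq T)) := by
  have : IsFiniteMeasure (volume.restrict (sq T)) := ⟨by simpa using volume_sq_lt_top T⟩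
  refine MemLp.of_bound (measurable_fT T).aestronglyMeasurable 1 (Eventually.of_forall fun p => ?_)
  unfold fT
  refine (norm_indicator_le_norm_self _ _).trans ?_
  rw [Real.norm_of_nonneg (Real.exp_pos _).le]
  exact Real.exp_le_one_iff.2 (by simp)

theorem tendsto_eLpNorm_gridStep_sub_fT {T : ℝ} (hT : 0 ≤ T) :
    Tendsto (fun n : ℕ => eLpNorm (fun p => (gridStep hT (n + 1)).toFun p - fT T p) 2
      (volume.restrict (sq T))) atTop (𝓝 0) := by
  have : IsFiniteMeasure (volume.restrict (sq T)) := ⟨by simpa using volume_sq_lt_top T⟩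
  have hb : ∀ n : ℕ, eLpNorm (fun p => (gridStep hT (n + 1)).toFun p - fT T p) 2
      (volume.restrict (sq T)) ≤ (volume.restrict (sq T)) Set.univ ^ ((2 : ENNReal).toReal⁻¹) *
        ENNReal.ofReal (T / ((n + 1 : ℕ) : ℝ)) := by
    intro n
    refine eLpNorm_le_of_ae_bound ?_
    -- The left-open cells miss the coordinate axes, which are null sets.
    have hne : ∀ᵐ x : ℝ, x ≠ 0 := by simp [ae_iff, measure_singleton]
    have e1 : ∀ᵐ p : ℝ × ℝ, p.1 ≠ 0 := Measure.quasiMeasurePreserving_fst.ae hne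
    have e2 : ∀ᵐ p : ℝ × ℝ, p.2 ≠ 0 := Measure.quasiMeasurePreserving_snd.ae hne
    filter_upwards [ae_restrict_of_ae e1, ae_restrict_of_ae e2,
      ae_restrict_mem (measurableSet_Icc.prod measurableSet_Icc)] with p h1 h2 hp
    exact abs_gridStep_sub_fT_le hT (Nat.succ_pos n)
      ⟨lt_of_le_of_ne hp.1.1 (Ne.symm h1), hp.1.2⟩ ⟨lt_of_le_of_ne hp.2.1 (Ne.symm h2), hp.2.2⟩
  have hfin : (volume.restrict (sq T)) Set.univ ^ ((2 : ENNReal).toReal⁻¹) ≠ ⊤ :=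
    ENNReal.rpow_ne_top_of_nonneg (by norm_num) (measure_ne_top _ _)
  have h1 : Tendsto (fun n : ℕ => T / ((n + 1 : ℕ) : ℝ)) atTop (𝓝 0) :=
    (tendsto_const_div_atTop_nhds_zero_nat T).comp (tendsto_add_atTop_nat 1)
  have h2 := ENNReal.Tendsto.const_mul (ENNReal.tendsto_ofReal h1) (Or.inr hfin)
  rw [ENNReal.ofReal_zero, mul_zero] at h2
  exact tendsto_of_tendsto_of_tendsto_of_le_of_le tendsto_const_nhds h2 (fun _ => zero_le) hb

theorem norm_specInd_sq_le {α : ℝ} (h0 : 0 < α) (h2 : α < 2) {a : ℝ} (ha : 0 ≤ a) (ξ : ℝ) :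
    ‖specInd α a ξ‖ ^ 2 ≤ (specConst α)⁻¹ * ((a ^ 2 + 4) * specDensity α ξ) := by
  rw [specInd, norm_mul, mul_pow, Complex.norm_real, Real.norm_eq_abs, sq_abs,
    specWeight_sq h0 h2, mul_assoc]
  have := (specConst_pos h0 h2)
  exact mul_le_mul_of_nonneg_left (abs_rpow_mul_norm_indHat_sq_le ha ξ) (by positivity)

/-- Each damped sum costs a factor 2, hence 4 per product, and the total weight of the products is
N(1 - q²) + 1 ≤ 2T + 1. The resulting bound is independent of N and integrable in z. -/
theorem norm_specStep_gridStep_sq_le {α : ℝ} (h0 : 0 < α) (h2 : α < 2) {T : ℝ} (hT : 0 ≤ T)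
    {N : ℕ} (hN : 0 < N) (z : ℝ × ℝ) :
    ‖specStep α (gridStep hT N) z‖ ^ 2 ≤ (4 * (2 * T + 1)) ^ 2 *
      (((specConst α)⁻¹ * ((T ^ 2 + 4) * specDensity α z.1)) *
        ((specConst α)⁻¹ * ((T ^ 2 + 4) * specDensity α z.2))) := by
  have hN' : (0 : ℝ) < N := by exact_mod_cast hN
  have hC := specConst_pos h0 h2
  set m : ℝ → ℝ := fun ξ => (specConst α)⁻¹ * ((T ^ 2 + 4) * specDensity α ξ)
  have hm0 : ∀ ξ, 0 ≤ m ξ := fun ξ => by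
    have := specDensity_nonneg α ξ
    positivity
  have hu : ∀ (a : Set.Icc (0 : ℝ) T) (ξ : ℝ), ‖specInd α a ξ‖ ≤ Real.sqrt (m ξ) := by
    intro a ξ
    refine Real.le_sqrt_of_sq_le ((norm_specInd_sq_le h0 h2 a.2.1 ξ).trans ?_)
    have := specDensity_nonneg α ξ
    have h3 : (a : ℝ) ^ 2 ≤ T ^ 2 := pow_le_pow_left₀ a.2.1 a.2.2 2
    simp only [m]
    gcongr
  have hsum := sum_gridStep hT N (fun a => specInd α a z.1) (fun a => specInd α a z.2)
  have e : specStep α (gridStep hT N) z = (gridStep hT N).sum fun ab w =>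
      w • (specInd α ab.1 z.1 * specInd α ab.2 z.2) := by
    unfold specStep
    refine Finsupp.sum_congr fun ab _ => ?_
    rw [Complex.real_smul]
  set q := Real.exp (-(T / N)) with hq
  have hq0 : 0 ≤ q := (Real.exp_pos _).le
  have hq1 : q ≤ 1 := Real.exp_le_one_iff.2 (by
    have : 0 ≤ T / N := by positivity
    linarith)
  set D1 := dampedSum q (fun i => specInd α (Set.projIcc 0 T hT (i * (T / N))) z.1)
  set D2 := dampedSum q (fun i => specInd α (Set.projIcc 0 T hT (i * (T / N))) z.2)
  have hD1 : ∀ k, ‖D1 k‖ ≤ 2 * Real.sqrt (m z.1) :=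
    norm_dampedSum_le hq0 hq1 fun i => hu _ _
  have hD2 : ∀ k, ‖D2 k‖ ≤ 2 * Real.sqrt (m z.2) :=
    norm_dampedSum_le hq0 hq1 fun i => hu _ _
  have hD : ∀ k, ‖D1 k * D2 k‖ ≤ 4 * (Real.sqrt (m z.1) * Real.sqrt (m z.2)) := by
    intro k
    rw [norm_mul]
    calc _ ≤ (2 * Real.sqrt (m z.1)) * (2 * Real.sqrt (m z.2)) := by
          gcongr
          · exact hD1 k
          · exact hD2 k
      _ = _ := by ring
  have hq2 : 0 ≤ 1 - q ^ 2 := by nlinarith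
  have hqN : N * (1 - q ^ 2) ≤ 2 * T := by
    have h3 : q ^ 2 = Real.exp (-(2 * T / N)) := by
      rw [hq, ← Real.exp_nat_mul]; congr 1; push_cast; ring
    have h4 := Real.add_one_le_exp (-(2 * T / N))
    rw [← h3] at h4
    calc N * (1 - q ^ 2) ≤ N * (2 * T / N) := by gcongr; linarith
      _ = 2 * T := by field_simp
  have hnorm : ‖specStep α (gridStep hT N) z‖ ≤
      (4 * (2 * T + 1)) * (Real.sqrt (m z.1) * Real.sqrt (m z.2)) := by
    rw [e, hsum]
    refine (norm_add_le _ _).trans ?_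
    have h5 : ‖∑ k ∈ Finset.range N, (1 - q ^ 2) • (D1 k * D2 k)‖ ≤
        N * ((1 - q ^ 2) * (4 * (Real.sqrt (m z.1) * Real.sqrt (m z.2)))) := by
      refine (norm_sum_le _ _).trans ?_
      have : ∀ k ∈ Finset.range N, ‖(1 - q ^ 2) • (D1 k * D2 k)‖ ≤
          (1 - q ^ 2) * (4 * (Real.sqrt (m z.1) * Real.sqrt (m z.2))) := by
        intro k _
        rw [norm_smul, Real.norm_of_nonneg hq2]
        gcongr
        exact hD k
      refine (Finset.sum_le_sum this).trans ?_
      simp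
    have h6 : 0 ≤ Real.sqrt (m z.1) * Real.sqrt (m z.2) := by positivity
    calc _ ≤ N * ((1 - q ^ 2) * (4 * (Real.sqrt (m z.1) * Real.sqrt (m z.2)))) +
          4 * (Real.sqrt (m z.1) * Real.sqrt (m z.2)) := add_le_add h5 (hD N)
      _ = (N * (1 - q ^ 2)) * (4 * (Real.sqrt (m z.1) * Real.sqrt (m z.2))) +
          4 * (Real.sqrt (m z.1) * Real.sqrt (m z.2)) := by ring
      _ ≤ (2 * T) * (4 * (Real.sqrt (m z.1) * Real.sqrt (m z.2))) +
          4 * (Real.sqrt (m z.1) * Real.sqrt (m z.2)) := by gcongr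
      _ = _ := by ring
  calc _ ≤ ((4 * (2 * T + 1)) * (Real.sqrt (m z.1) * Real.sqrt (m z.2))) ^ 2 :=
        pow_le_pow_left₀ (norm_nonneg _) hnorm 2
    _ = _ := by
        rw [mul_pow (4 * (2 * T + 1)), mul_pow (Real.sqrt (m z.1)), Real.sq_sqrt (hm0 _),
          Real.sq_sqrt (hm0 _)]

theorem hasTensorNormSq_fT_iff {H T : ℝ} (h0 : 0 < H) (h1 : H < 1) (hT : 0 ≤ T) (x : ℝ) :
    HasTensorNormSq H T (fT T) x ↔ x = ∫ z, ‖specFun (2 * H) T (fT T) z‖ ^ 2 := by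
  refine ⟨integral_specFun_of_hasTensorNormSq h0 h1 (memLp_fT T), ?_⟩
  rintro rfl
  have hi := integrable_specDensity (α := 2 * H) (by linarith) (by linarith)
  refine hasTensorNormSq_of_dominated h0 h1 (memLp_fT T) (tendsto_eLpNorm_gridStep_sub_fT hT)
    (V := fun z => (4 * (2 * T + 1)) ^ 2 *
      (((specConst (2 * H))⁻¹ * ((T ^ 2 + 4) * specDensity (2 * H) z.1)) *
        ((specConst (2 * H))⁻¹ * ((T ^ 2 + 4) * specDensity (2 * H) z.2)))) ?_
    (fun n z => norm_specStep_gridStep_sq_le (by linarith) (by linarith) hT (Nat.succ_pos n) z)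
  exact (((hi.const_mul _).const_mul _).mul_prod ((hi.const_mul _).const_mul _)).const_mul _

/-! ### Reduction to the covariance of the fractional Ornstein-Uhlenbeck process. -/

/-- The Fourier transform of `t ↦ e^{-(a-t)} 1_{[0,a]}(t)`. -/
noncomputable def dampHat (a ξ : ℝ) : ℂ :=
  (Complex.exp (a * ξ * Complex.I) - Real.exp (-a)) / (1 + ξ * Complex.I)

theorem one_add_mul_I_ne_zero (ξ : ℝ) : (1 + ξ * Complex.I : ℂ) ≠ 0 := by
  intro h
  have := congrArg Complex.re h
  simp at this

theorem continuous_dampHat : Continuous fun p : ℝ × ℝ => dampHat p.1 p.2 := by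
  unfold dampHat
  refine Continuous.div (by fun_prop) (by fun_prop) fun p => one_add_mul_I_ne_zero p.2

theorem norm_one_add_mul_I_sq (ξ : ℝ) : ‖(1 + ξ * Complex.I : ℂ)‖ ^ 2 = 1 + ξ ^ 2 := by
  rw [Complex.sq_norm, Complex.normSq_apply]; simp; ring

theorem norm_dampHat_sq_le {a : ℝ} (ha : 0 ≤ a) (ξ : ℝ) :
    ‖dampHat a ξ‖ ^ 2 ≤ 4 / (1 + ξ ^ 2) := by
  rw [dampHat, norm_div, div_pow, norm_one_add_mul_I_sq]
  have h1 : ‖Complex.exp (a * ξ * Complex.I) - Real.exp (-a)‖ ≤ 2 := by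
    refine (norm_sub_le _ _).trans ?_
    rw [norm_cexp_mul_I, Complex.norm_real, Real.norm_of_nonneg (Real.exp_pos _).le]
    have : Real.exp (-a) ≤ 1 := Real.exp_le_one_iff.2 (by linarith)
    linarith
  have := pow_le_pow_left₀ (norm_nonneg _) h1 2
  rw [show (2 : ℝ) ^ 2 = 4 by norm_num] at this
  gcongr

theorem integral_dampHat {a T : ℝ} (ha : a ∈ Set.Icc 0 T) (ξ : ℝ) :
    ∫ t in Set.Icc 0 T, (if t ≤ a then Complex.exp (t - a : ℝ) *
      Complex.exp (t * ξ * Complex.I) else 0) = dampHat a ξ := by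
  have e : ∀ t : ℝ, (if t ≤ a then Complex.exp (t - a : ℝ) *
      Complex.exp (t * ξ * Complex.I) else 0) = (Set.Iic a).indicator
        (fun t : ℝ => Complex.exp (-a) * Complex.exp ((1 + ξ * Complex.I) * t)) t := by
    intro t
    by_cases h : t ≤ a
    · rw [if_pos h, Set.indicator_of_mem (Set.mem_Iic.2 h), ← Complex.exp_add, ← Complex.exp_add]
      congr 1; push_cast; ring
    · rw [if_neg h, Set.indicator_of_notMem]; exact h
  simp_rw [e]
  rw [setIntegral_indicator measurableSet_Iic]
  have : Set.Icc 0 T ∩ Set.Iic a = Set.Icc 0 a := by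
    ext t; simp only [Set.mem_inter_iff, Set.mem_Icc, Set.mem_Iic]
    constructor
    · rintro ⟨⟨h1, _⟩, h3⟩; exact ⟨h1, h3⟩
    · rintro ⟨h1, h2⟩; exact ⟨⟨h1, h2.trans ha.2⟩, h2⟩
  rw [this, integral_Icc_eq_integral_Ioc, ← intervalIntegral.integral_of_le ha.1,
    intervalIntegral.integral_const_mul, integral_exp_mul_complex (one_add_mul_I_ne_zero ξ),
    dampHat, mul_div_assoc', mul_sub, ← Complex.exp_add, ← Complex.exp_add]
  congr 2
  · congr 1; ring
  · push_cast; congr 1; ring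

/-- The measure `m` with `e^{-|t-s|} = ∫ e^{-(a-t)} e^{-(a-s)} 1_{t ≤ a} 1_{s ≤ a} dm(a)`. -/
noncomputable def mixMeasure (T : ℝ) : Measure ℝ :=
  Measure.dirac T + (2 : NNReal) • volume.restrict (Set.Ioc 0 T)

instance (T : ℝ) : IsFiniteMeasure (mixMeasure T) := by
  unfold mixMeasure; infer_instance

theorem ae_mixMeasure {T : ℝ} (hT : 0 ≤ T) : ∀ᵐ a ∂mixMeasure T, a ∈ Set.Icc 0 T := by
  unfold mixMeasure
  rw [ae_add_measure_iff]
  constructor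
  · rw [ae_dirac_eq]; exact ⟨hT, le_rfl⟩
  · refine Measure.ae_smul_measure ?_ _
    filter_upwards [ae_restrict_mem measurableSet_Ioc] with a ha
    exact Set.Ioc_subset_Icc_self ha

theorem integral_mixMeasure {E : Type*} [NormedAddCommGroup E] [NormedSpace ℝ E] [CompleteSpace E]
    {T : ℝ} (hT : 0 ≤ T) {f : ℝ → E} (hf : IntegrableOn f (Set.Ioc 0 T)) :
    ∫ a, f a ∂mixMeasure T = f T + (2 : ℝ) • ∫ a in (0 : ℝ)..T, f a := by
  unfold mixMeasure
  rw [integral_add_measure, integral_dirac, integral_smul_nnreal_measure,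
    intervalIntegral.integral_of_le hT]
  · rfl
  · exact integrable_dirac (by finiteness)
  · exact Integrable.smul_measure hf (by finiteness)

/-- For t ≤ s the density part gives e^{t+s}(e^{-2s} - e^{-2T}), and the atom at T supplies the
missing e^{t+s-2T}. -/
theorem integral_exp_mixMeasure {T t s : ℝ} (hT : 0 ≤ T) (ht : t ∈ Set.Icc 0 T)
    (hs : s ∈ Set.Icc 0 T) :
    ∫ a, (if t ≤ a then Real.exp (t - a) else 0) * (if s ≤ a then Real.exp (s - a) else 0)
      ∂mixMeasure T = Real.exp (-|t - s|) := by
  wlog h : t ≤ s generalizing t s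
  · rw [abs_sub_comm, ← this hs ht (le_of_not_ge h)]
    congr 1; ext a; ring
  have e : ∀ a : ℝ, (if t ≤ a then Real.exp (t - a) else 0) *
      (if s ≤ a then Real.exp (s - a) else 0) =
      (Set.Ici s).indicator (fun a => Real.exp (t + s) * Real.exp (-2 * a)) a := by
    intro a
    by_cases h1 : s ≤ a
    · rw [if_pos h1, if_pos (h.trans h1), Set.indicator_of_mem (Set.mem_Ici.2 h1), ← Real.exp_add,
        ← Real.exp_add]
      congr 1; ring
    · rw [if_neg h1, mul_zero, Set.indicator_of_notMem]; exact h1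
  simp_rw [e]
  have hc : Continuous fun a : ℝ => Real.exp (t + s) * Real.exp (-2 * a) := by fun_prop
  rw [integral_mixMeasure hT (hc.integrableOn_Ioc.indicator measurableSet_Ici),
    Set.indicator_of_mem (Set.mem_Ici.2 hs.2), intervalIntegral.integral_of_le hT,
    ← integral_Icc_eq_integral_Ioc, setIntegral_indicator measurableSet_Ici]
  have hset : Set.Icc 0 T ∩ Set.Ici s = Set.Icc s T := by
    ext a; simp only [Set.mem_inter_iff, Set.mem_Icc, Set.mem_Ici]
    constructor
    · rintro ⟨⟨_, h2⟩, h3⟩; exact ⟨h3, h2⟩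
    · rintro ⟨h1, h2⟩; exact ⟨⟨hs.1.trans h1, h2⟩, h1⟩
  have hI : ∫ a in s..T, Real.exp (-2 * a) = (Real.exp (-2 * s) - Real.exp (-2 * T)) / 2 := by
    rw [intervalIntegral.integral_comp_mul_left (fun x => Real.exp x) (by norm_num), integral_exp,
      smul_eq_mul]
    ring
  rw [hset, integral_Icc_eq_integral_Ioc, ← intervalIntegral.integral_of_le hs.2,
    intervalIntegral.integral_const_mul, hI, abs_of_nonpos (by linarith),
    show -(-(t - s)) = (t + s) + -2 * s by ring, Real.exp_add (t + s), smul_eq_mul]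
  ring

/-- By Fubini the transform of f_T becomes a mixture of products of one-variable transforms, the
form required by `integral_norm_sq_mixture`. -/
theorem integral_fT_mul_char2 {T : ℝ} (hT : 0 ≤ T) (z : ℝ × ℝ) :
    ∫ p in sq T, (fT T p : ℂ) * char2 z p =
      ∫ a, dampHat a z.1 * dampHat a z.2 ∂mixMeasure T := by
  have hfin : IsFiniteMeasure (volume.restrict (sq T)) := ⟨by simpa using volume_sq_lt_top T⟩
  let k : ℝ → ℝ → ℝ := fun a t => if t ≤ a then Real.exp (t - a) else 0
  have hk1 : ∀ a t, ‖k a t‖ ≤ 1 := by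
    intro a t
    simp only [k]
    split_ifs with h
    · rw [Real.norm_of_nonneg (Real.exp_pos _).le]; exact Real.exp_le_one_iff.2 (by linarith)
    · simp
  have hkm : Measurable fun x : ℝ × ℝ => k x.1 x.2 :=
    Measurable.ite (measurableSet_le measurable_snd measurable_fst) (by fun_prop) measurable_const
  let F : ℝ × ℝ → ℝ → ℂ := fun p a => ((k a p.1 * k a p.2 : ℝ) : ℂ) * char2 z p
  have hF : Integrable (Function.uncurry F) ((volume.restrict (sq T)).prod (mixMeasure T)) := by
    refine Integrable.of_bound (C := 1) ?_ (Eventually.of_forall fun x => ?_)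
    · refine Measurable.aestronglyMeasurable ?_
      have h1 : Measurable fun x : (ℝ × ℝ) × ℝ => k x.2 x.1.1 :=
        hkm.comp (by fun_prop : Measurable fun x : (ℝ × ℝ) × ℝ => (x.2, x.1.1))
      have h2 : Measurable fun x : (ℝ × ℝ) × ℝ => k x.2 x.1.2 :=
        hkm.comp (by fun_prop : Measurable fun x : (ℝ × ℝ) × ℝ => (x.2, x.1.2))
      exact (Complex.measurable_ofReal.comp (h1.mul h2)).mul
        ((continuous_char2 z).measurable.comp measurable_fst)
    · simp only [Function.uncurry, F]
      rw [norm_mul, norm_char2, mul_one, Complex.norm_real, norm_mul]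
      exact mul_le_one₀ (hk1 _ _) (norm_nonneg _) (hk1 _ _)
  have e1 : ∫ p in sq T, (fT T p : ℂ) * char2 z p =
      ∫ p in sq T, ∫ a, F p a ∂mixMeasure T := by
    refine setIntegral_congr_fun (measurableSet_Icc.prod measurableSet_Icc) fun p hp => ?_
    simp only [F]
    rw [integral_mul_const, integral_complex_ofReal, integral_exp_mixMeasure hT hp.1 hp.2]
    unfold fT
    rw [Set.indicator_of_mem hp]
  rw [e1, integral_integral_swap hF]
  refine integral_congr_ae ?_
  filter_upwards [ae_mixMeasure hT] with a ha
  rw [← integral_dampHat ha z.1, ← integral_dampHat ha z.2, ← setIntegral_prod_mul,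
    Measure.volume_eq_prod]
  congr 1; ext p
  simp only [F, k, char2]
  split_ifs <;> push_cast <;> ring

/-- Mixtures of tensor squares: the `L²` norm of `∫ U_a ⊗ U_a dm(a)` in terms of the Gram kernel
`R` of the family `U`. -/
theorem integral_norm_sq_mixture {m : Measure ℝ} [IsFiniteMeasure m] {U : ℝ → ℝ → ℂ}
    (hU : Measurable fun x : ℝ × ℝ => U x.1 x.2) {D : ℝ → ℝ} (hD : Integrable D)
    (hb : ∀ᵐ a ∂m, ∀ ξ, ‖U a ξ‖ ^ 2 ≤ D ξ) {R : ℝ → ℝ → ℝ}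
    (hR : ∀ a b, ∫ ξ, U a ξ * starRingEnd ℂ (U b ξ) = (R a b : ℂ)) :
    ∫ z : ℝ × ℝ, ‖∫ a, U a z.1 * U a z.2 ∂m‖ ^ 2 = ∫ x, R x.1 x.2 ^ 2 ∂(m.prod m) := by
  let G : ℝ × ℝ → ℝ × ℝ → ℂ := fun z x =>
    (U x.1 z.1 * U x.1 z.2) * starRingEnd ℂ (U x.2 z.1 * U x.2 z.2)
  have hm : ∀ f g : (ℝ × ℝ) × (ℝ × ℝ) → ℝ, Measurable f → Measurable g →
      Measurable fun w => U (f w) (g w) := fun f g hf hg => hU.comp (hf.prodMk hg)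
  have hGm : Measurable (Function.uncurry G) := by
    refine ((hm _ _ ?_ ?_).mul (hm _ _ ?_ ?_)).mul
      (Complex.continuous_conj.measurable.comp ((hm _ _ ?_ ?_).mul (hm _ _ ?_ ?_))) <;> fun_prop
  have hDz : Integrable fun z : ℝ × ℝ => D z.1 * D z.2 := hD.mul_prod hD
  have hb1 : ∀ᵐ x ∂(m.prod m), ∀ ξ, ‖U x.1 ξ‖ ^ 2 ≤ D ξ := Measure.quasiMeasurePreserving_fst.ae hb
  have hb2 : ∀ᵐ x ∂(m.prod m), ∀ ξ, ‖U x.2 ξ‖ ^ 2 ≤ D ξ := Measure.quasiMeasurePreserving_snd.ae hb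
  have hGi : Integrable (Function.uncurry G) (volume.prod (m.prod m)) := by
    have h1 : Integrable (fun w : (ℝ × ℝ) × (ℝ × ℝ) => (D w.1.1 * D w.1.2) * 1)
        (volume.prod (m.prod m)) := hDz.mul_prod (integrable_const (1 : ℝ))
    refine h1.mono' hGm.aestronglyMeasurable ?_
    have c1 := (Measure.quasiMeasurePreserving_snd (μ := (volume : Measure (ℝ × ℝ)))
      (ν := m.prod m)).ae hb1
    have c2 := (Measure.quasiMeasurePreserving_snd (μ := (volume : Measure (ℝ × ℝ)))
      (ν := m.prod m)).ae hb2
    filter_upwards [c1, c2] with w h3 h4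
    simp only [Function.uncurry, G, norm_mul, RCLike.norm_conj, mul_one]
    have a1 := h3 w.1.1
    have a2 := h3 w.1.2
    have a3 := h4 w.1.1
    have a4 := h4 w.1.2
    -- The arithmetic-geometric mean inequality reduces the mixed product to the two diagonal
    -- bounds.
    have b1 : ‖U w.2.1 w.1.1‖ * ‖U w.2.2 w.1.1‖ ≤ D w.1.1 := by
      nlinarith [sq_nonneg (‖U w.2.1 w.1.1‖ - ‖U w.2.2 w.1.1‖)]
    have b2 : ‖U w.2.1 w.1.2‖ * ‖U w.2.2 w.1.2‖ ≤ D w.1.2 := by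
      nlinarith [sq_nonneg (‖U w.2.1 w.1.2‖ - ‖U w.2.2 w.1.2‖)]
    calc _ = (‖U w.2.1 w.1.1‖ * ‖U w.2.2 w.1.1‖) * (‖U w.2.1 w.1.2‖ * ‖U w.2.2 w.1.2‖) := by ring
      _ ≤ _ := mul_le_mul b1 b2 (by positivity) (le_trans (by positivity) b1)
  have key : ((∫ z : ℝ × ℝ, ‖∫ a, U a z.1 * U a z.2 ∂m‖ ^ 2 : ℝ) : ℂ) =
      ((∫ x, R x.1 x.2 ^ 2 ∂(m.prod m) : ℝ) : ℂ) := by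
    rw [← integral_complex_ofReal, ← integral_complex_ofReal]
    have e1 : ∀ z : ℝ × ℝ, ((‖∫ a, U a z.1 * U a z.2 ∂m‖ ^ 2 : ℝ) : ℂ) =
        ∫ x, G z x ∂(m.prod m) := by
      intro z
      rw [Complex.ofReal_pow, ← Complex.mul_conj', ← integral_conj, ← integral_prod_mul]
    simp_rw [e1]
    rw [integral_integral_swap hGi]
    congr 1; ext x
    have e2 := integral_prod_mul (μ := volume) (ν := volume)
      (fun ξ => U x.1 ξ * starRingEnd ℂ (U x.2 ξ)) (fun ξ => U x.1 ξ * starRingEnd ℂ (U x.2 ξ))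
    rw [hR] at e2
    rw [Complex.ofReal_pow, pow_two, ← e2, Measure.volume_eq_prod]
    congr 1; ext z
    simp only [G, map_mul]; ring
  exact_mod_cast key

/-- The stationary covariance in spectral form. -/
noncomputable def specCov (α τ : ℝ) : ℝ :=
  (specConst α)⁻¹ * ∫ ξ, Real.cos (τ * ξ) * specDensity α ξ

theorem integrable_cos_mul_specDensity {α : ℝ} (h0 : 0 < α) (h2 : α < 2) (τ : ℝ) :
    Integrable fun ξ => Real.cos (τ * ξ) * specDensity α ξ :=
  (integrable_specDensity h0 h2).bdd_mul (c := 1) (by fun_prop)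
    (Eventually.of_forall fun ξ => by simpa using Real.abs_cos_le_one (τ * ξ))

/-- The covariance of the fractional Ornstein-Uhlenbeck process started at zero. -/
noncomputable def dampCov (α a b : ℝ) : ℝ :=
  specCov α (a - b) - Real.exp (-a) * specCov α b - Real.exp (-b) * specCov α a +
    Real.exp (-a - b) * specCov α 0

/-- The image of `t ↦ e^{-(a-t)} 1_{[0,a]}(t)` under the spectral isometry. -/
noncomputable def specDamp (α a ξ : ℝ) : ℂ :=
  (((Real.sqrt (specConst α))⁻¹ * |ξ| ^ ((1 - α) / 2) : ℝ) : ℂ) * dampHat a ξ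

theorem norm_specDamp_sq_le {α : ℝ} (h0 : 0 < α) (h2 : α < 2) {a : ℝ} (ha : 0 ≤ a) (ξ : ℝ) :
    ‖specDamp α a ξ‖ ^ 2 ≤ (specConst α)⁻¹ * (4 * specDensity α ξ) := by
  have := (specConst_pos h0 h2)
  rw [specDamp, norm_mul, mul_pow, Complex.norm_real, Real.norm_eq_abs, sq_abs,
    specWeight_sq h0 h2, mul_assoc]
  refine mul_le_mul_of_nonneg_left ?_ (by positivity)
  calc |ξ| ^ (1 - α) * ‖dampHat a ξ‖ ^ 2 ≤ |ξ| ^ (1 - α) * (4 / (1 + ξ ^ 2)) := by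
        gcongr; exact norm_dampHat_sq_le ha ξ
    _ = _ := by unfold specDensity; ring

theorem measurable_specDamp (α : ℝ) : Measurable fun x : ℝ × ℝ => specDamp α x.1 x.2 := by
  have := continuous_dampHat.measurable
  unfold specDamp
  fun_prop

/-- The two denominators 1 + iξ combine to 1 + ξ², and multiplying out the numerators leaves four
cosine transforms of `specDensity`. The imaginary part is odd. -/
theorem integral_specDamp_mul_conj {α : ℝ} (h0 : 0 < α) (h2 : α < 2) (a b : ℝ) :
    ∫ ξ, specDamp α a ξ * starRingEnd ℂ (specDamp α b ξ) = (dampCov α a b : ℂ) := by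
  have hC := specConst_pos h0 h2
  have e : ∀ ξ : ℝ, specDamp α a ξ * starRingEnd ℂ (specDamp α b ξ) =
      (((specConst α)⁻¹ * specDensity α ξ : ℝ) : ℂ) *
        ((Complex.exp (a * ξ * Complex.I) - Real.exp (-a)) *
          starRingEnd ℂ (Complex.exp (b * ξ * Complex.I) - Real.exp (-b))) := by
    intro ξ
    have e1 : specDamp α a ξ * starRingEnd ℂ (specDamp α b ξ) =
        ((((specConst α)⁻¹ * |ξ| ^ (1 - α)) : ℝ) : ℂ) *
          (dampHat a ξ * starRingEnd ℂ (dampHat b ξ)) := by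
      rw [← specWeight_sq h0 h2]
      simp only [specDamp, map_mul, Complex.conj_ofReal]
      push_cast; ring
    rw [e1, dampHat, dampHat, map_div₀, div_mul_div_comm, Complex.mul_conj',
      ← Complex.ofReal_pow, norm_one_add_mul_I_sq, specDensity]
    simp only [map_sub, Complex.conj_ofReal]
    push_cast; ring
  have hi : Integrable fun ξ => specDamp α a ξ * starRingEnd ℂ (specDamp α b ξ) := by
    simp_rw [e]
    refine Integrable.mul_bdd (c := (1 + Real.exp (-a)) * (1 + Real.exp (-b)))
      ((integrable_specDensity h0 h2).const_mul ((specConst α)⁻¹)).ofReal ?_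
      (Eventually.of_forall fun ξ => ?_)
    · exact (by fun_prop : Continuous fun ξ : ℝ =>
        (Complex.exp (a * ξ * Complex.I) - Real.exp (-a)) *
          starRingEnd ℂ (Complex.exp (b * ξ * Complex.I) - Real.exp (-b))).aestronglyMeasurable
    · have h : ∀ c : ℝ, ‖Complex.exp (c * ξ * Complex.I) - Real.exp (-c)‖ ≤ 1 + Real.exp (-c) := by
        intro c
        refine (norm_sub_le _ _).trans ?_
        rw [norm_cexp_mul_I, Complex.norm_real, Real.norm_of_nonneg (Real.exp_pos _).le]
      rw [norm_mul, RCLike.norm_conj]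
      have := Real.exp_pos (-a)
      exact mul_le_mul (h a) (h b) (norm_nonneg _) (by positivity)
  have him : (∫ ξ, specDamp α a ξ * starRingEnd ℂ (specDamp α b ξ)).im = 0 := by
    rw [← Complex.conj_eq_iff_im, ← integral_conj,
      ← integral_neg_eq_self (fun ξ => specDamp α a ξ * starRingEnd ℂ (specDamp α b ξ))]
    congr 1; ext ξ
    have hneg : ∀ c ξ : ℝ, specDamp α c (-ξ) = starRingEnd ℂ (specDamp α c ξ) := by
      intro c ξ
      simp [specDamp, dampHat, ← Complex.exp_conj]
    simp [hneg]
  apply Complex.ext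
  · rw [Complex.ofReal_re]
    have h3 : (∫ ξ, specDamp α a ξ * starRingEnd ℂ (specDamp α b ξ)).re =
        ∫ ξ, (specDamp α a ξ * starRingEnd ℂ (specDamp α b ξ)).re := (integral_re hi).symm
    have hre : ∀ ξ : ℝ, (specDamp α a ξ * starRingEnd ℂ (specDamp α b ξ)).re =
        (specConst α)⁻¹ * (Real.cos ((a - b) * ξ) * specDensity α ξ
          - Real.exp (-a) * (Real.cos (b * ξ) * specDensity α ξ)
          - Real.exp (-b) * (Real.cos (a * ξ) * specDensity α ξ)
          + Real.exp (-a - b) * (Real.cos (0 * ξ) * specDensity α ξ)) := by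
      intro ξ
      rw [e, Complex.re_ofReal_mul, ← Complex.ofReal_mul, ← Complex.ofReal_mul]
      simp only [Complex.mul_re, Complex.conj_re, Complex.conj_im, Complex.sub_re, Complex.sub_im,
        Complex.exp_ofReal_mul_I_re, Complex.exp_ofReal_mul_I_im, Complex.ofReal_re,
        Complex.ofReal_im]
      rw [sub_mul a b ξ, Real.cos_sub, zero_mul, Real.cos_zero, show -a - b = -a + -b by ring,
        Real.exp_add]
      ring
    have i1 := integrable_cos_mul_specDensity h0 h2
    rw [h3]
    simp_rw [hre]
    rw [integral_const_mul, integral_add, integral_sub, integral_sub, integral_const_mul,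
      integral_const_mul, integral_const_mul]
    · unfold dampCov specCov; ring
    · exact i1 _
    · exact (i1 _).const_mul _
    · exact (i1 _).sub ((i1 _).const_mul _)
    · exact (i1 _).const_mul _
    · exact ((i1 _).sub ((i1 _).const_mul _)).sub ((i1 _).const_mul _)
    · exact (i1 _).const_mul _
  · rw [him, Complex.ofReal_im]

theorem integral_norm_specFun_fT_sq {α : ℝ} (h0 : 0 < α) (h2 : α < 2) {T : ℝ} (hT : 0 ≤ T) :
    ∫ z, ‖specFun α T (fT T) z‖ ^ 2 =
      ∫ x, dampCov α x.1 x.2 ^ 2 ∂((mixMeasure T).prod (mixMeasure T)) := by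
  rw [← integral_norm_sq_mixture (m := mixMeasure T) (U := specDamp α)
    (D := fun ξ => (specConst α)⁻¹ * (4 * specDensity α ξ)) (measurable_specDamp α)
    (((integrable_specDensity h0 h2).const_mul 4).const_mul _) ?_
    (integral_specDamp_mul_conj h0 h2)]
  · congr 1; ext z
    rw [specFun, integral_fT_mul_char2 hT, ← integral_const_mul]
    congr 2; congr 1; ext a
    simp only [specWeight, specDamp]; push_cast; ring
  · filter_upwards [ae_mixMeasure hT] with a ha ξ
    exact norm_specDamp_sq_le h0 h2 ha.1 ξ

theorem continuous_specCov {α : ℝ} (h0 : 0 < α) (h2 : α < 2) : Continuous (specCov α) := by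
  unfold specCov
  refine continuous_const.mul ?_
  refine continuous_of_dominated (bound := specDensity α) (fun τ =>
    (integrable_cos_mul_specDensity h0 h2 τ).1) (fun τ => Eventually.of_forall fun ξ => ?_)
    (integrable_specDensity h0 h2) (Eventually.of_forall fun ξ => by fun_prop)
  rw [norm_mul, Real.norm_of_nonneg (specDensity_nonneg α ξ)]
  exact mul_le_of_le_one_left (specDensity_nonneg α ξ) (Real.abs_cos_le_one _)

theorem specCov_neg (α τ : ℝ) : specCov α (-τ) = specCov α τ := by
  simp [specCov]

theorem continuous_dampCov {α : ℝ} (h0 : 0 < α) (h2 : α < 2) :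
    Continuous fun x : ℝ × ℝ => dampCov α x.1 x.2 := by
  have := continuous_specCov h0 h2
  unfold dampCov
  fun_prop

theorem dampCov_comm (α a b : ℝ) : dampCov α a b = dampCov α b a := by
  unfold dampCov
  rw [show b - a = -(a - b) by ring, specCov_neg, show -b - a = -a - b by ring]
  ring

/-- Fubini's theorem on a triangle. -/
theorem integral_triangle_swap {F : ℝ × ℝ → ℝ} (hF : Continuous F) {T : ℝ} (hT : 0 ≤ T) :
    ∫ x in (0 : ℝ)..T, ∫ y in (0 : ℝ)..x, F (x, y) =
      ∫ y in (0 : ℝ)..T, ∫ x in y..T, F (x, y) := by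
  let G : ℝ → ℝ → ℝ := fun x y => {p : ℝ × ℝ | p.2 ≤ p.1}.indicator F (x, y)
  have hms : MeasurableSet {p : ℝ × ℝ | p.2 ≤ p.1} := measurableSet_le measurable_snd measurable_fst
  have hG : Integrable (Function.uncurry G)
      ((volume.restrict (Set.Ioc 0 T)).prod (volume.restrict (Set.Ioc 0 T))) := by
    rw [Measure.prod_restrict]
    have : IntegrableOn F (Set.Ioc 0 T ×ˢ Set.Ioc 0 T) (volume.prod volume) :=
      (hF.continuousOn.integrableOn_compact (isCompact_Icc.prod isCompact_Icc)).mono_set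
        (Set.prod_mono Set.Ioc_subset_Icc_self Set.Ioc_subset_Icc_self)
    exact this.indicator hms
  have h1 := integral_integral_swap hG
  rw [intervalIntegral.integral_of_le hT, intervalIntegral.integral_of_le hT]
  refine Eq.trans ?_ (h1.trans ?_)
  · refine setIntegral_congr_fun measurableSet_Ioc fun x hx => ?_
    have : ∀ y, G x y = (Set.Iic x).indicator (fun y => F (x, y)) y := by
      intro y; simp [G, Set.indicator]
    simp only [this]
    rw [setIntegral_indicator measurableSet_Iic, intervalIntegral.integral_of_le hx.1.le]
    congr 2; ext y
    simp only [Set.mem_Ioc, Set.mem_inter_iff, Set.mem_Iic]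
    exact ⟨fun h => ⟨⟨h.1, h.2.trans hx.2⟩, h.2⟩, fun h => ⟨h.1.1, h.2⟩⟩
  · refine setIntegral_congr_fun measurableSet_Ioc fun y hy => ?_
    have : ∀ x, G x y = (Set.Ici y).indicator (fun x => F (x, y)) x := by
      intro x; simp [G, Set.indicator]
    simp only [this]
    rw [← integral_Icc_eq_integral_Ioc, setIntegral_indicator measurableSet_Ici,
      intervalIntegral.integral_of_le hy.2, ← integral_Icc_eq_integral_Ioc]
    congr 2; ext x
    simp only [Set.mem_Icc, Set.mem_inter_iff, Set.mem_Ici]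
    exact ⟨fun h => ⟨h.2, h.1.2⟩, fun h => ⟨⟨hy.1.le.trans h.1, h.2⟩, h.1⟩⟩

/-- Atom times atom gives the corner; the two mixed terms have weight 2 each and agree by symmetry;
the density part has weight 4 on the square, hence 8 on the triangle y ≤ x. -/
theorem integral_mixMeasure_prod {ρ : ℝ × ℝ → ℝ} (hρ : Continuous ρ)
    (hsymm : ∀ a b, ρ (a, b) = ρ (b, a)) {T : ℝ} (hT : 0 ≤ T) :
    ∫ x, ρ x ∂((mixMeasure T).prod (mixMeasure T)) =
      ρ (T, T) + 4 * (∫ y in (0 : ℝ)..T, ρ (T, y)) +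
        8 * ∫ x in (0 : ℝ)..T, ∫ y in (0 : ℝ)..x, ρ (x, y) := by
  have hcT : ∀ a b : ℝ, Continuous fun x : ℝ => ∫ y in a..b, ρ (x, y) := fun a b =>
    intervalIntegral.continuous_parametric_intervalIntegral_of_continuous' (by exact hρ) a b
  have hint : Integrable ρ ((mixMeasure T).prod (mixMeasure T)) := by
    obtain ⟨M, hM⟩ := (isCompact_Icc (a := (0:ℝ)) (b := T)).prod
      (isCompact_Icc (a := (0:ℝ)) (b := T)) |>.exists_bound_of_continuousOn hρ.continuousOn
    refine Integrable.of_bound (C := M) hρ.aestronglyMeasurable ?_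
    filter_upwards [(Measure.quasiMeasurePreserving_fst (μ := mixMeasure T)
      (ν := mixMeasure T)).ae (ae_mixMeasure hT), (Measure.quasiMeasurePreserving_snd
      (μ := mixMeasure T) (ν := mixMeasure T)).ae (ae_mixMeasure hT)] with x h1 h2
    exact hM x ⟨h1, h2⟩
  have hin : ∀ x : ℝ, ∫ y, ρ (x, y) ∂mixMeasure T = ρ (x, T) + 2 * ∫ y in (0 : ℝ)..T, ρ (x, y) := by
    intro x
    have hc : Continuous fun y => ρ (x, y) := by fun_prop
    rw [integral_mixMeasure hT hc.integrableOn_Ioc, smul_eq_mul]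
  rw [integral_prod _ hint]
  simp_rw [hin]
  have hc1 : Continuous fun x => ρ (x, T) := by fun_prop
  have hc2 : Continuous fun x => ρ (x, T) + 2 * ∫ y in (0 : ℝ)..T, ρ (x, y) :=
    hc1.add ((hcT 0 T).const_mul 2)
  rw [integral_mixMeasure hT hc2.integrableOn_Ioc, smul_eq_mul,
    intervalIntegral.integral_add (hc1.intervalIntegrable _ _)
      (((hcT 0 T).const_mul 2).intervalIntegrable _ _), intervalIntegral.integral_const_mul]
  have e1 : ∫ x in (0 : ℝ)..T, ρ (x, T) = ∫ y in (0 : ℝ)..T, ρ (T, y) := by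
    congr 1; ext x; exact hsymm _ _
  have hs := integral_triangle_swap hρ hT
  have e2 : ∫ y in (0 : ℝ)..T, ∫ x in y..T, ρ (x, y) =
      ∫ x in (0 : ℝ)..T, ∫ y in x..T, ρ (x, y) := by
    congr 1; ext x; congr 1; ext y; exact hsymm _ _
  have hcx : Continuous fun x : ℝ => ∫ y in (0 : ℝ)..x, ρ (x, y) :=
    intervalIntegral.continuous_parametric_intervalIntegral_of_continuous (by exact hρ)
      continuous_id
  have e3 : ∫ x in (0 : ℝ)..T, ∫ y in (0 : ℝ)..T, ρ (x, y) =
      (∫ x in (0 : ℝ)..T, ∫ y in (0 : ℝ)..x, ρ (x, y)) +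
        ∫ x in (0 : ℝ)..T, ∫ y in x..T, ρ (x, y) := by
    have e4 : ∀ x : ℝ, (∫ y in x..T, ρ (x, y)) =
        (∫ y in (0 : ℝ)..T, ρ (x, y)) - ∫ y in (0 : ℝ)..x, ρ (x, y) := by
      intro x
      have hc : Continuous fun y => ρ (x, y) := by fun_prop
      rw [intervalIntegral.integral_interval_sub_left (hc.intervalIntegrable _ _)
        (hc.intervalIntegrable _ _)]
    simp_rw [e4]
    rw [intervalIntegral.integral_sub ((hcT 0 T).intervalIntegrable _ _)
      (hcx.intervalIntegrable _ _)]
    ring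
  rw [e1, e3, ← e2, ← hs]
  ring

/-- The squared norm of `f_T`. -/
noncomputable def normSqFT (α T : ℝ) : ℝ :=
  dampCov α T T ^ 2 + 4 * (∫ y in (0 : ℝ)..T, dampCov α T y ^ 2) +
    8 * ∫ x in (0 : ℝ)..T, ∫ y in (0 : ℝ)..x, dampCov α x y ^ 2

theorem hasTensorNormSq_fT_iff_normSqFT {H T : ℝ} (h0 : 0 < H) (h1 : H < 1) (hT : 0 ≤ T) (x : ℝ) :
    HasTensorNormSq H T (fT T) x ↔ x = normSqFT (2 * H) T := by
  have hα0 : 0 < 2 * H := by linarith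
  have hα2 : 2 * H < 2 := by linarith
  rw [hasTensorNormSq_fT_iff h0 h1 hT, integral_norm_specFun_fT_sq hα0 hα2 hT,
    integral_mixMeasure_prod (ρ := fun x => dampCov (2 * H) x.1 x.2 ^ 2)
      ((continuous_dampCov hα0 hα2).pow 2) (fun a b => by simp only [dampCov_comm _ a b]) hT]
  rfl

/-! ### The stationary covariance through incomplete exponential integrals. -/

theorem integrableOn_exp_neg_mul_rpow {s : ℝ} (hs : -1 < s) :
    IntegrableOn (fun x : ℝ => Real.exp (-x) * x ^ s) (Ioi 0) := by
  have := Real.GammaIntegral_convergent (s := s + 1) (by linarith)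
  simpa using this

theorem integral_exp_neg_mul_rpow {s : ℝ} (hs : -1 < s) :
    ∫ x in Ioi (0 : ℝ), Real.exp (-x) * x ^ s = Real.Gamma (s + 1) := by
  have := Real.Gamma_eq_integral (s := s + 1) (by linarith)
  simpa using this.symm

theorem integral_Ioi_exp_neg_mul_cos (ξ : ℝ) :
    IntegrableOn (fun x => Real.exp (-x) * Real.cos (x * ξ)) (Ioi 0) ∧
    ∫ x in Ioi (0 : ℝ), Real.exp (-x) * Real.cos (x * ξ) = 1 / (1 + ξ ^ 2) := by
  have h0 : (1 + ξ ^ 2) ≠ 0 := by positivity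
  have hE : IntegrableOn (fun x : ℝ => Real.exp (-x)) (Ioi 0) := exp_neg_integrableOn_Ioi 0 one_pos
    |>.congr_fun (fun x _ => by simp) measurableSet_Ioi
  have hi : IntegrableOn (fun x => Real.exp (-x) * Real.cos (x * ξ)) (Ioi 0) :=
    hE.mul_bdd (c := 1) (by fun_prop)
      (Eventually.of_forall fun x => by simpa using Real.abs_cos_le_one _)
  refine ⟨hi, ?_⟩
  have hd : ∀ x ∈ Ici (0 : ℝ), HasDerivAt
      (fun x => Real.exp (-x) * (ξ * Real.sin (x * ξ) - Real.cos (x * ξ)) / (1 + ξ ^ 2))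
      (Real.exp (-x) * Real.cos (x * ξ)) x := by
    intro x _
    have e1 : HasDerivAt (fun x : ℝ => Real.exp (-x)) (-Real.exp (-x)) x := by
      simpa using (hasDerivAt_neg x).exp
    have e0 : HasDerivAt (fun x : ℝ => x * ξ) ξ x := by simpa using (hasDerivAt_id x).mul_const ξ
    have := ((e1.mul ((e0.sin.const_mul ξ).sub e0.cos)).div_const (1 + ξ ^ 2))
    refine this.congr_deriv ?_
    simp only [Pi.sub_apply]
    field_simp
    ring
  have ht : Tendsto
      (fun x => Real.exp (-x) * (ξ * Real.sin (x * ξ) - Real.cos (x * ξ)) / (1 + ξ ^ 2))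
      atTop (𝓝 0) := by
    rw [← zero_div (1 + ξ ^ 2)]
    refine Tendsto.div_const ?_ _
    refine squeeze_zero_norm (a := fun x => Real.exp (-x) * (|ξ| + 1)) (fun x => ?_) ?_
    · rw [norm_mul, Real.norm_of_nonneg (Real.exp_pos _).le]
      refine mul_le_mul_of_nonneg_left ?_ (Real.exp_pos _).le
      refine (norm_sub_le _ _).trans (add_le_add ?_ (Real.abs_cos_le_one _))
      rw [norm_mul]
      exact mul_le_of_le_one_right (abs_nonneg _) (Real.abs_sin_le_one _)
    · simpa using (Real.tendsto_exp_neg_atTop_nhds_zero).mul_const (|ξ| + 1)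
  rw [integral_Ioi_of_hasDerivAt_of_tendsto' hd hi ht]
  simp [neg_div]

theorem integrable_exp_neg_abs : Integrable fun x : ℝ => Real.exp (-|x|) := by
  refine integrable_comp_abs_of_integrableOn (f := fun x => Real.exp (-x)) ?_
  have := integrableOn_exp_neg_mul_rpow (s := 0) (by norm_num)
  simpa using this

theorem integrable_exp_neg_abs_mul_abs_rpow {α : ℝ} (h0 : 0 < α) (h2 : α < 2) (τ : ℝ) :
    Integrable fun x : ℝ => Real.exp (-|x|) * |τ + x| ^ α := by
  have h : Integrable fun x : ℝ => Real.exp (-|x|) * (1 + |τ| + |x|) ^ 2 := by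
    refine integrable_comp_abs_of_integrableOn
      (f := fun x => Real.exp (-x) * (1 + |τ| + x) ^ 2) ?_
    have a := integrableOn_exp_neg_mul_rpow (s := 0) (by norm_num)
    have b := integrableOn_exp_neg_mul_rpow (s := 1) (by norm_num)
    have c := integrableOn_exp_neg_mul_rpow (s := 2) (by norm_num)
    refine (((a.const_mul ((1 + |τ|) ^ 2)).add (b.const_mul (2 * (1 + |τ|)))).add c).congr
      (Eventually.of_forall fun x => ?_)
    simp; ring
  refine h.mono' (Measurable.aestronglyMeasurable (by fun_prop)) (Eventually.of_forall fun x => ?_)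
  rw [Real.norm_of_nonneg (by positivity)]
  refine mul_le_mul_of_nonneg_left ?_ (Real.exp_pos _).le
  calc |τ + x| ^ α ≤ (1 + |τ| + |x|) ^ α := by
        refine Real.rpow_le_rpow (abs_nonneg _) ?_ h0.le
        linarith [abs_add_le τ x]
    _ ≤ (1 + |τ| + |x|) ^ (2 : ℝ) :=
        Real.rpow_le_rpow_of_exponent_le (by linarith [abs_nonneg τ, abs_nonneg x]) h2.le
    _ = _ := Real.rpow_two _

theorem integral_exp_neg_abs_mul_one_sub_cos (τ ξ : ℝ) :
    ∫ x, Real.exp (-|x|) * (1 - Real.cos ((τ + x) * ξ)) =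
      2 - 2 * (Real.cos (τ * ξ) / (1 + ξ ^ 2)) := by
  have i1 : Integrable fun x : ℝ => Real.exp (-|x|) * Real.cos (x * ξ) :=
    integrable_exp_neg_abs.mul_bdd (c := 1) (by fun_prop)
      (Eventually.of_forall fun x => by simpa using Real.abs_cos_le_one _)
  have i2 : Integrable fun x : ℝ => Real.exp (-|x|) * Real.sin (x * ξ) :=
    integrable_exp_neg_abs.mul_bdd (c := 1) (by fun_prop)
      (Eventually.of_forall fun x => by simpa using Real.abs_sin_le_one _)
  have v0 : ∫ x : ℝ, Real.exp (-|x|) = 2 := by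
    rw [integral_comp_abs (f := fun x => Real.exp (-x)), integral_exp_neg_Ioi]; simp
  have v1 : ∫ x : ℝ, Real.exp (-|x|) * Real.cos (x * ξ) = 2 * (1 / (1 + ξ ^ 2)) := by
    rw [← (integral_Ioi_exp_neg_mul_cos ξ).2,
      ← integral_comp_abs (f := fun x => Real.exp (-x) * Real.cos (x * ξ))]
    congr 1; ext x
    congr 1
    rcases abs_choice x with h | h <;> rw [h]
    rw [neg_mul, Real.cos_neg]
  have v2 : ∫ x : ℝ, Real.exp (-|x|) * Real.sin (x * ξ) = 0 := by
    have := integral_neg_eq_self (fun x : ℝ => Real.exp (-|x|) * Real.sin (x * ξ)) volume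
    simp only [abs_neg, neg_mul, Real.sin_neg, mul_neg, integral_neg] at this
    linarith
  have e : ∀ x : ℝ, Real.exp (-|x|) * (1 - Real.cos ((τ + x) * ξ)) = Real.exp (-|x|) -
      Real.cos (τ * ξ) * (Real.exp (-|x|) * Real.cos (x * ξ)) +
      Real.sin (τ * ξ) * (Real.exp (-|x|) * Real.sin (x * ξ)) := by
    intro x; rw [add_mul, Real.cos_add]; ring
  simp_rw [e]
  have j1 := i1.const_mul (Real.cos (τ * ξ))
  have j2 : Integrable fun x : ℝ => Real.exp (-|x|) -
      Real.cos (τ * ξ) * (Real.exp (-|x|) * Real.cos (x * ξ)) := integrable_exp_neg_abs.sub j1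
  rw [integral_add j2 (i2.const_mul _), integral_sub integrable_exp_neg_abs j1, integral_const_mul, integral_const_mul, v0, v1, v2]
  ring

/-- Average the spectral formula for |τ + x|^α against e^{-|x|}, whose transform is 2/(1+ξ²). The
x-integral equals 2(1 - cos τξ) + 2ξ² cos(τξ)/(1+ξ²): the first part represents |τ|^α again and the
second is the integrand of c. -/
theorem specCov_eq_integral {α : ℝ} (h0 : 0 < α) (h2 : α < 2) (τ : ℝ) :
    specCov α τ = (∫ x, Real.exp (-|x|) * |τ + x| ^ α) / 4 - |τ| ^ α / 2 := by
  have hC := specConst_pos h0 h2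
  let F : ℝ → ℝ → ℝ := fun x ξ =>
    Real.exp (-|x|) * ((1 - Real.cos ((τ + x) * ξ)) * |ξ| ^ (-1 - α))
  have hFn : ∀ x ξ, 0 ≤ F x ξ := fun x ξ => mul_nonneg (Real.exp_pos _).le
    (mul_nonneg (by linarith [Real.cos_le_one ((τ + x) * ξ)]) (by positivity))
  have hFx : ∀ x, ∫ ξ, F x ξ = specConst α / 2 * (Real.exp (-|x|) * |τ + x| ^ α) := by
    intro x
    simp only [F]
    rw [integral_const_mul, integral_one_sub_cos h0]; ring
  have hF : Integrable (Function.uncurry F) (volume.prod volume) := by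
    rw [integrable_prod_iff (Measurable.aestronglyMeasurable (by unfold F; fun_prop))]
    constructor
    · exact Eventually.of_forall fun x => (integrable_one_sub_cos h0 h2 (τ + x)).const_mul
        (Real.exp (-|x|))
    · simp only [Function.uncurry, Real.norm_of_nonneg (hFn _ _), hFx]
      exact (integrable_exp_neg_abs_mul_abs_rpow h0 h2 τ).const_mul _
  have hsw := integral_integral_swap hF
  simp only [hFx] at hsw
  rw [integral_const_mul] at hsw
  have hne : ∀ᵐ x : ℝ, x ≠ 0 := by simp [ae_iff, measure_singleton]
  have hξ : ∀ᵐ ξ : ℝ, ∫ x, F x ξ = 2 * ((1 - Real.cos (τ * ξ)) * |ξ| ^ (-1 - α)) +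
      2 * (Real.cos (τ * ξ) * specDensity α ξ) := by
    filter_upwards [hne] with ξ hξ
    have hx : 0 < |ξ| := abs_pos.2 hξ
    have : ∀ x, F x ξ = |ξ| ^ (-1 - α) *
        (Real.exp (-|x|) * (1 - Real.cos ((τ + x) * ξ))) := fun x => by simp only [F]; ring
    simp_rw [this]
    rw [integral_const_mul, integral_exp_neg_abs_mul_one_sub_cos, specDensity,
      show (1 - α) = (-1 - α) + 2 by ring, Real.rpow_add hx, Real.rpow_two, sq_abs]
    have : (1 + ξ ^ 2) ≠ 0 := by positivity
    field_simp
    ring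
  rw [integral_congr_ae hξ, integral_add ((integrable_one_sub_cos h0 h2 τ).const_mul 2)
    ((integrable_cos_mul_specDensity h0 h2 τ).const_mul 2), integral_const_mul,
    integral_const_mul, integral_one_sub_cos h0] at hsw
  unfold specCov
  field_simp
  linarith

/-- The tail integral `∫_τ^∞ e^{τ-v} v^{α-1} dv`. -/
noncomputable def tailExp (α τ : ℝ) : ℝ :=
  Real.exp τ * ∫ v in Ioi τ, Real.exp (-v) * v ^ (α - 1)

/-- The integral `∫_0^τ e^{v-τ} v^{α-1} dv`. -/
noncomputable def headExp (α τ : ℝ) : ℝ :=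
  Real.exp (-τ) * ∫ v in (0 : ℝ)..τ, Real.exp v * v ^ (α - 1)

theorem intervalIntegrable_exp_mul_rpow {s : ℝ} (hs : -1 < s) (a b : ℝ) :
    IntervalIntegrable (fun v => Real.exp v * v ^ s) volume a b :=
  (intervalIntegral.intervalIntegrable_rpow' hs).continuousOn_mul (by fun_prop)

theorem hasDerivAt_headExp {α τ : ℝ} (h0 : 0 < α) (hτ : 0 < τ) :
    HasDerivAt (headExp α) (τ ^ (α - 1) - headExp α τ) τ := by
  have hc : ContinuousAt (fun v : ℝ => Real.exp v * v ^ (α - 1)) τ :=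
    (by fun_prop : ContinuousAt Real.exp τ).mul (Real.continuousAt_rpow_const _ _ (Or.inl hτ.ne'))
  have h1 := intervalIntegral.integral_hasDerivAt_right
    (intervalIntegrable_exp_mul_rpow (s := α - 1) (by linarith) 0 τ)
    (Measurable.stronglyMeasurable (by fun_prop)).stronglyMeasurableAtFilter hc
  have e1 : HasDerivAt (fun x : ℝ => Real.exp (-x)) (-Real.exp (-τ)) τ := by
    simpa using (hasDerivAt_neg τ).exp
  refine (e1.mul h1).congr_deriv ?_
  unfold headExp
  rw [← mul_assoc (Real.exp (-τ)), ← Real.exp_add, neg_add_cancel, Real.exp_zero]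
  ring

theorem tailExp_eq {α τ : ℝ} (h0 : 0 < α) (hτ : 0 ≤ τ) :
    tailExp α τ = Real.exp τ *
      (Real.Gamma α - ∫ v in (0 : ℝ)..τ, Real.exp (-v) * v ^ (α - 1)) := by
  have hi := integrableOn_exp_neg_mul_rpow (s := α - 1) (by linarith)
  have := intervalIntegral.integral_interval_add_Ioi (a := 0) (b := τ) hi
    (hi.mono_set (Set.Ioi_subset_Ioi hτ))
  rw [integral_exp_neg_mul_rpow (by linarith), sub_add_cancel] at this
  unfold tailExp
  rw [← this]; ring

theorem hasDerivAt_tailExp {α τ : ℝ} (h0 : 0 < α) (hτ : 0 < τ) :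
    HasDerivAt (tailExp α) (tailExp α τ - τ ^ (α - 1)) τ := by
  have hc : ContinuousAt (fun v : ℝ => Real.exp (-v) * v ^ (α - 1)) τ :=
    (by fun_prop : ContinuousAt (fun v : ℝ => Real.exp (-v)) τ).mul
      (Real.continuousAt_rpow_const _ _ (Or.inl hτ.ne'))
  have hI : IntervalIntegrable (fun v : ℝ => Real.exp (-v) * v ^ (α - 1)) volume 0 τ :=
    (intervalIntegral.intervalIntegrable_rpow' (by linarith)).continuousOn_mul (by fun_prop)
  have h1 := intervalIntegral.integral_hasDerivAt_right hI
    (Measurable.stronglyMeasurable (by fun_prop)).stronglyMeasurableAtFilter hc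
  have h2 := (Real.hasDerivAt_exp τ).mul (h1.const_sub (Real.Gamma α))
  have h3 : tailExp α =ᶠ[𝓝 τ] fun τ => Real.exp τ *
      (Real.Gamma α - ∫ v in (0 : ℝ)..τ, Real.exp (-v) * v ^ (α - 1)) := by
    filter_upwards [lt_mem_nhds hτ] with x hx
    exact tailExp_eq h0 hx.le
  refine (h2.congr_of_eventuallyEq h3).congr_deriv ?_
  rw [tailExp_eq h0 hτ.le, mul_neg, ← mul_assoc (Real.exp τ), ← Real.exp_add, add_neg_cancel,
    Real.exp_zero]
  ring

theorem integral_comp_add_right_Ioi (g : ℝ → ℝ) (τ : ℝ) :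
    ∫ x in Ioi (0 : ℝ), g (x + τ) = ∫ x in Ioi τ, g x := by
  have h := (measurePreserving_add_right volume τ).setIntegral_preimage_emb
    (Homeomorph.addRight τ).measurableEmbedding g (Ioi τ)
  simpa using h

/-- Shift by τ and integrate by parts once. Together with `integral_exp_mul_sub_rpow`, this makes
the powers τ^α cancel in `specCov_eq`. -/
theorem integral_Ioi_exp_neg_mul_add_rpow {α τ : ℝ} (h0 : 0 < α) (hτ : 0 < τ) :
    ∫ x in Ioi (0 : ℝ), Real.exp (-x) * (τ + x) ^ α = τ ^ α + α * tailExp α τ := by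
  have e1 : ∫ x in Ioi (0 : ℝ), Real.exp (-x) * (τ + x) ^ α =
      Real.exp τ * ∫ v in Ioi τ, Real.exp (-v) * v ^ α := by
    have := integral_comp_add_right_Ioi (fun v : ℝ => Real.exp (-v) * v ^ α) τ
    rw [← this, ← integral_const_mul]
    congr 1; ext x
    rw [← mul_assoc, ← Real.exp_add, add_comm x τ]
    congr 2; ring
  have hi1 := (integrableOn_exp_neg_mul_rpow (s := α) (by linarith)).mono_set
    (Set.Ioi_subset_Ioi hτ.le)
  have hi2 := (integrableOn_exp_neg_mul_rpow (s := α - 1) (by linarith)).mono_set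
    (Set.Ioi_subset_Ioi hτ.le)
  have hd : ∀ v ∈ Ici τ, HasDerivAt (fun v : ℝ => -(Real.exp (-v) * v ^ α))
      (Real.exp (-v) * v ^ α - α * (Real.exp (-v) * v ^ (α - 1))) v := by
    intro v hv
    have hv0 : 0 < v := hτ.trans_le hv
    have e1 : HasDerivAt (fun x : ℝ => Real.exp (-x)) (-Real.exp (-v)) v := by
      simpa using (hasDerivAt_neg v).exp
    have := (e1.mul (Real.hasDerivAt_rpow_const (p := α) (Or.inl hv0.ne'))).neg
    refine this.congr_deriv ?_
    ring
  have ht : Tendsto (fun v : ℝ => -(Real.exp (-v) * v ^ α)) atTop (𝓝 0) := by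
    have := tendsto_rpow_mul_exp_neg_mul_atTop_nhds_zero α 1 one_pos
    rw [← neg_zero]
    refine Tendsto.neg (this.congr fun v => ?_)
    rw [mul_comm]; simp
  have := integral_Ioi_of_hasDerivAt_of_tendsto' hd (hi1.sub (hi2.const_mul α)) ht
  rw [integral_sub hi1 (hi2.const_mul α), integral_const_mul] at this
  rw [e1, tailExp]
  have h3 : Real.exp τ * Real.exp (-τ) = 1 := by rw [← Real.exp_add]; simp
  linear_combination Real.exp τ * this + τ ^ α * h3

theorem integral_exp_mul_sub_rpow {α τ : ℝ} (h0 : 0 < α) (hτ : 0 < τ) :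
    ∫ x in (0 : ℝ)..τ, Real.exp (-x) * (τ - x) ^ α = τ ^ α - α * headExp α τ := by
  have e1 : ∫ x in (0 : ℝ)..τ, Real.exp (-x) * (τ - x) ^ α =
      Real.exp (-τ) * ∫ v in (0 : ℝ)..τ, Real.exp v * v ^ α := by
    have := intervalIntegral.integral_comp_sub_left (a := 0) (b := τ)
      (fun v : ℝ => Real.exp v * v ^ α) τ
    rw [sub_self, sub_zero] at this
    rw [← this, ← intervalIntegral.integral_const_mul]
    congr 1; ext x
    rw [← mul_assoc, ← Real.exp_add]
    congr 2; ring
  have hi1 := intervalIntegrable_exp_mul_rpow (s := α) (by linarith) 0 τ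
  have hi2 := intervalIntegrable_exp_mul_rpow (s := α - 1) (by linarith) 0 τ
  have hd : ∀ v ∈ Ioo 0 τ, HasDerivAt (fun v : ℝ => Real.exp v * v ^ α)
      (Real.exp v * v ^ α + α * (Real.exp v * v ^ (α - 1))) v := by
    intro v hv
    have := (Real.hasDerivAt_exp v).mul (Real.hasDerivAt_rpow_const (p := α) (Or.inl hv.1.ne'))
    refine this.congr_deriv ?_
    ring
  have hc : Continuous (fun v : ℝ => Real.exp v * v ^ α) :=
    Real.continuous_exp.mul (Real.continuous_rpow_const h0.le)
  have := intervalIntegral.integral_eq_sub_of_hasDerivAt_of_le hτ.le hc.continuousOn hd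
    (hi1.add (hi2.const_mul α))
  rw [intervalIntegral.integral_add hi1 (hi2.const_mul α), intervalIntegral.integral_const_mul,
    Real.zero_rpow h0.ne'] at this
  rw [e1, headExp]
  have h3 : Real.exp (-τ) * Real.exp τ = 1 := by rw [← Real.exp_add]; simp
  linear_combination Real.exp (-τ) * this + τ ^ α * h3

/-- The stationary covariance in terms of incomplete exponential integrals. -/
theorem specCov_eq {α τ : ℝ} (h0 : 0 < α) (h2 : α < 2) (hτ : 0 < τ) :
    specCov α τ = (α / 2 * (tailExp α τ - headExp α τ) +
      Real.Gamma (α + 1) / 2 * Real.exp (-τ)) / 2 := by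
  have hi := integrable_exp_neg_abs_mul_abs_rpow h0 h2 τ
  have h1 : ∫ x in Ioi (0 : ℝ), Real.exp (-|x|) * |τ + x| ^ α = τ ^ α + α * tailExp α τ := by
    rw [← integral_Ioi_exp_neg_mul_add_rpow h0 hτ]
    refine setIntegral_congr_fun measurableSet_Ioi fun x hx => ?_
    have hx : 0 < x := hx
    rw [abs_of_pos hx, abs_of_pos (by linarith)]
  have h3 : ∫ x in Iic (0 : ℝ), Real.exp (-|x|) * |τ + x| ^ α =
      ∫ x in Ioi (0 : ℝ), Real.exp (-x) * |τ - x| ^ α := by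
    have := integral_comp_neg_Ioi 0 (fun x : ℝ => Real.exp (-|x|) * |τ + x| ^ α)
    rw [neg_zero] at this
    rw [← this]
    refine setIntegral_congr_fun measurableSet_Ioi fun x hx => ?_
    have hx : 0 < x := hx
    rw [abs_neg, abs_of_pos hx, ← sub_eq_add_neg]
  have hi4 : IntegrableOn (fun x : ℝ => Real.exp (-x) * |τ - x| ^ α) (Ioi 0) := by
    have := (integrable_exp_neg_abs_mul_abs_rpow h0 h2 (-τ)).integrableOn (s := Ioi 0)
    refine this.congr_fun (fun x hx => ?_) measurableSet_Ioi
    have hx : 0 < x := hx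
    simp only
    rw [abs_of_pos hx, show -τ + x = -(τ - x) by ring, abs_neg]
  have h4 : ∫ x in Ioi (0 : ℝ), Real.exp (-x) * |τ - x| ^ α =
      (τ ^ α - α * headExp α τ) + Real.exp (-τ) * Real.Gamma (α + 1) := by
    rw [← intervalIntegral.integral_interval_add_Ioi (b := τ) hi4
      (hi4.mono_set (Set.Ioi_subset_Ioi hτ.le)), ← integral_exp_mul_sub_rpow h0 hτ]
    congr 1
    · rw [intervalIntegral.integral_of_le hτ.le, intervalIntegral.integral_of_le hτ.le]
      refine setIntegral_congr_fun measurableSet_Ioc fun x hx => ?_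
      rw [abs_of_nonneg (by linarith [hx.2])]
    · have := integral_comp_add_right_Ioi (fun x : ℝ => Real.exp (-x) * |τ - x| ^ α) τ
      rw [← this, ← integral_exp_neg_mul_rpow (by linarith), ← integral_const_mul]
      refine setIntegral_congr_fun measurableSet_Ioi fun x hx => ?_
      have hx : 0 < x := hx
      rw [← mul_assoc, ← Real.exp_add, show τ - (x + τ) = -x by ring, abs_neg, abs_of_pos hx]
      congr 2; ring
  have h5 := integral_add_compl (measurableSet_Ioi (a := (0:ℝ))) hi
  rw [Set.compl_Ioi, h1, h3, h4] at h5
  rw [specCov_eq_integral h0 h2, ← h5, abs_of_pos hτ]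
  ring

theorem tendsto_headExp_zero {α : ℝ} (h0 : 0 < α) : Tendsto (headExp α) (𝓝[>] 0) (𝓝 0) := by
  have h : Continuous (headExp α) := by
    unfold headExp
    refine (by fun_prop : Continuous fun τ : ℝ => Real.exp (-τ)).mul ?_
    exact intervalIntegral.continuous_primitive
      (intervalIntegrable_exp_mul_rpow (s := α - 1) (by linarith)) 0
  have := h.tendsto 0
  simp only [headExp, intervalIntegral.integral_same, mul_zero] at this
  exact this.mono_left nhdsWithin_le_nhds

theorem tendsto_tailExp_zero {α : ℝ} (h0 : 0 < α) :
    Tendsto (tailExp α) (𝓝[>] 0) (𝓝 (Real.Gamma α)) := by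
  have h : Continuous fun τ => Real.exp τ *
      (Real.Gamma α - ∫ v in (0 : ℝ)..τ, Real.exp (-v) * v ^ (α - 1)) := by
    refine Real.continuous_exp.mul (continuous_const.sub ?_)
    exact intervalIntegral.continuous_primitive (fun a b =>
      (intervalIntegral.intervalIntegrable_rpow' (by linarith)).continuousOn_mul (by fun_prop)) 0
  have := h.tendsto 0
  simp only [intervalIntegral.integral_same, sub_zero, Real.exp_zero, one_mul] at this
  refine (this.mono_left nhdsWithin_le_nhds).congr' ?_
  filter_upwards [self_mem_nhdsWithin] with x hx
  exact (tailExp_eq h0 (le_of_lt hx)).symm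

theorem specCov_zero {α : ℝ} (h0 : 0 < α) (h2 : α < 2) :
    specCov α 0 = Real.Gamma (α + 1) / 2 := by
  have h1 : Tendsto (specCov α) (𝓝[>] 0) (𝓝 (specCov α 0)) :=
    ((continuous_specCov h0 h2).tendsto 0).mono_left nhdsWithin_le_nhds
  have h3 : Tendsto (fun τ => (α / 2 * (tailExp α τ - headExp α τ) +
      Real.Gamma (α + 1) / 2 * Real.exp (-τ)) / 2) (𝓝[>] 0)
      (𝓝 ((α / 2 * (Real.Gamma α - 0) + Real.Gamma (α + 1) / 2 * Real.exp (-0)) / 2)) := by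
    refine (((tendsto_tailExp_zero h0).sub (tendsto_headExp_zero h0)).const_mul _ |>.add
      (Tendsto.const_mul _ ?_)).div_const 2
    exact ((by fun_prop : Continuous fun τ : ℝ => Real.exp (-τ)).tendsto 0).mono_left
      nhdsWithin_le_nhds
  have h4 := tendsto_nhds_unique h1 (h3.congr' (by
    filter_upwards [self_mem_nhdsWithin] with τ hτ
    exact (specCov_eq h0 h2 hτ).symm))
  rw [h4, Real.Gamma_add_one h0.ne', neg_zero, Real.exp_zero]
  ring

/-- The integral defining `specConst` is not evaluated directly. The beta integral with n = 1 and
Euler's reflection formula give c(0) as C^{-1} π / sin(πα/2), and this is solved for C^{-1}. -/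
theorem inv_specConst {α : ℝ} (h0 : 0 < α) (h2 : α < 2) :
    (specConst α)⁻¹ = specCov α 0 * Real.sin (π * α / 2) / π := by
  have hI : ∫ ξ, specDensity α ξ = π / Real.sin (π * α / 2) := by
    have e : ∀ ξ, specDensity α ξ = (fun x : ℝ => x ^ (1 - α) / (1 + x ^ 2) ^ 1) |ξ| := by
      intro ξ; simp [specDensity]
    rw [integral_congr_ae (Eventually.of_forall e)]
    rw [integral_comp_abs (f := fun x : ℝ => x ^ (1 - α) / (1 + x ^ 2) ^ 1), (integral_rpow_div_one_add_sq_pow (b := 1 - α) (n := 1) (by linarith)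
      (by push_cast; linarith)).2]
    have := Real.Gamma_mul_Gamma_one_sub (α / 2)
    rw [show π * (α / 2) = π * α / 2 by ring] at this
    rw [← this, show ((1 : ℕ) : ℝ) - (1 - α + 1) / 2 = α / 2 by push_cast; ring,
      show (1 - α + 1) / 2 = 1 - α / 2 by ring, Nat.cast_one, Real.Gamma_one]
    ring
  have hs : 0 < Real.sin (π * α / 2) :=
    Real.sin_pos_of_pos_of_lt_pi (by positivity) (by nlinarith [Real.pi_pos])
  have : specCov α 0 = (specConst α)⁻¹ * (π / Real.sin (π * α / 2)) := by
    rw [← hI]; simp [specCov]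
  rw [this]
  field_simp

/-! ### The differential equation of the covariance and explicit primitives. -/

/-- The derivative of the stationary covariance `specCov α` on `(0, ∞)`. -/
noncomputable def covDeriv (α τ : ℝ) : ℝ :=
  (α / 2 * (tailExp α τ + headExp α τ) - α * τ ^ (α - 1) - specCov α 0 * Real.exp (-τ)) / 2

/-- The second derivative of `|τ|^α / 2`. -/
noncomputable def noiseCov (α τ : ℝ) : ℝ := α / 2 * (α - 1) * τ ^ (α - 2)

theorem rpow_sub_one_eq {α x : ℝ} (hx : 0 < x) : x ^ (α - 1) = x * x ^ (α - 2) := by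
  rw [show α - 1 = 1 + (α - 2) by ring, Real.rpow_add hx, Real.rpow_one]

theorem hasDerivAt_exp_neg (x : ℝ) :
    HasDerivAt (fun x : ℝ => Real.exp (-x)) (-Real.exp (-x)) x := by
  simpa using (hasDerivAt_neg x).exp

theorem hasDerivAt_rpow_sub_one {α x : ℝ} (hx : 0 < x) :
    HasDerivAt (fun x : ℝ => x ^ (α - 1)) ((α - 1) * x ^ (α - 2)) x := by
  have := Real.hasDerivAt_rpow_const (p := α - 1) (Or.inl hx.ne')
  rwa [show α - 1 - 1 = α - 2 by ring] at this

theorem specCov_eq' {α x : ℝ} (h0 : 0 < α) (h2 : α < 2) (hx : 0 < x) :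
    specCov α x = (α / 2 * (tailExp α x - headExp α x) + specCov α 0 * Real.exp (-x)) / 2 := by
  rw [specCov_eq h0 h2 hx, specCov_zero h0 h2]

theorem specCov_zero_eq {α : ℝ} (h0 : 0 < α) (h2 : α < 2) :
    specCov α 0 = α / 2 * Real.Gamma α := by
  rw [specCov_zero h0 h2, Real.Gamma_add_one h0.ne']; ring

theorem hasDerivAt_specCov {α x : ℝ} (h0 : 0 < α) (h2 : α < 2) (hx : 0 < x) :
    HasDerivAt (specCov α) (covDeriv α x) x := by
  have h := ((((hasDerivAt_tailExp h0 hx).sub (hasDerivAt_headExp h0 hx)).const_mul (α / 2)).add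
    ((hasDerivAt_exp_neg x).const_mul (specCov α 0))).div_const 2
  have e : specCov α =ᶠ[𝓝 x] fun x =>
      (α / 2 * (tailExp α x - headExp α x) + specCov α 0 * Real.exp (-x)) / 2 := by
    filter_upwards [lt_mem_nhds hx] with y hy
    exact specCov_eq' h0 h2 hy
  refine (h.congr_of_eventuallyEq e).congr_deriv ?_
  unfold covDeriv
  ring

/-- This is c'' = c - κ, the source of all the primitives below. It follows from p' = p - x^{α-1}
and h' = x^{α-1} - h for the tail integral p and the head integral h. -/
theorem hasDerivAt_covDeriv {α x : ℝ} (h0 : 0 < α) (h2 : α < 2) (hx : 0 < x) :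
    HasDerivAt (covDeriv α) (specCov α x - noiseCov α x) x := by
  have h := (((((hasDerivAt_tailExp h0 hx).add (hasDerivAt_headExp h0 hx)).const_mul (α / 2)).sub
    ((hasDerivAt_rpow_sub_one (α := α) hx).const_mul α)).sub
    ((hasDerivAt_exp_neg x).const_mul (specCov α 0))).div_const 2
  refine h.congr_deriv ?_
  rw [specCov_eq' h0 h2 hx, noiseCov]
  ring

/-- `∫_0^x c²` for the stationary covariance `c`. -/
noncomputable def covSqInt (α x : ℝ) : ℝ := ∫ t in (0 : ℝ)..x, specCov α t ^ 2

/-- `∫_0^x e^{-t} c(t) dt` for the stationary covariance `c`. -/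
noncomputable def covLaplace (α x : ℝ) : ℝ := ∫ t in (0 : ℝ)..x, Real.exp (-t) * specCov α t

/-- `∫_0^x e^{-(x-t)} c(t) dt` for the stationary covariance `c`. -/
noncomputable def covDamp (α x : ℝ) : ℝ :=
  Real.exp (-x) * ∫ t in (0 : ℝ)..x, Real.exp t * specCov α t

/-- The self-convolution `∫_0^x c(x-t) c(t) dt` of the stationary covariance `c`. -/
noncomputable def covConv (α x : ℝ) : ℝ := ∫ t in (0 : ℝ)..x, specCov α (x - t) * specCov α t

/-- `∫_0^x κ(t) t² e^{-t} dt` for the noise covariance `κ`. -/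
noncomputable def noiseGamma (α x : ℝ) : ℝ :=
  ∫ t in (0 : ℝ)..x, α / 2 * (α - 1) * (Real.exp (-t) * t ^ α)

theorem hasDerivAt_covSqInt {α : ℝ} (h0 : 0 < α) (h2 : α < 2) (x : ℝ) :
    HasDerivAt (covSqInt α) (specCov α x ^ 2) x := by
  have hc := (continuous_specCov h0 h2).pow 2
  exact intervalIntegral.integral_hasDerivAt_right (hc.intervalIntegrable _ _)
    hc.stronglyMeasurable.stronglyMeasurableAtFilter hc.continuousAt

theorem hasDerivAt_covLaplace {α : ℝ} (h0 : 0 < α) (h2 : α < 2) (x : ℝ) :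
    HasDerivAt (covLaplace α) (Real.exp (-x) * specCov α x) x := by
  have hc : Continuous fun t => Real.exp (-t) * specCov α t :=
    (by fun_prop : Continuous fun t : ℝ => Real.exp (-t)).mul (continuous_specCov h0 h2)
  exact intervalIntegral.integral_hasDerivAt_right (hc.intervalIntegrable _ _)
    hc.stronglyMeasurable.stronglyMeasurableAtFilter hc.continuousAt

theorem hasDerivAt_noiseGamma {α : ℝ} (h0 : 0 < α) (x : ℝ) :
    HasDerivAt (noiseGamma α) (α / 2 * (α - 1) * (Real.exp (-x) * x ^ α)) x := by
  have hc : Continuous fun t : ℝ => α / 2 * (α - 1) * (Real.exp (-t) * t ^ α) :=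
    continuous_const.mul ((by fun_prop : Continuous fun t : ℝ => Real.exp (-t)).mul
      (Real.continuous_rpow_const h0.le))
  exact intervalIntegral.integral_hasDerivAt_right (hc.intervalIntegrable _ _)
    hc.stronglyMeasurable.stronglyMeasurableAtFilter hc.continuousAt

theorem tendsto_specCov_zero {α : ℝ} (h0 : 0 < α) (h2 : α < 2) :
    Tendsto (specCov α) (𝓝[>] 0) (𝓝 (specCov α 0)) :=
  ((continuous_specCov h0 h2).tendsto 0).mono_left nhdsWithin_le_nhds

theorem tendsto_exp_neg_zero : Tendsto (fun x : ℝ => Real.exp (-x)) (𝓝[>] 0) (𝓝 1) := by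
  have := ((by fun_prop : Continuous fun x : ℝ => Real.exp (-x)).tendsto 0).mono_left
    (nhdsWithin_le_nhds (s := Set.Ioi (0 : ℝ)))
  simpa using this

theorem tendsto_id_zero : Tendsto (fun x : ℝ => x) (𝓝[>] 0) (𝓝 0) :=
  tendsto_id.mono_left nhdsWithin_le_nhds

/-- For α < 1 the derivative c' blows up at zero like -(α/2) x^{α-1}. The primitives below combine
c' with powers of x so that they have finite limits at zero, and the fundamental theorem is applied
on the open interval with these limits. -/
theorem tendsto_covDeriv_add_zero {α : ℝ} (h0 : 0 < α) (h2 : α < 2) :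
    Tendsto (fun x => covDeriv α x + α / 2 * x ^ (α - 1)) (𝓝[>] 0) (𝓝 0) := by
  have h := ((((tendsto_tailExp_zero h0).add (tendsto_headExp_zero h0)).const_mul (α / 2)).sub
    (tendsto_exp_neg_zero.const_mul (specCov α 0))).div_const 2
  rw [specCov_zero_eq h0 h2, show (α / 2 * (Real.Gamma α + 0) - α / 2 * Real.Gamma α * 1) / 2 = 0 by
    ring] at h
  refine h.congr fun x => ?_
  rw [covDeriv, specCov_zero_eq h0 h2]; ring

theorem tendsto_mul_rpow_zero {α : ℝ} (h0 : 0 < α) :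
    Tendsto (fun x : ℝ => x * x ^ (α - 1)) (𝓝[>] 0) (𝓝 0) := by
  have := ((Real.continuous_rpow_const h0.le).tendsto 0).mono_left
    (nhdsWithin_le_nhds (s := Set.Ioi (0 : ℝ)))
  rw [Real.zero_rpow h0.ne'] at this
  refine this.congr' ?_
  filter_upwards [self_mem_nhdsWithin] with x hx
  have hx : 0 < x := hx
  rw [show α = 1 + (α - 1) by ring, Real.rpow_add hx, Real.rpow_one]; ring_nf

theorem tendsto_mul_covDeriv_zero {α : ℝ} (h0 : 0 < α) (h2 : α < 2) :
    Tendsto (fun x => x * covDeriv α x) (𝓝[>] 0) (𝓝 0) := by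
  have h := (tendsto_id_zero.mul (tendsto_covDeriv_add_zero h0 h2)).sub
    ((tendsto_mul_rpow_zero h0).const_mul (α / 2))
  simp only [mul_zero, sub_zero] at h
  refine h.congr fun x => ?_
  ring

/-- The solution `q = (αc - xc')/2` of `q - q'' = c`. -/
noncomputable def covPot (α x : ℝ) : ℝ := (α * specCov α x - x * covDeriv α x) / 2

/-- The derivative of `covPot`. -/
noncomputable def covPotDeriv (α x : ℝ) : ℝ :=
  ((α - 1) * covDeriv α x - x * specCov α x + α / 2 * (α - 1) * x ^ (α - 1)) / 2

theorem hasDerivAt_covPot {α x : ℝ} (h0 : 0 < α) (h2 : α < 2) (hx : 0 < x) :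
    HasDerivAt (covPot α) (covPotDeriv α x) x := by
  have h := (((hasDerivAt_specCov h0 h2 hx).const_mul α).sub
    ((hasDerivAt_id x).mul (hasDerivAt_covDeriv h0 h2 hx))).div_const 2
  refine h.congr_deriv ?_
  rw [covPotDeriv, noiseCov, rpow_sub_one_eq hx]
  simp only [id]; ring

/-- This is q'' = q - c. Since κ is homogeneous of degree α-2, the operator 1 - ∂² sends xc' to ακ -
2c and αc to ακ, so it sends q = (αc - xc')/2 to c. -/
theorem hasDerivAt_covPotDeriv {α x : ℝ} (h0 : 0 < α) (h2 : α < 2) (hx : 0 < x) :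
    HasDerivAt (covPotDeriv α) (covPot α x - specCov α x) x := by
  have h := ((((hasDerivAt_covDeriv h0 h2 hx).const_mul (α - 1)).sub
    ((hasDerivAt_id x).mul (hasDerivAt_specCov h0 h2 hx))).add
    ((hasDerivAt_rpow_sub_one (α := α) hx).const_mul (α / 2 * (α - 1)))).div_const 2
  refine h.congr_deriv ?_
  rw [covPot, noiseCov]
  simp only [id]; ring

theorem tendsto_covPot_zero {α : ℝ} (h0 : 0 < α) (h2 : α < 2) :
    Tendsto (covPot α) (𝓝[>] 0) (𝓝 (α * specCov α 0 / 2)) := by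
  have := (((tendsto_specCov_zero h0 h2).const_mul α).sub
    (tendsto_mul_covDeriv_zero h0 h2)).div_const 2
  rwa [sub_zero] at this

theorem tendsto_covPotDeriv_zero {α : ℝ} (h0 : 0 < α) (h2 : α < 2) :
    Tendsto (covPotDeriv α) (𝓝[>] 0) (𝓝 0) := by
  have h := (((tendsto_covDeriv_add_zero h0 h2).const_mul (α - 1)).sub
    (tendsto_id_zero.mul (tendsto_specCov_zero h0 h2))).div_const 2
  simp only [mul_zero, zero_mul, sub_zero, zero_div] at h
  refine h.congr fun x => ?_
  rw [covPotDeriv]; ring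

/-- Since q - q'' = c, the function e^x (q - q') has derivative e^x c. -/
theorem covDamp_eq {α x : ℝ} (h0 : 0 < α) (h2 : α < 2) (hx : 0 < x) :
    covDamp α x = covPot α x - covPotDeriv α x - α * specCov α 0 / 2 * Real.exp (-x) := by
  have hc : Continuous fun t => Real.exp t * specCov α t :=
    Real.continuous_exp.mul (continuous_specCov h0 h2)
  have hd : ∀ y, 0 < y → HasDerivAt (fun x => Real.exp x * (covPot α x - covPotDeriv α x))
      (Real.exp y * specCov α y) y := by
    intro y hy
    refine ((Real.hasDerivAt_exp y).mul ((hasDerivAt_covPot h0 h2 hy).sub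
      (hasDerivAt_covPotDeriv h0 h2 hy))).congr_deriv ?_
    simp only [Pi.sub_apply]; ring
  have h := intervalIntegral.integral_eq_sub_of_hasDerivAt_of_tendsto hx
    (fun y hy => hd y hy.1) (hc.intervalIntegrable _ _)
    (((Real.continuous_exp.tendsto 0).mono_left nhdsWithin_le_nhds).mul
      ((tendsto_covPot_zero h0 h2).sub (tendsto_covPotDeriv_zero h0 h2)))
    ((hd x hx).continuousAt.tendsto.mono_left nhdsWithin_le_nhds)
  have h3 : Real.exp (-x) * Real.exp x = 1 := by rw [← Real.exp_add]; simp
  rw [Real.exp_zero] at h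
  rw [covDamp, h]
  linear_combination (covPot α x - covPotDeriv α x) * h3

theorem covLaplace_eq {α x : ℝ} (h0 : 0 < α) (h2 : α < 2) (hx : 0 < x) :
    covLaplace α x = α * specCov α 0 / 2 - Real.exp (-x) * (covPot α x + covPotDeriv α x) := by
  have hc : Continuous fun t => Real.exp (-t) * specCov α t :=
    (by fun_prop : Continuous fun t : ℝ => Real.exp (-t)).mul (continuous_specCov h0 h2)
  have hd : ∀ y, 0 < y → HasDerivAt (fun x => -(Real.exp (-x) * (covPot α x + covPotDeriv α x)))
      (Real.exp (-y) * specCov α y) y := by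
    intro y hy
    refine ((hasDerivAt_exp_neg y).mul ((hasDerivAt_covPot h0 h2 hy).add
      (hasDerivAt_covPotDeriv h0 h2 hy))).neg.congr_deriv ?_
    simp only [Pi.add_apply]; ring
  have h := intervalIntegral.integral_eq_sub_of_hasDerivAt_of_tendsto hx
    (fun y hy => hd y hy.1) (hc.intervalIntegrable _ _)
    (tendsto_exp_neg_zero.mul
      ((tendsto_covPot_zero h0 h2).add (tendsto_covPotDeriv_zero h0 h2))).neg
    ((hd x hx).continuousAt.tendsto.mono_left nhdsWithin_le_nhds)
  rw [covLaplace, h]; ring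

/-- A primitive of `x (c² - c'²)`. -/
noncomputable def momentPrim (α x : ℝ) : ℝ :=
  x ^ 2 * (specCov α x ^ 2 - covDeriv α x ^ 2) / 2 + specCov α 0 / 2 * noiseGamma α x -
    (α / 2) ^ 2 * (α - 1) / 2 * (x * x ^ (α - 1) * (tailExp α x - headExp α x) -
      α * (tailExp α x * headExp α x))

/-- Differentiating x²(c² - c'²)/2 leaves the excess x²κc'. The exponential part of c' is
compensated by `noiseGamma`. For the rest, (ph)' = x^{α-1}(p - h) shows that x^α(p - h) - αph has
derivative x^α(p + h - 2x^{α-1}), which is the other part of c' times a multiple of x^α. -/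
theorem hasDerivAt_momentPrim {α x : ℝ} (h0 : 0 < α) (h2 : α < 2) (hx : 0 < x) :
    HasDerivAt (momentPrim α) (x * (specCov α x ^ 2 - covDeriv α x ^ 2)) x := by
  have hc := hasDerivAt_specCov h0 h2 hx
  have hd := hasDerivAt_covDeriv h0 h2 hx
  have hp := hasDerivAt_tailExp h0 hx
  have he := hasDerivAt_headExp h0 hx
  have hid := hasDerivAt_id x
  have h := ((((hid.pow 2).mul ((hc.pow 2).sub (hd.pow 2))).div_const 2).add
    ((hasDerivAt_noiseGamma h0 x).const_mul (specCov α 0 / 2))).sub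
    ((((hid.mul (hasDerivAt_rpow_sub_one (α := α) hx)).mul (hp.sub he)).sub
      ((hp.mul he).const_mul α)).const_mul ((α / 2) ^ 2 * (α - 1) / 2))
  refine h.congr_deriv ?_
  have e1 : x ^ α = x ^ 2 * x ^ (α - 2) := by
    rw [← Real.rpow_two, ← Real.rpow_add hx]; congr 1; ring
  simp only [id, Pi.mul_apply, Pi.sub_apply, Pi.pow_apply]
  rw [noiseCov, e1, covDeriv, specCov_eq' h0 h2 hx, rpow_sub_one_eq hx]
  push_cast
  ring

theorem tendsto_momentPrim_zero {α : ℝ} (h0 : 0 < α) (h2 : α < 2) :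
    Tendsto (momentPrim α) (𝓝[>] 0) (𝓝 0) := by
  have hG : Tendsto (noiseGamma α) (𝓝[>] 0) (𝓝 0) := by
    have := (hasDerivAt_noiseGamma h0 0).continuousAt.tendsto.mono_left
      (nhdsWithin_le_nhds (s := Set.Ioi (0 : ℝ)))
    simpa [noiseGamma] using this
  have h := ((((((tendsto_id_zero.mul (tendsto_specCov_zero h0 h2)).pow 2).sub
    ((tendsto_mul_covDeriv_zero h0 h2).pow 2)).div_const 2).add
    (hG.const_mul (specCov α 0 / 2))).sub
    ((((tendsto_mul_rpow_zero h0).mul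
      ((tendsto_tailExp_zero h0).sub (tendsto_headExp_zero h0))).sub
      (((tendsto_tailExp_zero h0).mul (tendsto_headExp_zero h0)).const_mul α)).const_mul
        ((α / 2) ^ 2 * (α - 1) / 2)))
  norm_num at h
  refine h.congr fun x => ?_
  rw [momentPrim]; ring

/-- The non-convolution part of `∫_0^x ρ(x,y)² dy`. -/
noncomputable def rowSqLocal (α x : ℝ) : ℝ :=
  covSqInt α x + Real.exp (-x) ^ 2 * covSqInt α x +
    specCov α x ^ 2 * (1 - Real.exp (-x) ^ 2) / 2 +
    Real.exp (-x) ^ 2 * specCov α 0 ^ 2 * (1 - Real.exp (-x) ^ 2) / 2 -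
    2 * specCov α x * covDamp α x + 2 * specCov α 0 * Real.exp (-x) * covDamp α x +
    2 * Real.exp (-x) * specCov α x * covLaplace α x -
    2 * Real.exp (-x) ^ 2 * specCov α 0 * covLaplace α x -
    specCov α x * specCov α 0 * Real.exp (-x) * (1 - Real.exp (-x) ^ 2)

/-- Expand the square of the four-term covariance and substitute y ↦ x - y where needed. Only the
product c(x-y)c(y) gives a convolution; it is kept apart because it carries the factor e^{-x}. -/
theorem integral_dampCov_sq {α : ℝ} (h0 : 0 < α) (h2 : α < 2) (x : ℝ) :
    ∫ y in (0 : ℝ)..x, dampCov α x y ^ 2 =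
      rowSqLocal α x - 2 * (Real.exp (-x) * covConv α x) := by
  have hc := continuous_specCov h0 h2
  set c := specCov α with hcdef
  set E := Real.exp (-x) with hE
  have e : ∀ y : ℝ, dampCov α x y ^ 2 = c (x - y) ^ 2 + E ^ 2 * c y ^ 2 +
      (c x ^ 2 + E ^ 2 * c 0 ^ 2 - 2 * (c x * c 0 * E)) * Real.exp (-2 * y) +
      (-(2 * E)) * (c (x - y) * c y) +
      (2 * c 0 * E - 2 * c x) * (Real.exp (-y) * c (x - y)) +
      (2 * E * c x - 2 * E ^ 2 * c 0) * (Real.exp (-y) * c y) := by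
    intro y
    have e2 : Real.exp (-2 * y) = Real.exp (-y) ^ 2 := by
      rw [← Real.exp_nat_mul]; congr 1; push_cast; ring
    rw [dampCov, e2, show -x - y = -x + -y by ring, Real.exp_add, ← hcdef, ← hE]
    ring
  simp_rw [e]
  have i1 : Continuous fun y => c (x - y) ^ 2 := by fun_prop
  have i2 : Continuous fun y => E ^ 2 * c y ^ 2 := by fun_prop
  have i3 : Continuous fun y : ℝ => (c x ^ 2 + E ^ 2 * c 0 ^ 2 - 2 * (c x * c 0 * E)) *
    Real.exp (-2 * y) := by fun_prop
  have i4 : Continuous fun y => (-(2 * E)) * (c (x - y) * c y) := by fun_prop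
  have i5 : Continuous fun y => (2 * c 0 * E - 2 * c x) * (Real.exp (-y) * c (x - y)) := by fun_prop
  have i6 : Continuous fun y => (2 * E * c x - 2 * E ^ 2 * c 0) * (Real.exp (-y) * c y) := by
    fun_prop
  have I := fun {f : ℝ → ℝ} (h : Continuous f) => h.intervalIntegrable (μ := volume) 0 x
  rw [intervalIntegral.integral_add (I (by fun_prop)) (I i6),
    intervalIntegral.integral_add (I (by fun_prop)) (I i5),
    intervalIntegral.integral_add (I (by fun_prop)) (I i4),
    intervalIntegral.integral_add (I (by fun_prop)) (I i3),
    intervalIntegral.integral_add (I i1) (I i2)]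
  simp only [intervalIntegral.integral_const_mul]
  have v1 : ∫ y in (0 : ℝ)..x, c (x - y) ^ 2 = covSqInt α x := by
    have := intervalIntegral.integral_comp_sub_left (a := 0) (b := x) (fun y => c y ^ 2) x
    rw [sub_self, sub_zero] at this
    exact this
  have v3 : ∫ y in (0 : ℝ)..x, Real.exp (-2 * y) = (1 - E ^ 2) / 2 := by
    rw [intervalIntegral.integral_comp_mul_left (fun y => Real.exp y) (by norm_num), integral_exp,
      smul_eq_mul, mul_zero, Real.exp_zero, hE, ← Real.exp_nat_mul,
      show -2 * x = ((2 : ℕ) : ℝ) * -x by push_cast; ring]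
    ring
  have v5 : ∫ y in (0 : ℝ)..x, Real.exp (-y) * c (x - y) = covDamp α x := by
    have := intervalIntegral.integral_comp_sub_left (a := 0) (b := x)
      (fun y => Real.exp y * c y) x
    rw [sub_self, sub_zero] at this
    rw [covDamp, ← this, ← intervalIntegral.integral_const_mul]
    congr 1; ext y
    rw [← mul_assoc, ← Real.exp_add]; congr 2; ring
  rw [v1, v3, v5]
  unfold rowSqLocal covConv covLaplace
  rw [← hcdef, ← hE]
  have v2 : ∫ t in (0 : ℝ)..x, c t ^ 2 = covSqInt α x := rfl
  rw [v2]
  ring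

/-- A primitive of `rowSqLocal`. -/
noncomputable def rowSqPrim (α x : ℝ) : ℝ :=
  x * covSqInt α x - α * covSqInt α x - momentPrim α x + x * specCov α x ^ 2 / 2 +
    α * specCov α x ^ 2 / 2 - x * specCov α x * covDeriv α x +
    α * specCov α 0 * covLaplace α x - Real.exp (-x) ^ 2 * covSqInt α x / 2 -
    specCov α 0 ^ 2 * Real.exp (-x) ^ 2 / 4 + specCov α 0 ^ 2 * Real.exp (-x) ^ 4 / 8 -
    specCov α 0 * Real.exp (-x) *
      (covPot α x - covPotDeriv α x - α * specCov α 0 / 2 * Real.exp (-x)) +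
    covLaplace α x ^ 2 + specCov α 0 * Real.exp (-x) ^ 2 * covLaplace α x

theorem hasDerivAt_rowSqPrim {α x : ℝ} (h0 : 0 < α) (h2 : α < 2) (hx : 0 < x) :
    HasDerivAt (rowSqPrim α) (rowSqLocal α x) x := by
  have hc := hasDerivAt_specCov h0 h2 hx
  have hd := hasDerivAt_covDeriv h0 h2 hx
  have hm := hasDerivAt_momentPrim h0 h2 hx
  have hI := hasDerivAt_covSqInt h0 h2 x
  have hg := hasDerivAt_covLaplace h0 h2 x
  have hq := hasDerivAt_covPot h0 h2 hx
  have hq' := hasDerivAt_covPotDeriv h0 h2 hx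
  have hE := hasDerivAt_exp_neg x
  have hid := hasDerivAt_id x
  have h := (((((((((((hid.mul hI).sub (hI.const_mul α)).sub hm).add
    ((hid.mul (hc.pow 2)).div_const 2)).add (((hc.pow 2).const_mul α).div_const 2)).sub
    ((hid.mul hc).mul hd)).add (hg.const_mul (α * specCov α 0))).sub
    (((hE.pow 2).mul hI).div_const 2)).sub
    (((hE.pow 2).const_mul (specCov α 0 ^ 2)).div_const 4)).add
    (((hE.pow 4).const_mul (specCov α 0 ^ 2)).div_const 8)).sub
    ((hE.const_mul (specCov α 0)).mul ((hq.sub hq').sub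
      (hE.const_mul (α * specCov α 0 / 2))))).add (hg.pow 2) |>.add
    (((hE.pow 2).const_mul (specCov α 0)).mul hg)
  refine h.congr_deriv ?_
  simp only [id, Pi.mul_apply, Pi.sub_apply, Pi.pow_apply]
  -- With `covDamp` eliminated, both sides are polynomials in c, c', e^{-x}, the integrals and
  -- x^{α-2}.
  rw [rowSqLocal, covDamp_eq h0 h2 hx, covPot, covPotDeriv, noiseCov, rpow_sub_one_eq hx]
  push_cast
  ring

theorem tendsto_rowSqPrim_zero {α : ℝ} (h0 : 0 < α) (h2 : α < 2) :
    Tendsto (rowSqPrim α) (𝓝[>] 0)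
      (𝓝 (α * specCov α 0 ^ 2 / 2 - specCov α 0 ^ 2 / 8)) := by
  have hI : Tendsto (covSqInt α) (𝓝[>] 0) (𝓝 0) := by
    have := (hasDerivAt_covSqInt h0 h2 0).continuousAt.tendsto.mono_left
      (nhdsWithin_le_nhds (s := Set.Ioi (0 : ℝ)))
    simpa [covSqInt] using this
  have hg : Tendsto (covLaplace α) (𝓝[>] 0) (𝓝 0) := by
    have := (hasDerivAt_covLaplace h0 h2 0).continuousAt.tendsto.mono_left
      (nhdsWithin_le_nhds (s := Set.Ioi (0 : ℝ)))
    simpa [covLaplace] using this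
  have hc := tendsto_specCov_zero h0 h2
  have hE := tendsto_exp_neg_zero
  have hx := tendsto_id_zero
  have h := (((((((((((hx.mul hI).sub (hI.const_mul α)).sub (tendsto_momentPrim_zero h0 h2)).add
    ((hx.mul (hc.pow 2)).div_const 2)).add (((hc.pow 2).const_mul α).div_const 2)).sub
    (hc.mul (tendsto_mul_covDeriv_zero h0 h2))).add (hg.const_mul (α * specCov α 0))).sub
    (((hE.pow 2).mul hI).div_const 2)).sub
    (((hE.pow 2).const_mul (specCov α 0 ^ 2)).div_const 4)).add
    (((hE.pow 4).const_mul (specCov α 0 ^ 2)).div_const 8)).sub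
    ((hE.const_mul (specCov α 0)).mul
      (((tendsto_covPot_zero h0 h2).sub (tendsto_covPotDeriv_zero h0 h2)).sub
      (hE.const_mul (α * specCov α 0 / 2))))).add (hg.pow 2) |>.add
    (((hE.pow 2).const_mul (specCov α 0)).mul hg)
  convert h using 1
  · ext x
    rw [rowSqPrim]; ring
  · congr 1; ring

/-! ### The squared norm up to exponentially small terms. -/

/-- `∫_0^T e^{-t} c(t) g(T-t) dt`, where `g` is `covLaplace`. -/
noncomputable def covLaplaceConv (α T : ℝ) : ℝ :=
  ∫ t in (0 : ℝ)..T, Real.exp (-t) * specCov α t * covLaplace α (T - t)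

/-- Splitting e^{-x} = e^{-y} e^{-(x-y)} and swapping the triangle makes the inner integral a
truncated Laplace integral of c. -/
theorem integral_exp_neg_mul_covConv {α : ℝ} (h0 : 0 < α) (h2 : α < 2) {T : ℝ} (hT : 0 ≤ T) :
    ∫ x in (0 : ℝ)..T, Real.exp (-x) * covConv α x = covLaplaceConv α T := by
  have hc := continuous_specCov h0 h2
  have h := integral_triangle_swap (F := fun p : ℝ × ℝ =>
    Real.exp (-p.1) * (specCov α (p.1 - p.2) * specCov α p.2)) (by fun_prop) hT
  simp only [intervalIntegral.integral_const_mul] at h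
  unfold covConv
  rw [h, covLaplaceConv]
  refine intervalIntegral.integral_congr fun y _ => ?_
  have := intervalIntegral.integral_comp_sub_right (a := y) (b := T)
    (fun x => Real.exp (-x) * specCov α x) y
  rw [sub_self] at this
  rw [covLaplace, ← this, ← intervalIntegral.integral_const_mul]
  congr 1; ext x
  rw [show -x = -y + -(x - y) by ring, Real.exp_add]; ring

theorem normSqFT_eq {α T : ℝ} (h0 : 0 < α) (h2 : α < 2) (hT : 0 < T) :
    normSqFT α T = (specCov α 0 - 2 * Real.exp (-T) * specCov α T +
        Real.exp (-T) ^ 2 * specCov α 0) ^ 2 +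
      4 * (rowSqLocal α T - 2 * (Real.exp (-T) * covConv α T)) +
      8 * (rowSqPrim α T - (α * specCov α 0 ^ 2 / 2 - specCov α 0 ^ 2 / 8) -
        2 * covLaplaceConv α T) := by
  have hc := continuous_specCov h0 h2
  have cV : Continuous (covConv α) := by
    unfold covConv
    exact intervalIntegral.continuous_parametric_intervalIntegral_of_continuous
      (by fun_prop) continuous_id
  have cI : Continuous (covSqInt α) :=
    continuous_iff_continuousAt.2 fun x => (hasDerivAt_covSqInt h0 h2 x).continuousAt
  have cg : Continuous (covLaplace α) :=
    continuous_iff_continuousAt.2 fun x => (hasDerivAt_covLaplace h0 h2 x).continuousAt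
  have cy : Continuous (covDamp α) := by
    unfold covDamp
    refine (by fun_prop : Continuous fun t : ℝ => Real.exp (-t)).mul ?_
    exact intervalIntegral.continuous_primitive
      (fun a b => (Real.continuous_exp.mul hc).intervalIntegrable a b) 0
  have cr : Continuous (rowSqLocal α) := by
    unfold rowSqLocal; fun_prop
  have cEV : Continuous fun x => Real.exp (-x) * covConv α x := by fun_prop
  have h := intervalIntegral.integral_eq_sub_of_hasDerivAt_of_tendsto hT
    (fun y hy => hasDerivAt_rowSqPrim h0 h2 hy.1) (cr.intervalIntegrable _ _)
    (tendsto_rowSqPrim_zero h0 h2)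
    ((hasDerivAt_rowSqPrim h0 h2 hT).continuousAt.tendsto.mono_left nhdsWithin_le_nhds)
  unfold normSqFT
  simp_rw [integral_dampCov_sq h0 h2]
  rw [intervalIntegral.integral_sub (cr.intervalIntegrable _ _)
    ((cEV.const_mul 2).intervalIntegrable _ _), intervalIntegral.integral_const_mul,
    integral_exp_neg_mul_covConv h0 h2 hT.le, h, dampCov, sub_self,
    show -T - T = ((2 : ℕ) : ℝ) * -T by push_cast; ring, Real.exp_nat_mul]
  ring

theorem specCov_zero_nonneg {α : ℝ} (h0 : 0 < α) (h2 : α < 2) : 0 ≤ specCov α 0 := by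
  rw [specCov_zero h0 h2]
  have := Real.Gamma_pos_of_pos (show 0 < α + 1 by linarith)
  positivity

theorem abs_specCov_le {α : ℝ} (h0 : 0 < α) (h2 : α < 2) (τ : ℝ) :
    |specCov α τ| ≤ specCov α 0 := by
  have hC := specConst_pos h0 h2
  have h := norm_integral_le_of_norm_le (integrable_specDensity h0 h2)
    (f := fun ξ => Real.cos (τ * ξ) * specDensity α ξ) (Eventually.of_forall fun ξ => by
      rw [norm_mul, Real.norm_of_nonneg (specDensity_nonneg α ξ)]
      exact mul_le_of_le_one_left (specDensity_nonneg α ξ) (Real.abs_cos_le_one _))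
  rw [specCov, abs_mul, abs_of_pos (inv_pos.2 hC)]
  unfold specCov
  simp only [zero_mul, Real.cos_zero, one_mul]
  exact mul_le_mul_of_nonneg_left h (inv_pos.2 hC).le

theorem intervalIntegral_exp_neg_mul (a b : ℝ) :
    ∫ t in a..b, Real.exp (-t) = Real.exp (-a) - Real.exp (-b) := by
  rw [intervalIntegral.integral_comp_neg fun t => Real.exp t, integral_exp]

theorem abs_covLaplace_sub_le {α : ℝ} (h0 : 0 < α) (h2 : α < 2) {a b : ℝ} (hab : a ≤ b) :
    |covLaplace α b - covLaplace α a| ≤ specCov α 0 * (Real.exp (-a) - Real.exp (-b)) := by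
  have hc : Continuous fun t => Real.exp (-t) * specCov α t :=
    (by fun_prop : Continuous fun t : ℝ => Real.exp (-t)).mul (continuous_specCov h0 h2)
  have e : covLaplace α b - covLaplace α a = ∫ t in a..b, Real.exp (-t) * specCov α t :=
    intervalIntegral.integral_interval_sub_left (hc.intervalIntegrable _ _)
      (hc.intervalIntegrable _ _)
  rw [e, ← intervalIntegral_exp_neg_mul, ← intervalIntegral.integral_const_mul]
  refine intervalIntegral.norm_integral_le_of_norm_le (μ := volume)
    (f := fun t => Real.exp (-t) * specCov α t) (g := fun t => specCov α 0 * Real.exp (-t)) hab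
    (Eventually.of_forall fun t _ => ?_) ((by fun_prop : Continuous fun t : ℝ => specCov α 0 * Real.exp (-t)).intervalIntegrable _ _)
  rw [norm_mul, Real.norm_of_nonneg (Real.exp_pos _).le, mul_comm]
  exact mul_le_mul_of_nonneg_right (abs_specCov_le h0 h2 t) (Real.exp_pos _).le

theorem isBigO_specCov_one {α : ℝ} (h0 : 0 < α) (h2 : α < 2) (l : Filter ℝ) :
    specCov α =O[l] (fun _ => (1 : ℝ)) :=
  IsBigO.of_bound (specCov α 0) (Eventually.of_forall fun x => by
    simpa using abs_specCov_le h0 h2 x)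

/-- `tailExp` is polynomially bounded. -/
theorem abs_tailExp_le {α x : ℝ} (h2 : α < 2) (hx : 1 ≤ x) :
    |tailExp α x| ≤ x + 1 := by
  have hx0 : 0 < x := by linarith
  have hi := (integrableOn_exp_neg_mul_rpow (s := 1) (by norm_num)).mono_set
    (Set.Ioi_subset_Ioi hx0.le)
  have h := norm_integral_le_of_norm_le (μ := volume.restrict (Ioi x)) hi
    (f := fun v => Real.exp (-v) * v ^ (α - 1)) (by
      filter_upwards [ae_restrict_mem measurableSet_Ioi] with v hv
      have hv : x < v := hv
      rw [Real.norm_of_nonneg (mul_nonneg (Real.exp_pos _).le (Real.rpow_nonneg (by linarith) _))]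
      refine mul_le_mul_of_nonneg_left ?_ (Real.exp_pos _).le
      exact Real.rpow_le_rpow_of_exponent_le (by linarith) (by linarith))
  have e : ∫ v in Ioi x, Real.exp (-v) * v ^ (1 : ℝ) = Real.exp (-x) * (x + 1) := by
    have hd : ∀ v ∈ Ici x, HasDerivAt (fun v : ℝ => -(Real.exp (-v) * (v + 1)))
        (Real.exp (-v) * v ^ (1 : ℝ)) v := by
      intro v _
      refine ((hasDerivAt_exp_neg v).mul ((hasDerivAt_id v).add_const 1)).neg.congr_deriv ?_
      rw [Real.rpow_one]; simp only [id]; ring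
    have ht : Tendsto (fun v : ℝ => -(Real.exp (-v) * (v + 1))) atTop (𝓝 0) := by
      have h1 := tendsto_rpow_mul_exp_neg_mul_atTop_nhds_zero 1 1 one_pos
      have h2 := h1.add Real.tendsto_exp_neg_atTop_nhds_zero
      rw [add_zero] at h2
      rw [← neg_zero]
      refine (h2.congr fun v => ?_).neg
      simp; ring
    rw [integral_Ioi_of_hasDerivAt_of_tendsto' hd hi ht]; ring
  rw [tailExp, abs_mul, abs_of_pos (Real.exp_pos _)]
  rw [e] at h
  calc _ ≤ Real.exp x * (Real.exp (-x) * (x + 1)) :=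
        mul_le_mul_of_nonneg_left h (Real.exp_pos _).le
    _ = _ := by rw [← mul_assoc, ← Real.exp_add]; simp

/-- In the closed form for `covLaplace`, the factor q + q' grows at most like x², so e^{-x} removes
it and only the value of q at 0 remains. -/
theorem tendsto_covLaplace {α : ℝ} (h0 : 0 < α) (h2 : α < 2) :
    Tendsto (covLaplace α) atTop (𝓝 (α * specCov α 0 / 2)) := by
  have h1T : (fun _ : ℝ => (1 : ℝ)) =O[atTop] fun T => T := IsBigO.of_bound 1 (by
    filter_upwards [eventually_ge_atTop 1] with x hx
    rw [norm_one, one_mul]; exact hx.trans (le_abs_self x))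
  have hs : (fun x : ℝ => x ^ (α - 1)) =O[atTop] fun T => T := IsBigO.of_bound 1 (by
    filter_upwards [eventually_ge_atTop 1] with x hx
    have hx0 : 0 < x := by linarith
    rw [Real.norm_of_nonneg (Real.rpow_nonneg hx0.le _), Real.norm_of_nonneg hx0.le, one_mul]
    nth_rw 2 [← Real.rpow_one x]
    exact Real.rpow_le_rpow_of_exponent_le hx (by linarith))
  have hp : tailExp α =O[atTop] fun T => T := IsBigO.of_bound 2 (by
    filter_upwards [eventually_ge_atTop 1] with x hx
    rw [Real.norm_of_nonneg (by linarith : 0 ≤ x)]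
    exact (abs_tailExp_le h2 hx).trans (by linarith))
  have hc := isBigO_specCov_one h0 h2 atTop
  have hd : covDeriv α =O[atTop] fun T => T := by
    refine (((hp.sub hs).const_mul_left (α / 2)).sub (hc.trans h1T)).congr' ?_ EventuallyEq.rfl
    filter_upwards [eventually_gt_atTop 0] with x hx
    rw [covDeriv, specCov_eq' h0 h2 hx]; ring
  have hT2 : (fun T : ℝ => T) =O[atTop] fun T => T ^ 2 := by
    simpa [pow_two] using h1T.mul (isBigO_refl (fun T : ℝ => T) atTop)
  have hxd : (fun x => x * covDeriv α x) =O[atTop] fun T => T ^ 2 := by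
    simpa [pow_two] using (isBigO_refl (fun T : ℝ => T) atTop).mul hd
  have hxc : (fun x => x * specCov α x) =O[atTop] fun T => T ^ 2 := by
    simpa [pow_two] using (isBigO_refl (fun T : ℝ => T) atTop).mul (hc.trans h1T)
  have hq : (fun x => covPot α x + covPotDeriv α x) =O[atTop] fun T => T ^ 2 := by
    refine ((((((hc.trans (h1T.trans hT2)).const_mul_left (α / 2)).sub
      (hxd.const_mul_left (1 / 2))).add ((hd.trans hT2).const_mul_left ((α - 1) / 2))).sub
      (hxc.const_mul_left (1 / 2))).add ((hs.trans hT2).const_mul_left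
        (α / 4 * (α - 1)))).congr_left fun x => ?_
    rw [covPot, covPotDeriv]; ring
  have ht : Tendsto (fun x : ℝ => Real.exp (-x) * x ^ 2) atTop (𝓝 0) := by
    have := Real.tendsto_pow_mul_exp_neg_atTop_nhds_zero 2
    exact this.congr fun x => mul_comm _ _
  have h3 := ((isBigO_refl (fun x : ℝ => Real.exp (-x)) atTop).mul hq).trans_tendsto ht
  have h4 := h3.const_sub (α * specCov α 0 / 2)
  rw [sub_zero] at h4
  refine h4.congr' ?_
  filter_upwards [eventually_gt_atTop 0] with x hx
  rw [covLaplace_eq h0 h2 hx]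

theorem abs_covLaplace_sub_limit_le {α : ℝ} (h0 : 0 < α) (h2 : α < 2) (x : ℝ) :
    |covLaplace α x - α * specCov α 0 / 2| ≤ specCov α 0 * Real.exp (-x) := by
  have h := ((tendsto_covLaplace h0 h2).sub_const (covLaplace α x)).abs
  rw [abs_sub_comm]
  refine le_of_tendsto h ?_
  filter_upwards [eventually_ge_atTop x] with b hb
  refine (abs_covLaplace_sub_le h0 h2 hb).trans ?_
  refine mul_le_mul_of_nonneg_left ?_ (specCov_zero_nonneg h0 h2)
  linarith [Real.exp_pos (-b)]

/-- The Laplace integral up to T - t is within c(0) e^{-(T-t)} of its limit. Multiplied by e^{-t},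
this is of size e^{-T} uniformly in t. -/
theorem abs_covLaplaceConv_sub_le {α : ℝ} (h0 : 0 < α) (h2 : α < 2) {T : ℝ} (hT : 0 ≤ T) :
    |covLaplaceConv α T - α * specCov α 0 / 2 * covLaplace α T| ≤
      specCov α 0 ^ 2 * (T * Real.exp (-T)) := by
  have hc := continuous_specCov h0 h2
  have cg : Continuous (covLaplace α) :=
    continuous_iff_continuousAt.2 fun x => (hasDerivAt_covLaplace h0 h2 x).continuousAt
  have e : covLaplaceConv α T - α * specCov α 0 / 2 * covLaplace α T =
      ∫ t in (0 : ℝ)..T, Real.exp (-t) * specCov α t *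
        (covLaplace α (T - t) - α * specCov α 0 / 2) := by
    rw [covLaplaceConv, covLaplace, ← intervalIntegral.integral_const_mul,
      ← intervalIntegral.integral_sub ((by fun_prop : Continuous fun t =>
        Real.exp (-t) * specCov α t * covLaplace α (T - t)).intervalIntegrable _ _)
        ((by fun_prop : Continuous fun t =>
        α * specCov α 0 / 2 * (Real.exp (-t) * specCov α t)).intervalIntegrable _ _)]
    congr 1; ext t; rw [covLaplace]; ring
  rw [e]
  have := intervalIntegral.norm_integral_le_of_norm_le_const (a := 0) (b := T)
    (C := specCov α 0 ^ 2 * Real.exp (-T)) (f := fun t => Real.exp (-t) * specCov α t *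
        (covLaplace α (T - t) - α * specCov α 0 / 2)) (fun t _ => ?_)
  · rw [sub_zero, abs_of_nonneg hT] at this
    exact this.trans (le_of_eq (by ring))
  · rw [norm_mul, norm_mul, Real.norm_of_nonneg (Real.exp_pos _).le]
    have h3 : Real.exp (-T) = Real.exp (-t) * Real.exp (-(T - t)) := by
      rw [← Real.exp_add]; congr 1; ring
    calc _ ≤ Real.exp (-t) * specCov α 0 * (specCov α 0 * Real.exp (-(T - t))) := by
          gcongr
          · have := specCov_zero_nonneg h0 h2; positivity
          · exact abs_specCov_le h0 h2 t
          · exact abs_covLaplace_sub_limit_le h0 h2 (T - t)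
      _ = _ := by rw [h3]; ring

theorem abs_covConv_le {α : ℝ} (h0 : 0 < α) (h2 : α < 2) {x : ℝ} (hx : 0 ≤ x) :
    |covConv α x| ≤ specCov α 0 ^ 2 * x := by
  have := intervalIntegral.norm_integral_le_of_norm_le_const (a := 0) (b := x)
    (C := specCov α 0 ^ 2) (f := fun t => specCov α (x - t) * specCov α t) (fun t _ => by
      rw [norm_mul, pow_two]
      exact mul_le_mul (abs_specCov_le h0 h2 _) (abs_specCov_le h0 h2 _) (norm_nonneg _)
        (specCov_zero_nonneg h0 h2))
  rwa [sub_zero, abs_of_nonneg hx] at this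

/-- `normSqFT` up to exponentially small terms. -/
noncomputable def normSqMain (α T : ℝ) : ℝ :=
  8 * T * covSqInt α T - 4 * (2 * α - 1) * covSqInt α T - 8 * momentPrim α T +
    2 * (1 - α) ^ 2 * specCov α 0 ^ 2 + 2 * specCov α T ^ 2 -
    4 * T * specCov α T * covDeriv α T + 4 * (α - 1) * specCov α T * covDeriv α T +
    4 * T * noiseCov α T * specCov α T

/-- Write g for `covLaplace` and q0 for its limit αc(0)/2. The convolution contributes -16 q0 g up
to an exponentially small error, which cancels 8αc(0) g. What is left, 8g², is close to 8q0² =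
2α²c(0)²; with the other constants this gives 2(1-α)²c(0)². -/
theorem normSqFT_sub_normSqMain {α : ℝ} (h0 : 0 < α) (h2 : α < 2) :
    (fun T => normSqFT α T - normSqMain α T) =O[atTop] fun T => T * Real.exp (-T) := by
  set c0 := specCov α 0 with hc0
  set q0 := α * c0 / 2 with hq0
  have hE1 : (fun T : ℝ => Real.exp (-T)) =O[atTop] fun _ => (1 : ℝ) :=
    Real.tendsto_exp_neg_atTop_nhds_zero.isBigO_one ℝ
  have hc := isBigO_specCov_one h0 h2 atTop
  have hg : covLaplace α =O[atTop] fun _ => (1 : ℝ) := (tendsto_covLaplace h0 h2).isBigO_one ℝ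
  have hV : covConv α =O[atTop] fun T => T := IsBigO.of_bound (c0 ^ 2) (by
    filter_upwards [eventually_ge_atTop 0] with x hx
    rw [Real.norm_of_nonneg hx]
    exact abs_covConv_le h0 h2 hx)
  have h1T : (fun _ : ℝ => (1 : ℝ)) =O[atTop] fun T => T := IsBigO.of_bound 1 (by
    filter_upwards [eventually_ge_atTop 1] with x hx
    rw [norm_one, one_mul]; exact hx.trans (le_abs_self x))
  have hET : (fun T : ℝ => Real.exp (-T)) =O[atTop] fun T => T * Real.exp (-T) := by
    simpa using h1T.mul (isBigO_refl (fun T : ℝ => Real.exp (-T)) atTop)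
  have hk : ∀ k : ℝ, (fun _ : ℝ => k) =O[atTop] fun _ => (1 : ℝ) := fun k => isBigO_const_const k one_ne_zero _
  have mul1 : ∀ {f g : ℝ → ℝ}, f =O[atTop] (fun _ => (1 : ℝ)) → g =O[atTop] (fun _ => (1 : ℝ)) →
      (fun T => f T * g T) =O[atTop] fun _ => (1 : ℝ) := fun hf hg => by simpa using hf.mul hg
  have hgq : (fun T => covLaplace α T - q0) =O[atTop] fun T => T * Real.exp (-T) :=
    IsBigO.trans (IsBigO.of_bound c0 (Eventually.of_forall fun x => by
      rw [Real.norm_of_nonneg (Real.exp_pos _).le]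
      exact abs_covLaplace_sub_limit_le h0 h2 x)) hET
  have hW : (fun T => covLaplaceConv α T - q0 * covLaplace α T) =O[atTop]
      fun T => T * Real.exp (-T) := IsBigO.of_bound (c0 ^ 2) (by
    filter_upwards [eventually_ge_atTop 0] with x hx
    rw [Real.norm_of_nonneg (mul_nonneg hx (Real.exp_pos _).le)]
    exact abs_covLaplaceConv_sub_le h0 h2 hx)
  have hB1 := mul1 (((mul1 (hk c0) hE1)).sub (mul1 (hk 2) hc))
    (((hk (2 * c0)).sub (mul1 (hk 2) (mul1 hE1 hc))).add (mul1 (hk c0) (mul1 hE1 hE1)))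
  have hB2 := (((((mul1 (mul1 (mul1 hc hc) hE1) (hk (-2))).add
    (mul1 hE1 (mul1 (hk (2 * c0 ^ 2)) ((hk 1).sub (mul1 hE1 hE1))))).add
    (mul1 (hk 8) (mul1 hc hg))).sub (mul1 (hk (4 * c0)) (mul1 hc ((hk 1).sub (mul1 hE1 hE1))))).add
    (mul1 (hk (8 * q0)) hc)).add
    ((mul1 (hk (c0 ^ 2)) (mul1 hE1 (mul1 hE1 hE1))).sub (mul1 (hk (2 * c0 ^ 2)) hE1))
  -- `hB1` and `hB2` bound the coefficients of e^{-T}: the first comes from ρ(T,T)², the second from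
  -- the row integral and its primitive.
  have hA := (((hB1.add hB2).trans h1T).sub (hV.const_mul_left 8)).mul
    (isBigO_refl (fun T : ℝ => Real.exp (-T)) atTop)
  have hG : (fun T => (covLaplace α T - q0) * (8 * covLaplace α T + 8 * q0)) =O[atTop]
      fun T => T * Real.exp (-T) := by
    simpa using hgq.mul ((mul1 (hk 8) hg).add (hk (8 * q0)))
  refine ((hA.add hG).sub (hW.const_mul_left 16)).congr' ?_ EventuallyEq.rfl
  filter_upwards [eventually_gt_atTop 0] with T hT
  rw [normSqFT_eq h0 h2 hT, normSqMain, rowSqLocal, rowSqPrim]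
  have ey := covDamp_eq h0 h2 hT
  have ek : T * noiseCov α T = α / 2 * (α - 1) * T ^ (α - 1) := by
    rw [noiseCov, rpow_sub_one_eq hT]; ring
  rw [← ey, ← hc0]
  rw [← hc0, ← hq0, covPot, covPotDeriv, ← ek] at ey
  have e2 : α * c0 = 2 * q0 := by rw [hq0]; ring
  clear_value q0 c0
  linear_combination (8 * specCov α T) * ey -
    (8 * covLaplace α T - 2 * (2 * c0 - α * c0 - 2 * q0) + 4 * c0 -
      4 * (α * c0 + 2 * q0)) * e2

/-! ### Large-time expansions of the covariance and its derivative. -/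

theorem integrableOn_Ioi_exp_neg_mul_rpow {x : ℝ} (hx : 1 ≤ x) (s : ℝ) :
    IntegrableOn (fun v : ℝ => Real.exp (-v) * v ^ s) (Ioi x) := by
  have hi := (integrableOn_exp_neg_mul_rpow (s := max s 0)
    (by linarith [le_max_right s 0])).mono_set
    (Set.Ioi_subset_Ioi (by linarith : (0 : ℝ) ≤ x))
  refine hi.mono' (Measurable.aestronglyMeasurable (by fun_prop)) ?_
  filter_upwards [ae_restrict_mem measurableSet_Ioi] with v hv
  have hv : x < v := hv
  rw [Real.norm_of_nonneg (mul_nonneg (Real.exp_pos _).le (Real.rpow_nonneg (by linarith) _))]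
  exact mul_le_mul_of_nonneg_left
    (Real.rpow_le_rpow_of_exponent_le (by linarith) (le_max_left _ _)) (Real.exp_pos _).le

theorem tailExp_recurrence {x : ℝ} (hx : 1 ≤ x) (α : ℝ) :
    tailExp α x = x ^ (α - 1) + (α - 1) * tailExp (α - 1) x := by
  have hi1 := integrableOn_Ioi_exp_neg_mul_rpow hx (α - 1)
  have hi2 := integrableOn_Ioi_exp_neg_mul_rpow hx (α - 1 - 1)
  have hd : ∀ v ∈ Ici x, HasDerivAt (fun v : ℝ => -(Real.exp (-v) * v ^ (α - 1)))
      (Real.exp (-v) * v ^ (α - 1) - (α - 1) * (Real.exp (-v) * v ^ (α - 1 - 1))) v := by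
    intro v hv
    have hv0 : x ≤ v := hv
    have := ((hasDerivAt_exp_neg v).mul
      (Real.hasDerivAt_rpow_const (p := α - 1) (Or.inl (by linarith : v ≠ 0)))).neg
    refine this.congr_deriv ?_
    ring
  have ht : Tendsto (fun v : ℝ => -(Real.exp (-v) * v ^ (α - 1))) atTop (𝓝 0) := by
    have := tendsto_rpow_mul_exp_neg_mul_atTop_nhds_zero (α - 1) 1 one_pos
    rw [← neg_zero]
    refine Tendsto.neg (this.congr fun v => ?_)
    rw [mul_comm]; simp
  have := integral_Ioi_of_hasDerivAt_of_tendsto' hd (hi1.sub (hi2.const_mul (α - 1))) ht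
  rw [integral_sub hi1 (hi2.const_mul (α - 1)), integral_const_mul] at this
  rw [tailExp, tailExp]
  have h3 : Real.exp x * Real.exp (-x) = 1 := by rw [← Real.exp_add]; simp
  linear_combination Real.exp x * this + x ^ (α - 1) * h3

theorem abs_tailExp_le_rpow {α x : ℝ} (hx : 1 ≤ x) (hα : α ≤ 1) :
    |tailExp α x| ≤ x ^ (α - 1) := by
  have hx0 : 0 < x := by linarith
  have h := norm_integral_le_of_norm_le (μ := volume.restrict (Ioi x))
    (((integrableOn_Ioi_exp_neg_mul_rpow hx 0)).const_mul (x ^ (α - 1)))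
    (f := fun v => Real.exp (-v) * v ^ (α - 1)) (by
      filter_upwards [ae_restrict_mem measurableSet_Ioi] with v hv
      have hv : x < v := hv
      rw [Real.norm_of_nonneg (mul_nonneg (Real.exp_pos _).le (Real.rpow_nonneg (by linarith) _)),
        Real.rpow_zero, mul_one, mul_comm]
      exact mul_le_mul_of_nonneg_right
        (Real.rpow_le_rpow_of_nonpos hx0 hv.le (by linarith)) (Real.exp_pos _).le)
  rw [integral_const_mul] at h
  simp only [Real.rpow_zero, mul_one, integral_exp_neg_Ioi] at h
  rw [tailExp, abs_mul, abs_of_pos (Real.exp_pos _)]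
  calc _ ≤ Real.exp x * (x ^ (α - 1) * Real.exp (-x)) :=
        mul_le_mul_of_nonneg_left h (Real.exp_pos _).le
    _ = x ^ (α - 1) * (Real.exp x * Real.exp (-x)) := by ring
    _ = _ := by rw [← Real.exp_add]; simp

/-- Four integrations by parts; the remainder is estimated by monotonicity of the power. The
constants here and below are explicit in α because the critical case needs the error bounds in a
limit α → 3/2. -/
theorem abs_tailExp_sub_le {α x : ℝ} (hx : 1 ≤ x) (h0 : 0 < α) (h2 : α ≤ 2) :
    |tailExp α x - (x ^ (α - 1) + (α - 1) * x ^ (α - 2) + (α - 1) * (α - 2) * x ^ (α - 3) +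
      (α - 1) * (α - 2) * (α - 3) * x ^ (α - 4))| ≤ 24 * x ^ (α - 5) := by
  have e : tailExp α x - (x ^ (α - 1) + (α - 1) * x ^ (α - 2) + (α - 1) * (α - 2) * x ^ (α - 3) +
      (α - 1) * (α - 2) * (α - 3) * x ^ (α - 4)) =
      (α - 1) * (α - 2) * (α - 3) * (α - 4) * tailExp (α - 4) x := by
    have r1 := tailExp_recurrence hx α
    have r2 := tailExp_recurrence hx (α - 1)
    have r3 := tailExp_recurrence hx (α - 2)
    have r4 := tailExp_recurrence hx (α - 3)
    rw [show α - 1 - 1 = α - 2 by ring] at r2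
    rw [show α - 2 - 1 = α - 3 by ring] at r3
    rw [show α - 3 - 1 = α - 4 by ring] at r4
    rw [r1, r2, r3, r4]; ring
  have h4 := abs_tailExp_le_rpow hx (show α - 4 ≤ 1 by linarith)
  rw [show α - 4 - 1 = α - 5 by ring] at h4
  rw [e, abs_mul, abs_mul, abs_mul, abs_mul]
  have b1 : |α - 1| ≤ 1 := abs_le.2 ⟨by linarith, by linarith⟩
  have b2 : |α - 2| ≤ 2 := abs_le.2 ⟨by linarith, by linarith⟩
  have b3 : |α - 3| ≤ 3 := abs_le.2 ⟨by linarith, by linarith⟩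
  have b4 : |α - 4| ≤ 4 := abs_le.2 ⟨by linarith, by linarith⟩
  calc _ ≤ 1 * 2 * 3 * 4 * x ^ (α - 5) := by gcongr
    _ = _ := by ring

/-- The integral `∫_1^x e^{v-x} v^s dv`. -/
noncomputable def midExp (s x : ℝ) : ℝ := Real.exp (-x) * ∫ v in (1 : ℝ)..x, Real.exp v * v ^ s

theorem continuousOn_exp_mul_rpow {x : ℝ} (hx : 1 ≤ x) (s : ℝ) :
    ContinuousOn (fun v : ℝ => Real.exp v * v ^ s) (uIcc 1 x) := by
  rw [uIcc_of_le hx]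
  exact Real.continuous_exp.continuousOn.mul (continuousOn_id.rpow_const fun v hv =>
    Or.inl (by have := hv.1; simp only [id]; linarith))

theorem midExp_recurrence {x : ℝ} (hx : 1 ≤ x) (s : ℝ) :
    midExp s x = x ^ s - Real.exp (1 - x) - s * midExp (s - 1) x := by
  have hi1 := (continuousOn_exp_mul_rpow hx s).intervalIntegrable (μ := volume)
  have hi2 := (continuousOn_exp_mul_rpow hx (s - 1)).intervalIntegrable (μ := volume)
  have hd : ∀ v ∈ uIcc 1 x, HasDerivAt (fun v : ℝ => Real.exp v * v ^ s)
      (Real.exp v * v ^ s + s * (Real.exp v * v ^ (s - 1))) v := by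
    intro v hv
    rw [uIcc_of_le hx] at hv
    have := (Real.hasDerivAt_exp v).mul
      (Real.hasDerivAt_rpow_const (p := s) (Or.inl (by linarith [hv.1] : v ≠ 0)))
    refine this.congr_deriv ?_
    ring
  have := intervalIntegral.integral_eq_sub_of_hasDerivAt hd (hi1.add (hi2.const_mul s))
  rw [intervalIntegral.integral_add hi1 (hi2.const_mul s), intervalIntegral.integral_const_mul,
    Real.one_rpow] at this
  rw [midExp, midExp, show (1 - x) = -x + 1 by ring, Real.exp_add]
  have h3 : Real.exp (-x) * Real.exp x = 1 := by rw [← Real.exp_add]; simp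
  linear_combination Real.exp (-x) * this + x ^ s * h3

theorem abs_midExp_le {s x : ℝ} (hx : 1 ≤ x) (h5 : -5 ≤ s) (hs : s ≤ 0) :
    |midExp s x| ≤ 15360 * x ^ s := by
  have hx0 : 0 < x := by linarith
  have key : ∀ v ∈ Ioc 1 x, ‖Real.exp v * v ^ s‖ ≤
      3840 * Real.exp (x / 2 + 1 / 2) * x ^ s * Real.exp (v / 2) := by
    intro v hv
    have hv1 := hv.1
    have hv0 : 0 < v := by linarith
    rw [Real.norm_of_nonneg (by positivity)]
    -- For 1 ≤ v ≤ x one has x ≤ v(1 + x - v), so replacing v by x in the negative power costs at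
    -- most the fifth power of 1 + x - v. Half of the exponential decay absorbs it; 3840 = 2⁵ · 5!.
    have h1 : v ^ s ≤ x ^ s * (1 + x - v) ^ (5 : ℕ) := by
      have h2 : x ≤ v * (1 + x - v) := by nlinarith [hv.2]
      have h3 : (v * (1 + x - v)) ^ s ≤ x ^ s := Real.rpow_le_rpow_of_nonpos hx0 h2 hs
      have h4 : 0 < 1 + x - v := by linarith [hv.2]
      rw [Real.mul_rpow hv0.le h4.le] at h3
      have h6 : (1 + x - v) ^ (5 : ℕ) * (1 + x - v) ^ s ≥ 1 := by
        rw [← Real.rpow_natCast, ← Real.rpow_add h4]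
        exact Real.one_le_rpow (by linarith [hv.2]) (by push_cast; linarith)
      calc v ^ s = v ^ s * 1 := by ring
        _ ≤ v ^ s * ((1 + x - v) ^ (5 : ℕ) * (1 + x - v) ^ s) := by gcongr
        _ = (v ^ s * (1 + x - v) ^ s) * (1 + x - v) ^ (5 : ℕ) := by ring
        _ ≤ _ := by gcongr
    have h7 : (1 + x - v) ^ 5 ≤ 3840 * Real.exp ((1 + x - v) / 2) := by
      have := Real.pow_div_factorial_le_exp ((1 + x - v) / 2) (by linarith [hv.2]) 5
      simp only [Nat.factorial] at this
      norm_num at this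
      have e : ((1 + x - v) / 2) ^ 5 / 120 = (1 + x - v) ^ 5 / 3840 := by ring
      rw [e, div_le_iff₀ (by norm_num)] at this
      linarith
    have h8 : Real.exp v * Real.exp ((1 + x - v) / 2) =
        Real.exp (x / 2 + 1 / 2) * Real.exp (v / 2) := by
      rw [← Real.exp_add, ← Real.exp_add]; congr 1; ring
    calc Real.exp v * v ^ s ≤ Real.exp v * (x ^ s * (3840 * Real.exp ((1 + x - v) / 2))) := by
          gcongr; exact h1.trans (by gcongr)
      _ = 3840 * x ^ s * (Real.exp v * Real.exp ((1 + x - v) / 2)) := by ring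
      _ = _ := by rw [h8]; ring
  have h := intervalIntegral.norm_integral_le_of_norm_le (μ := volume) hx
    (Eventually.of_forall key) ((by fun_prop : Continuous fun v : ℝ =>
      3840 * Real.exp (x / 2 + 1 / 2) * x ^ s * Real.exp (v / 2)).intervalIntegrable _ _)
  rw [intervalIntegral.integral_const_mul, intervalIntegral.integral_comp_div _ two_ne_zero,
    integral_exp, smul_eq_mul] at h
  rw [midExp, abs_mul, abs_of_pos (Real.exp_pos _)]
  have he : Real.exp (1 / 2) ≤ 2 := by
    have h1 : Real.exp (1 / 2) ^ 2 = Real.exp 1 := by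
      rw [← Real.exp_nat_mul]; congr 1; norm_num
    have := Real.exp_one_lt_d9
    nlinarith [Real.exp_pos (1 / 2)]
  have hx2 : Real.exp (-x) * Real.exp (x / 2) * Real.exp (x / 2) = 1 := by
    rw [← Real.exp_add, ← Real.exp_add, ← Real.exp_zero]; congr 1; ring
  have hxs : 0 < x ^ s := by positivity
  calc _ ≤ Real.exp (-x) * (3840 * Real.exp (x / 2 + 1 / 2) * x ^ s *
        (2 * (Real.exp (x / 2) - Real.exp (1 / 2)))) :=
        mul_le_mul_of_nonneg_left h (Real.exp_pos _).le
    _ ≤ Real.exp (-x) * (3840 * Real.exp (x / 2 + 1 / 2) * x ^ s *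
        (2 * Real.exp (x / 2))) := by
        gcongr; linarith [Real.exp_pos (1 / 2)]
    _ = 7680 * x ^ s * Real.exp (1 / 2) *
        (Real.exp (-x) * Real.exp (x / 2) * Real.exp (x / 2)) := by rw [Real.exp_add]; ring
    _ ≤ _ := by rw [hx2]; nlinarith

theorem exp_neg_le_rpow {α x : ℝ} (hx : 1 ≤ x) (h0 : 0 < α) :
    Real.exp (-x) ≤ 120 * x ^ (α - 5) := by
  have hx0 : 0 < x := by linarith
  have := Real.pow_div_factorial_le_exp x hx0.le 5
  simp only [Nat.factorial] at this
  norm_num at this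
  rw [Real.exp_neg, inv_le_comm₀ (Real.exp_pos _) (by positivity), mul_inv,
    ← Real.rpow_neg hx0.le]
  refine le_trans ?_ this
  have h2 : x ^ (-(α - 5)) ≤ x ^ 5 := by
    rw [← Real.rpow_natCast]
    exact Real.rpow_le_rpow_of_exponent_le hx (by push_cast; linarith)
  linarith

/-- The integral is cut at 1, because the powers reached by repeated integration by parts are not
integrable at 0. The piece over [0,1] and the boundary terms at 1 carry e^{-x}, which is below every
power. -/
theorem abs_headExp_sub_le {α x : ℝ} (hx : 1 ≤ x) (h0 : 0 < α) (h2 : α ≤ 2) :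
    |headExp α x - (x ^ (α - 1) - (α - 1) * x ^ (α - 2) + (α - 1) * (α - 2) * x ^ (α - 3) -
      (α - 1) * (α - 2) * (α - 3) * x ^ (α - 4))| ≤ (400000 + 400 / α) * x ^ (α - 5) := by
  have hx0 : 0 < x := by linarith
  set A := ∫ v in (0 : ℝ)..1, Real.exp v * v ^ (α - 1) with hA
  have hsplit : headExp α x = Real.exp (-x) * A + midExp (α - 1) x := by
    rw [headExp, midExp, ← mul_add, hA, intervalIntegral.integral_add_adjacent_intervals
      (intervalIntegrable_exp_mul_rpow (by linarith) _ _)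
      (intervalIntegrable_exp_mul_rpow (by linarith) _ _)]
  have hAle : |A| ≤ 3 / α := by
    have h := intervalIntegral.norm_integral_le_of_norm_le (μ := volume) zero_le_one
      (f := fun v : ℝ => Real.exp v * v ^ (α - 1)) (g := fun v : ℝ => 3 * v ^ (α - 1))
      (Eventually.of_forall fun v hv => by
        have hv0 : 0 < v := hv.1
        rw [Real.norm_of_nonneg (by positivity)]
        have : Real.exp v ≤ 3 := (Real.exp_le_exp.2 hv.2).trans (by
          have := Real.exp_one_lt_d9; linarith)
        gcongr)
      ((intervalIntegral.intervalIntegrable_rpow' (by linarith)).const_mul 3)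
    rw [intervalIntegral.integral_const_mul, integral_rpow (Or.inl (by linarith)),
      Real.one_rpow, sub_add_cancel, Real.zero_rpow h0.ne'] at h
    exact h.trans (le_of_eq (by ring))
  have e : headExp α x - (x ^ (α - 1) - (α - 1) * x ^ (α - 2) + (α - 1) * (α - 2) * x ^ (α - 3) -
      (α - 1) * (α - 2) * (α - 3) * x ^ (α - 4)) = Real.exp (-x) * A +
      (-1 + (α - 1) - (α - 1) * (α - 2) + (α - 1) * (α - 2) * (α - 3)) *
        (Real.exp 1 * Real.exp (-x)) +
      (α - 1) * (α - 2) * (α - 3) * (α - 4) * midExp (α - 5) x := by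
    have r1 := midExp_recurrence hx (α - 1)
    have r2 := midExp_recurrence hx (α - 2)
    have r3 := midExp_recurrence hx (α - 3)
    have r4 := midExp_recurrence hx (α - 4)
    rw [show α - 1 - 1 = α - 2 by ring] at r1
    rw [show α - 2 - 1 = α - 3 by ring] at r2
    rw [show α - 3 - 1 = α - 4 by ring] at r3
    rw [show α - 4 - 1 = α - 5 by ring] at r4
    rw [hsplit, r1, r2, r3, r4, sub_eq_add_neg 1 x, Real.exp_add]; ring
  have hm := abs_midExp_le (s := α - 5) hx (by linarith) (by linarith)
  have hE := exp_neg_le_rpow hx h0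
  have he : Real.exp 1 ≤ 3 := by have := Real.exp_one_lt_d9; linarith
  have b1 : |α - 1| ≤ 1 := abs_le.2 ⟨by linarith, by linarith⟩
  have b2 : |α - 2| ≤ 2 := abs_le.2 ⟨by linarith, by linarith⟩
  have b3 : |α - 3| ≤ 3 := abs_le.2 ⟨by linarith, by linarith⟩
  have b4 : |α - 4| ≤ 4 := abs_le.2 ⟨by linarith, by linarith⟩
  have c1 : |(α - 1) * (α - 2) * (α - 3) * (α - 4)| ≤ 24 := by
    rw [abs_mul, abs_mul, abs_mul]
    calc _ ≤ (1 : ℝ) * 2 * 3 * 4 := by gcongr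
      _ = _ := by norm_num
  have c2 : |-1 + (α - 1) - (α - 1) * (α - 2) + (α - 1) * (α - 2) * (α - 3)| ≤ 10 := by
    have t1 : |(α - 1) * (α - 2)| ≤ 1 * 2 := by rw [abs_mul]; gcongr
    have t2 : |(α - 1) * (α - 2) * (α - 3)| ≤ 1 * 2 * 3 := by rw [abs_mul, abs_mul]; gcongr
    rw [abs_le] at *
    constructor <;> linarith
  rw [e]
  set R := x ^ (α - 5) with hR
  have hR0 : 0 < R := by positivity
  calc _ ≤ |Real.exp (-x) * A| + |(-1 + (α - 1) - (α - 1) * (α - 2) +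
        (α - 1) * (α - 2) * (α - 3)) * (Real.exp 1 * Real.exp (-x))| +
        |(α - 1) * (α - 2) * (α - 3) * (α - 4) * midExp (α - 5) x| := abs_add_three _ _ _
    _ ≤ 120 * R * (3 / α) + 10 * (3 * (120 * R)) + 24 * (15360 * R) := by
        rw [abs_mul, abs_mul, abs_mul _ (midExp _ _), abs_of_pos (Real.exp_pos (-x)),
          abs_of_pos (mul_pos (Real.exp_pos 1) (Real.exp_pos (-x)))]
        gcongr
    _ ≤ _ := by
        have : 0 < 1 / α := by positivity
        have h3 : 3 / α = 3 * (1 / α) := by ring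
        have h4 : 400 / α = 400 * (1 / α) := by ring
        rw [h3, h4]
        nlinarith [mul_pos hR0 this]

/-- The error constant in the large time expansion of the covariance. -/
noncomputable def covErr (α : ℝ) : ℝ := 400024 + 400 / α + 120 * specCov α 0

/-- The series of the head alternates in sign relative to that of the tail, so their difference
keeps every second power: the first is κ. In c' the sum keeps the other powers and the leading one
is removed by -αx^{α-1}, leaving κ'. -/
theorem abs_specCov_sub_le {α x : ℝ} (h0 : 0 < α) (h2 : α < 2) (hx : 1 ≤ x) :
    |specCov α x - (noiseCov α x + α / 2 * (α - 1) * (α - 2) * (α - 3) * x ^ (α - 4))| ≤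
      covErr α * x ^ (α - 5) := by
  have hx0 : 0 < x := by linarith
  have hp := abs_tailExp_sub_le hx h0 h2.le
  have he := abs_headExp_sub_le hx h0 h2.le
  have hE := exp_neg_le_rpow hx h0
  have hc0 := specCov_zero_nonneg h0 h2
  rw [specCov_eq' h0 h2 hx0, noiseCov]
  set p := tailExp α x - (x ^ (α - 1) + (α - 1) * x ^ (α - 2) + (α - 1) * (α - 2) * x ^ (α - 3) +
      (α - 1) * (α - 2) * (α - 3) * x ^ (α - 4)) with hpd
  set q := headExp α x - (x ^ (α - 1) - (α - 1) * x ^ (α - 2) + (α - 1) * (α - 2) * x ^ (α - 3) -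
      (α - 1) * (α - 2) * (α - 3) * x ^ (α - 4)) with hqd
  have e : (α / 2 * (tailExp α x - headExp α x) + specCov α 0 * Real.exp (-x)) / 2 -
      (α / 2 * (α - 1) * x ^ (α - 2) + α / 2 * (α - 1) * (α - 2) * (α - 3) * x ^ (α - 4)) =
      α / 4 * (p - q) + specCov α 0 * Real.exp (-x) / 2 := by rw [hpd, hqd]; ring
  rw [e]
  have hR : 0 < x ^ (α - 5) := by positivity
  have h1 : |p - q| ≤ (400024 + 400 / α) * x ^ (α - 5) :=
    (abs_sub _ _).trans (by linarith)
  have h3 : |α / 4 * (p - q)| ≤ 1 * ((400024 + 400 / α) * x ^ (α - 5)) := by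
    rw [abs_mul, abs_of_pos (by linarith : 0 < α / 4)]
    gcongr; linarith
  have h4 : |specCov α 0 * Real.exp (-x) / 2| ≤ specCov α 0 * (120 * x ^ (α - 5)) := by
    rw [abs_of_nonneg (by positivity)]
    have := mul_le_mul_of_nonneg_left hE hc0
    have := mul_nonneg hc0 (Real.exp_pos (-x)).le
    linarith
  refine (abs_add_le _ _).trans ?_
  rw [covErr]; linarith

theorem abs_covDeriv_sub_le {α x : ℝ} (h0 : 0 < α) (h2 : α < 2) (hx : 1 ≤ x) :
    |covDeriv α x - α / 2 * (α - 1) * (α - 2) * x ^ (α - 3)| ≤ covErr α * x ^ (α - 5) := by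
  have hx0 : 0 < x := by linarith
  have hp := abs_tailExp_sub_le hx h0 h2.le
  have he := abs_headExp_sub_le hx h0 h2.le
  have hE := exp_neg_le_rpow hx h0
  have hc0 := specCov_zero_nonneg h0 h2
  rw [covDeriv]
  set p := tailExp α x - (x ^ (α - 1) + (α - 1) * x ^ (α - 2) + (α - 1) * (α - 2) * x ^ (α - 3) +
      (α - 1) * (α - 2) * (α - 3) * x ^ (α - 4)) with hpd
  set q := headExp α x - (x ^ (α - 1) - (α - 1) * x ^ (α - 2) + (α - 1) * (α - 2) * x ^ (α - 3) -
      (α - 1) * (α - 2) * (α - 3) * x ^ (α - 4)) with hqd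
  have e : (α / 2 * (tailExp α x + headExp α x) - α * x ^ (α - 1) -
      specCov α 0 * Real.exp (-x)) / 2 - α / 2 * (α - 1) * (α - 2) * x ^ (α - 3) =
      α / 4 * (p + q) - specCov α 0 * Real.exp (-x) / 2 := by rw [hpd, hqd]; ring
  rw [e]
  have hR : 0 < x ^ (α - 5) := by positivity
  have h1 : |p + q| ≤ (400024 + 400 / α) * x ^ (α - 5) :=
    (abs_add_le _ _).trans (by linarith)
  have h3 : |α / 4 * (p + q)| ≤ 1 * ((400024 + 400 / α) * x ^ (α - 5)) := by
    rw [abs_mul, abs_of_pos (by linarith : 0 < α / 4)]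
    gcongr; linarith
  have h4 : |specCov α 0 * Real.exp (-x) / 2| ≤ specCov α 0 * (120 * x ^ (α - 5)) := by
    rw [abs_of_nonneg (by positivity)]
    have := mul_le_mul_of_nonneg_left hE hc0
    have := mul_nonneg hc0 (Real.exp_pos (-x)).le
    linarith
  refine (abs_sub _ _).trans ?_
  rw [covErr]; linarith

/-! ### Expansion of the main part for large time. -/

theorem isBigO_exp_neg_rpow (s : ℝ) :
    (fun x : ℝ => Real.exp (-x)) =O[atTop] fun x => x ^ s := by
  simpa using (isLittleO_exp_neg_mul_rpow_atTop one_pos s).isBigO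

theorem noiseGamma_eq {α x : ℝ} (h0 : 0 < α) (hx : 0 < x) :
    noiseGamma α x = α / 2 * (α - 1) *
      (Real.Gamma (α + 1) - Real.exp (-x) * tailExp (α + 1) x) := by
  rw [tailExp_eq (by linarith) hx.le, noiseGamma, intervalIntegral.integral_const_mul,
    ← mul_assoc (Real.exp (-x)), ← Real.exp_add, neg_add_cancel, Real.exp_zero,
    add_sub_cancel_right]
  ring

theorem isBigO_exp_neg_mul_tailExp {α : ℝ} (h2 : α < 2) (h0 : 0 < α) :
    (fun x => Real.exp (-x) * tailExp (α + 1) x) =O[atTop] fun x => x ^ (2 * α - 5) := by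
  have h : tailExp (α + 1) =O[atTop] fun x : ℝ => x ^ (2 : ℝ) := IsBigO.of_bound 5 (by
    filter_upwards [eventually_ge_atTop 1] with x hx
    have hx0 : 0 < x := by linarith
    rw [Real.norm_of_nonneg (Real.rpow_nonneg hx0.le 2), Real.norm_eq_abs,
      tailExp_recurrence hx, add_sub_cancel_right]
    have h1 := abs_tailExp_le h2 hx
    have h3 : x ^ α ≤ x ^ (2 : ℝ) := Real.rpow_le_rpow_of_exponent_le hx h2.le
    have h5 : x ≤ x ^ (2 : ℝ) := by rw [Real.rpow_two]; nlinarith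
    calc _ ≤ |x ^ α| + |α * tailExp α x| := abs_add_le _ _
      _ ≤ x ^ (2 : ℝ) + 2 * (x + 1) := by
        rw [abs_of_pos (by positivity), abs_mul, abs_of_pos h0]; gcongr
      _ ≤ _ := by rw [Real.rpow_two] at *; nlinarith)
  refine ((isBigO_exp_neg_rpow (2 * α - 7)).mul h).congr' EventuallyEq.rfl ?_
  filter_upwards [eventually_gt_atTop 0] with x hx
  rw [← Real.rpow_add hx]; congr 1; ring

/-- The large time expansion of `normSqFT` in terms of `covSqInt`. -/
theorem normSqMain_expansion {α : ℝ} (h0 : 0 < α) (h2 : α < 2) :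
    (fun T => normSqMain α T - (8 * T * covSqInt α T - 4 * (2 * α - 1) * covSqInt α T -
      4 * specCov α 0 * (α / 2 * (α - 1) * Real.Gamma (α + 1)) +
      2 * (1 - α) ^ 2 * specCov α 0 ^ 2 - 4 * ((α / 2) ^ 2 * (α - 1) * T ^ (2 * α - 2)) +
      4 * (α / 2 * (α - 1)) ^ 2 * T ^ (2 * α - 3) +
      (α / 2 * (α - 1)) ^ 2 * (26 - 8 * α) * T ^ (2 * α - 4))) =O[atTop]
      fun T => T ^ (2 * α - 5) := by
  set k := α / 2 * (α - 1) with hk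
  set c0 := specCov α 0 with hc0
  -- Remainders are normalised to bounded functions: c = κ + A T^{α-4}, c' = κ' + D T^{α-5}, e^{-T}
  -- = X T^{α-5} and R = 1/T. The claim becomes a polynomial identity plus boundedness of one
  -- polynomial.
  set A : ℝ → ℝ := fun T => (specCov α T - noiseCov α T) / T ^ (α - 4) with hA
  set D : ℝ → ℝ := fun T => (covDeriv α T - k * (α - 2) * T ^ (α - 3)) / T ^ (α - 5) with hD
  set R : ℝ → ℝ := fun T => T⁻¹ with hR
  set X : ℝ → ℝ := fun T => Real.exp (-T) / T ^ (α - 5) with hX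
  have hkO : ∀ k : ℝ, (fun _ : ℝ => k) =O[atTop] fun _ => (1 : ℝ) :=
    fun k => isBigO_const_const k one_ne_zero _
  have mul1 : ∀ {f g : ℝ → ℝ}, f =O[atTop] (fun _ => (1 : ℝ)) → g =O[atTop] (fun _ => (1 : ℝ)) →
      (fun T => f T * g T) =O[atTop] fun _ => (1 : ℝ) := fun hf hg => by simpa using hf.mul hg
  have hRO : R =O[atTop] fun _ => (1 : ℝ) := tendsto_inv_atTop_zero.isBigO_one ℝ
  have hXO : X =O[atTop] fun _ => (1 : ℝ) := IsBigO.of_bound 120 (by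
    filter_upwards [eventually_ge_atTop 1] with x hx
    have hx0 : 0 < x := by linarith
    rw [hX, norm_one, mul_one, Real.norm_of_nonneg (by positivity), div_le_iff₀ (by positivity)]
    exact exp_neg_le_rpow hx h0)
  have hDO : D =O[atTop] fun _ => (1 : ℝ) := IsBigO.of_bound (covErr α) (by
    filter_upwards [eventually_ge_atTop 1] with x hx
    have hx0 : 0 < x := by linarith
    rw [hD, norm_one, mul_one, norm_div, Real.norm_of_nonneg (by positivity : 0 ≤ x ^ (α - 5)),
      div_le_iff₀ (by positivity)]
    exact abs_covDeriv_sub_le h0 h2 hx)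
  have hAO : A =O[atTop] fun _ => (1 : ℝ) := IsBigO.of_bound (covErr α + |k * (α - 2) * (α - 3)|) (by
    filter_upwards [eventually_ge_atTop 1] with x hx
    have hx0 : 0 < x := by linarith
    rw [hA, norm_one, mul_one, norm_div, Real.norm_of_nonneg (by positivity : 0 ≤ x ^ (α - 4)),
      div_le_iff₀ (by positivity)]
    have h := abs_specCov_sub_le h0 h2 hx
    have h3 : x ^ (α - 5) ≤ x ^ (α - 4) := Real.rpow_le_rpow_of_exponent_le hx (by linarith)
    have hE : 0 ≤ covErr α := by
      have := specCov_zero_nonneg h0 h2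
      unfold covErr; positivity
    have h4 : |k * (α - 2) * (α - 3) * x ^ (α - 4)| = |k * (α - 2) * (α - 3)| * x ^ (α - 4) := by
      rw [abs_mul _ (x ^ (α - 4)), abs_of_pos (by positivity : 0 < x ^ (α - 4))]
    have e : specCov α x - noiseCov α x = (specCov α x - (noiseCov α x +
      k * (α - 2) * (α - 3) * x ^ (α - 4))) + k * (α - 2) * (α - 3) * x ^ (α - 4) := by ring
    rw [e, add_mul, ← h4]
    exact (abs_add_le _ _).trans (add_le_add (h.trans (by gcongr)) le_rfl))
  -- This polynomial is the remainder divided by T^{2α-5}, apart from the incomplete gamma term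
  -- added below.
  have hP : (fun T => 8 * k * (α - 2) * (D T * R T) + 4 * (D T ^ 2 * R T ^ 3) -
      4 * (A T ^ 2 * R T) - 4 * α * (α - 1) * ((k * (α - 2) + D T * R T ^ 2) ^ 2 * R T) +
      (4 * α * (α - 1) + 2) * (2 * k * (A T * R T) + A T ^ 2 * R T ^ 3) -
      8 * α * k * (D T * R T) - 4 * (k * (D T * R T) + k * (α - 2) * (A T * R T) +
        A T * D T * R T ^ 3) + 4 * (α - 1) * ((k + A T * R T ^ 2) * (k * (α - 2) + D T * R T ^ 2)) +
      4 * k * A T + 4 * (α - 1) * (-(α / 2) * c0 * X T - α * c0 * (X T * (k * (α - 2) * R T ^ 3 +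
        D T * R T ^ 5 + α / 2 * R T + k * R T ^ 2 + A T * R T ^ 4)))) =O[atTop]
        fun _ => (1 : ℝ) := by
    have pw : ∀ {f : ℝ → ℝ} (n : ℕ), f =O[atTop] (fun _ => (1 : ℝ)) →
        (fun T => f T ^ n) =O[atTop] fun _ => (1 : ℝ) := fun n hf => by simpa using hf.pow n
    repeat' first
      | exact hRO | exact hAO | exact hDO | exact hXO | exact hkO _
      | refine IsBigO.add ?_ ?_ | refine IsBigO.sub ?_ ?_ | refine IsBigO.neg_left ?_ | refine pw _ ?_
      | refine mul1 ?_ ?_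
  have hmain := (isBigO_refl (fun T : ℝ => T ^ (2 * α - 5)) atTop).mul hP
  simp only [mul_one] at hmain
  refine (hmain.add ((isBigO_exp_neg_mul_tailExp h2 h0).const_mul_left (4 * c0 * k))).congr' ?_
    EventuallyEq.rfl
  filter_upwards [eventually_gt_atTop 0] with T hT
  set u := T ^ (α - 4) with hu
  have hu0 : 0 < u := by positivity
  have e5 : T ^ (α - 5) = u / T := by
    rw [hu, show α - 5 = α - 4 - 1 by ring, Real.rpow_sub_one hT.ne']
  have e3 : T ^ (α - 3) = T * u := by
    rw [hu, show α - 3 = 1 + (α - 4) by ring, Real.rpow_add hT, Real.rpow_one]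
  have e2 : T ^ (α - 2) = T ^ 2 * u := by
    rw [hu, ← Real.rpow_natCast, ← Real.rpow_add hT]; congr 1; push_cast; ring
  have e1 : T ^ (α - 1) = T ^ 3 * u := by
    rw [hu, ← Real.rpow_natCast, ← Real.rpow_add hT]; congr 1; push_cast; ring
  have eu : u ^ 2 = T ^ (2 * α - 8) := by
    rw [hu, ← Real.rpow_natCast, ← Real.rpow_mul hT.le]; congr 1; push_cast; ring
  have f5 : T ^ (2 * α - 5) = T ^ 3 * u ^ 2 := by
    rw [eu, ← Real.rpow_natCast, ← Real.rpow_add hT]; congr 1; push_cast; ring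
  have f4 : T ^ (2 * α - 4) = T ^ 4 * u ^ 2 := by
    rw [eu, ← Real.rpow_natCast, ← Real.rpow_add hT]; congr 1; push_cast; ring
  have f3 : T ^ (2 * α - 3) = T ^ 5 * u ^ 2 := by
    rw [eu, ← Real.rpow_natCast, ← Real.rpow_add hT]; congr 1; push_cast; ring
  have f2 : T ^ (2 * α - 2) = T ^ 6 * u ^ 2 := by
    rw [eu, ← Real.rpow_natCast, ← Real.rpow_add hT]; congr 1; push_cast; ring
  have ec : specCov α T = u * (k * T ^ 2 + A T) := by
    simp only [hA, noiseCov, ← hu, e2]; field_simp; ring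
  have ed : covDeriv α T = u * (k * (α - 2) * T + D T * R T) := by
    simp only [hD, hR, e5, e3]; field_simp; ring
  have eE : Real.exp (-T) = X T * (u * R T) := by
    simp only [hX, hR, e5]; field_simp
  have ep : α / 2 * tailExp α T = specCov α T + covDeriv α T + α / 2 * (T ^ 3 * u) := by
    rw [covDeriv, specCov_eq' h0 h2 hT, e1]; ring
  have eh : α / 2 * headExp α T = covDeriv α T - specCov α T + α / 2 * (T ^ 3 * u) +
      c0 * Real.exp (-T) := by
    rw [covDeriv, specCov_eq' h0 h2 hT, e1]; ring
  have em : momentPrim α T = T ^ 2 * (specCov α T ^ 2 - covDeriv α T ^ 2) / 2 +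
      c0 / 2 * noiseGamma α T - (α - 1) / 2 * (α / 2 * (T * (T ^ 3 * u)) *
        (α / 2 * tailExp α T - α / 2 * headExp α T) -
        α * ((α / 2 * tailExp α T) * (α / 2 * headExp α T))) := by
    rw [momentPrim, e1]; ring
  rw [normSqMain, em, ep, eh, noiseGamma_eq h0 hT, noiseCov, ← hc0, ← hk, e2, f5, f4, f3, f2,
    ec, ed]
  generalize Real.exp (-T) * tailExp (α + 1) T = G
  rw [eE]
  simp only [hR]
  generalize A T = a
  generalize D T = d
  generalize X T = x
  rw [hk]
  field_simp
  ring

/-! ### Asymptotics of the integral of the squared covariance. -/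

/-- A function on `[1, ∞)` whose derivative is dominated by a power `x ^ (s - 1)` with `s < 0` has
a limit at infinity, which it approaches at rate `x ^ s`. -/
theorem exists_limit_of_abs_deriv_le {F f : ℝ → ℝ} {M s : ℝ} (hM : 0 ≤ M) (hs : s < 0)
    (hF : ∀ x, 1 ≤ x → HasDerivAt F (f x) x) (hf : ∀ x, 1 ≤ x → |f x| ≤ M * x ^ (s - 1)) :
    ∃ L, Tendsto F atTop (𝓝 L) ∧ ∀ x, 1 ≤ x → |F x - L| ≤ M / (-s) * x ^ s := by
  have hpow : ∀ x : ℝ, 1 ≤ x → HasDerivAt (fun x : ℝ => M / s * x ^ s) (M * x ^ (s - 1)) x := by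
    intro x hx
    have := (Real.hasDerivAt_rpow_const (p := s) (Or.inl (by linarith : x ≠ 0))).const_mul (M / s)
    refine this.congr_deriv ?_
    field_simp [hs.ne]
  have mono : ∀ G g : ℝ → ℝ, (∀ x, 1 ≤ x → HasDerivAt G (g x) x) → (∀ x, 1 ≤ x → 0 ≤ g x) →
      ∀ a b, 1 ≤ a → a ≤ b → G a ≤ G b := by
    intro G g hG hg a b ha hab
    have h1 : MonotoneOn G (Ici 1) := by
      refine monotoneOn_of_deriv_nonneg (convex_Ici 1)
        (fun x hx => (hG x hx).continuousAt.continuousWithinAt) (fun x hx => ?_) fun x hx => ?_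
      · rw [interior_Ici] at hx
        exact (hG x (le_of_lt hx)).differentiableAt.differentiableWithinAt
      · rw [interior_Ici] at hx
        rw [(hG x (le_of_lt hx)).deriv]
        exact hg x (le_of_lt hx)
    exact h1 ha (ha.trans hab : (1 : ℝ) ≤ b) hab
  -- Both (M/s)x^s + F and (M/s)x^s - F are nondecreasing, so no integrability of f has to be
  -- assumed.
  have hle : ∀ a b, 1 ≤ a → a ≤ b → |F b - F a| ≤ M / (-s) * (a ^ s - b ^ s) := by
    intro a b ha hab
    have h1 := mono _ _ (fun x hx => (hF x hx).add (hpow x hx)) (fun x hx => by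
      have := (abs_le.1 (hf x hx)).1; linarith) a b ha hab
    have h2 := mono _ _ (fun x hx => (hpow x hx).sub (hF x hx)) (fun x hx => by
      have := (abs_le.1 (hf x hx)).2; linarith) a b ha hab
    simp only [Pi.add_apply, Pi.sub_apply] at h1 h2
    rw [abs_le, div_neg]
    constructor <;> linarith
  have hpos : ∀ b : ℝ, 1 ≤ b → 0 ≤ M / (-s) * b ^ s := fun b hb =>
    mul_nonneg (div_nonneg hM (by linarith)) (Real.rpow_nonneg (by linarith) _)
  have hle' : ∀ a b, 1 ≤ a → a ≤ b → |F b - F a| ≤ M / (-s) * a ^ s := by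
    intro a b ha hab
    have h1 := hle a b ha hab
    have h2 := hpos b (ha.trans hab)
    linarith
  have ht : Tendsto (fun x : ℝ => M / (-s) * x ^ s) atTop (𝓝 0) := by
    have := (tendsto_rpow_neg_atTop (y := -s) (by linarith)).const_mul (M / (-s))
    simpa using this
  have hcau : CauchySeq F := by
    rw [Metric.cauchySeq_iff']
    intro ε hε
    obtain ⟨N, hN1, hN⟩ := ((eventually_ge_atTop 1).and (ht.eventually_lt_const hε)).exists
    refine ⟨N, fun n hn => ?_⟩
    exact (hle' N n hN1 hn).trans_lt hN
  obtain ⟨L, hL⟩ := cauchySeq_tendsto_of_complete hcau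
  refine ⟨L, hL, fun x hx => ?_⟩
  rw [abs_sub_comm]
  refine le_of_tendsto (hL.sub_const (F x)).abs ?_
  filter_upwards [eventually_ge_atTop x] with b hb
  exact hle' x b hx hb

/-- The error constant for the squared covariance. -/
noncomputable def covSqErr (α : ℝ) : ℝ :=
  (covErr α + |α / 2 * (α - 1) * (α - 2) * (α - 3)|) *
    (2 * |α / 2 * (α - 1)| + (covErr α + |α / 2 * (α - 1) * (α - 2) * (α - 3)|))

theorem covErr_nonneg {α : ℝ} (h0 : 0 < α) (h2 : α < 2) : 0 ≤ covErr α := by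
  have := specCov_zero_nonneg h0 h2
  unfold covErr; positivity

theorem abs_specCov_sub_noiseCov_le {α x : ℝ} (h0 : 0 < α) (h2 : α < 2) (hx : 1 ≤ x) :
    |specCov α x - noiseCov α x| ≤
      (covErr α + |α / 2 * (α - 1) * (α - 2) * (α - 3)|) * x ^ (α - 4) := by
  have hx0 : 0 < x := by linarith
  have h := abs_specCov_sub_le h0 h2 hx
  have h3 : x ^ (α - 5) ≤ x ^ (α - 4) := Real.rpow_le_rpow_of_exponent_le hx (by linarith)
  have hE := covErr_nonneg h0 h2
  have h4 : |α / 2 * (α - 1) * (α - 2) * (α - 3) * x ^ (α - 4)| =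
      |α / 2 * (α - 1) * (α - 2) * (α - 3)| * x ^ (α - 4) := by
    rw [abs_mul _ (x ^ (α - 4)), abs_of_pos (by positivity : 0 < x ^ (α - 4))]
  have e : specCov α x - noiseCov α x = (specCov α x - (noiseCov α x +
    α / 2 * (α - 1) * (α - 2) * (α - 3) * x ^ (α - 4))) +
      α / 2 * (α - 1) * (α - 2) * (α - 3) * x ^ (α - 4) := by ring
  rw [e, add_mul, ← h4]
  exact (abs_add_le _ _).trans (add_le_add (h.trans (by gcongr)) le_rfl)

theorem abs_specCov_sq_sub_le {α x : ℝ} (h0 : 0 < α) (h2 : α < 2) (hx : 1 ≤ x) :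
    |specCov α x ^ 2 - (α / 2 * (α - 1)) ^ 2 * x ^ (2 * α - 4)| ≤
      covSqErr α * x ^ (2 * α - 6) := by
  have hx0 : 0 < x := by linarith
  have h := abs_specCov_sub_noiseCov_le h0 h2 hx
  set M := covErr α + |α / 2 * (α - 1) * (α - 2) * (α - 3)| with hM
  have hM0 : 0 ≤ M := by have := covErr_nonneg h0 h2; positivity
  have h3 : x ^ (α - 4) ≤ x ^ (α - 2) := Real.rpow_le_rpow_of_exponent_le hx (by linarith)
  have h4 : |specCov α x + noiseCov α x| ≤ (2 * |α / 2 * (α - 1)| + M) * x ^ (α - 2) := by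
    have e : specCov α x + noiseCov α x = (specCov α x - noiseCov α x) + 2 * noiseCov α x := by
      ring
    rw [e]
    refine (abs_add_le _ _).trans ?_
    have h5 : |2 * noiseCov α x| = 2 * |α / 2 * (α - 1)| * x ^ (α - 2) := by
      rw [noiseCov, abs_mul, abs_mul _ (x ^ (α - 2)), abs_of_pos (by positivity : 0 < x ^ (α - 2)),
        abs_of_pos (two_pos : (0 : ℝ) < 2)]
      ring
    rw [h5]
    have := mul_le_mul_of_nonneg_left h3 hM0
    linarith
  have e1 : (α / 2 * (α - 1)) ^ 2 * x ^ (2 * α - 4) = noiseCov α x ^ 2 := by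
    rw [noiseCov, mul_pow _ (x ^ (α - 2)), ← Real.rpow_natCast (x ^ (α - 2)),
      ← Real.rpow_mul hx0.le]
    congr 2; push_cast; ring
  have e2 : x ^ (2 * α - 6) = x ^ (α - 4) * x ^ (α - 2) := by
    rw [← Real.rpow_add hx0]; congr 1; ring
  rw [e1, e2, sq_sub_sq, abs_mul, covSqErr, mul_comm]
  calc _ ≤ M * x ^ (α - 4) * ((2 * |α / 2 * (α - 1)| + M) * x ^ (α - 2)) := by gcongr
    _ = _ := by ring

theorem covSqErr_nonneg {α : ℝ} (h0 : 0 < α) (h2 : α < 2) : 0 ≤ covSqErr α := by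
  have := covErr_nonneg h0 h2
  unfold covSqErr; positivity

theorem exists_covSqInt_limit {α : ℝ} (h0 : 0 < α) (h2 : α < 2) (h : α ≠ 3 / 2) :
    ∃ L, Tendsto (fun x => covSqInt α x - (α / 2 * (α - 1)) ^ 2 / (2 * α - 3) * x ^ (2 * α - 3))
        atTop (𝓝 L) ∧
      ∀ x, 1 ≤ x → |covSqInt α x - (α / 2 * (α - 1)) ^ 2 / (2 * α - 3) * x ^ (2 * α - 3) - L| ≤
        covSqErr α / (5 - 2 * α) * x ^ (2 * α - 5) := by
  have h3 : 2 * α - 3 ≠ 0 := fun h' => h (by linarith)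
  obtain ⟨L, h1, h2'⟩ := exists_limit_of_abs_deriv_le (M := covSqErr α) (s := 2 * α - 5)
    (F := fun x => covSqInt α x - (α / 2 * (α - 1)) ^ 2 / (2 * α - 3) * x ^ (2 * α - 3))
    (f := fun x => specCov α x ^ 2 - (α / 2 * (α - 1)) ^ 2 * x ^ (2 * α - 4))
    (covSqErr_nonneg h0 h2) (by linarith) (fun x hx => by
      have := (hasDerivAt_covSqInt h0 h2 x).sub ((Real.hasDerivAt_rpow_const (p := 2 * α - 3)
        (Or.inl (by linarith : x ≠ 0))).const_mul ((α / 2 * (α - 1)) ^ 2 / (2 * α - 3)))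
      refine this.congr_deriv ?_
      rw [show 2 * α - 3 - 1 = 2 * α - 4 by ring, ← mul_assoc, div_mul_cancel₀ _ h3]) (fun x hx => by
      rw [show 2 * α - 5 - 1 = 2 * α - 6 by ring]
      exact abs_specCov_sq_sub_le h0 h2 hx)
  refine ⟨L, h1, fun x hx => ?_⟩
  have := h2' x hx
  rwa [neg_sub] at this

/-- At α = 3/2 the final error O(T^{-2}) requires `covSqInt` up to O(T^{-3}), since it is multiplied
by T. Hence one more term than in the generic case: c² = (9/64)x^{-1} + (27/128)x^{-3} + O(x^{-4}).
-/
theorem exists_covSqInt_limit_three_halves :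
    ∃ L M, Tendsto (fun x => covSqInt (3 / 2) x - 9 / 64 * Real.log x) atTop (𝓝 L) ∧
      ∀ x, 1 ≤ x → |covSqInt (3 / 2) x - 9 / 64 * Real.log x + 27 / 256 * x ^ (-2 : ℝ) - L| ≤
        M * x ^ (-3 : ℝ) := by
  have h0 : (0 : ℝ) < 3 / 2 := by norm_num
  have h2 : (3 / 2 : ℝ) < 2 := by norm_num
  set K := covErr (3 / 2) with hK
  have hK0 : 0 ≤ K := covErr_nonneg h0 h2
  have hb : ∀ x, 1 ≤ x → |specCov (3 / 2) x ^ 2 - 9 / 64 * x⁻¹ - 27 / 128 * x ^ (-3 : ℝ)| ≤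
      (1 + K) ^ 2 * x ^ ((-3 : ℝ) - 1) := by
    intro x hx
    have hx0 : 0 < x := by linarith
    have h := abs_specCov_sub_le h0 h2 hx
    rw [noiseCov, ← hK] at h
    set u := x ^ (-(1 / 2) : ℝ) with hu
    have hu0 : 0 < u := by positivity
    set y := x⁻¹ with hy
    have hy0 : 0 < y := by positivity
    have hy1 : y ≤ 1 := inv_le_one_of_one_le₀ hx
    have eu : u ^ 2 = y := by
      rw [hu, ← Real.rpow_natCast, ← Real.rpow_mul hx0.le, hy, ← Real.rpow_neg_one]
      congr 1; norm_num
    have hyn : ∀ n : ℕ, x ^ (-(n : ℝ)) = y ^ n := fun n => by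
      rw [Real.rpow_neg hx0.le, Real.rpow_natCast, hy, inv_pow]
    have hun : ∀ n : ℕ, x ^ (-(1 / 2) - (n : ℝ)) = u * y ^ n := fun n => by
      rw [sub_eq_add_neg, Real.rpow_add hx0, hyn]
    rw [show (3 / 2 : ℝ) - 2 = -(1 / 2) by norm_num,
      show (3 / 2 : ℝ) - 4 = -(1 / 2) - (2 : ℕ) by norm_num,
      show (3 / 2 : ℝ) - 5 = -(1 / 2) - (3 : ℕ) by norm_num, hun, hun, ← hu] at h
    rw [show (-3 : ℝ) - 1 = -((4 : ℕ) : ℝ) by norm_num, show (-3 : ℝ) = -((3 : ℕ) : ℝ) by norm_num,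
      hyn, hyn]
    set ρ := (specCov (3 / 2) x - (3 / 2 / 2 * (3 / 2 - 1) * u +
      3 / 2 / 2 * (3 / 2 - 1) * -(1 / 2) * (3 / 2 - 3) * (u * y ^ 2))) / (u * y ^ 3) with hρ
    have hρK : |ρ| ≤ K := by
      rw [hρ, abs_div, abs_of_pos (by positivity : 0 < u * y ^ 3), div_le_iff₀ (by positivity)]
      exact h
    have ec : specCov (3 / 2) x = u * (3 / 8 + 9 / 32 * y ^ 2 + ρ * y ^ 3) := by
      rw [hρ]; field_simp; ring
    have e : specCov (3 / 2) x ^ 2 - 9 / 64 * y - 27 / 128 * y ^ 3 =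
        y ^ 4 * (81 / 1024 * y + 2 * (3 / 8 + 9 / 32 * y ^ 2) * ρ + ρ ^ 2 * y ^ 3) := by
      rw [ec, mul_pow, eu]; ring
    rw [e, abs_mul, abs_of_pos (by positivity : 0 < y ^ 4), mul_comm]
    refine mul_le_mul_of_nonneg_right ?_ (by positivity)
    have hy2 : y ^ 2 ≤ 1 := pow_le_one₀ hy0.le hy1
    have hy3 : y ^ 3 ≤ 1 := pow_le_one₀ hy0.le hy1
    calc _ ≤ |81 / 1024 * y| + |2 * (3 / 8 + 9 / 32 * y ^ 2) * ρ| + |ρ ^ 2 * y ^ 3| :=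
          abs_add_three _ _ _
      _ = 81 / 1024 * y + 2 * (3 / 8 + 9 / 32 * y ^ 2) * |ρ| + |ρ| ^ 2 * y ^ 3 := by
          rw [abs_of_pos (by positivity), abs_mul _ ρ, abs_mul (ρ ^ 2), abs_pow ρ,
            abs_of_pos (by positivity : 0 < y ^ 3),
            abs_of_pos (by positivity : 0 < 2 * (3 / 8 + 9 / 32 * y ^ 2))]
      _ ≤ 1 * 1 + 2 * 1 * K + K ^ 2 * 1 := by gcongr <;> linarith
      _ = _ := by ring
  obtain ⟨L, h1, h2'⟩ := exists_limit_of_abs_deriv_le (M := (1 + K) ^ 2) (s := -3)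
    (F := fun x => covSqInt (3 / 2) x - 9 / 64 * Real.log x + 27 / 256 * x ^ (-2 : ℝ))
    (f := fun x => specCov (3 / 2) x ^ 2 - 9 / 64 * x⁻¹ - 27 / 128 * x ^ (-3 : ℝ))
    (by positivity) (by norm_num) (fun x hx => by
      have := ((hasDerivAt_covSqInt h0 h2 x).sub ((Real.hasDerivAt_log
        (by linarith : x ≠ 0)).const_mul (9 / 64))).add ((Real.hasDerivAt_rpow_const (p := -2)
        (Or.inl (by linarith : x ≠ 0))).const_mul (27 / 256))
      refine this.congr_deriv ?_
      rw [show (-2 : ℝ) - 1 = -3 by norm_num]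
      ring) hb
  refine ⟨L, (1 + K) ^ 2 / (-(-3)), ?_, h2'⟩
  have h3 := h1.sub ((tendsto_rpow_neg_atTop (y := 2) (by norm_num)).const_mul (27 / 256))
  simp only [mul_zero, sub_zero, add_sub_cancel_right] at h3
  exact h3

/-! ### The limiting constant from Plancherel's theorem. -/

/-- Plancherel's theorem for the cosine and sine transforms of a real function. -/
theorem integral_cos_sin_transform_sq {φ : ℝ → ℝ} (h1 : Integrable φ)
    (h2 : Integrable fun ξ => φ ξ ^ 2) :
    Integrable (fun τ => (∫ ξ, Real.cos (τ * ξ) * φ ξ) ^ 2 + (∫ ξ, Real.sin (τ * ξ) * φ ξ) ^ 2) ∧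
    ∫ τ, ((∫ ξ, Real.cos (τ * ξ) * φ ξ) ^ 2 + (∫ ξ, Real.sin (τ * ξ) * φ ξ) ^ 2) =
      2 * π * ∫ ξ, φ ξ ^ 2 := by
  have hπ : (0 : ℝ) < 2 * π := by positivity
  let f : ℝ → ℂ := fun ξ => φ ξ
  have hf1 : MemLp f 1 := memLp_one_iff_integrable.2 h1.ofReal
  have hf2 : MemLp f 2 := by
    rw [memLp_two_iff_integrable_sq_norm hf1.1]
    refine h2.congr (Eventually.of_forall fun ξ => ?_)
    simp [f]
  have hcos : ∀ τ, Integrable fun ξ => Real.cos (τ * ξ) * φ ξ := fun τ =>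
    h1.bdd_mul (c := 1) (by fun_prop)
      (Eventually.of_forall fun ξ => by simpa using Real.abs_cos_le_one (τ * ξ))
  have hsin : ∀ τ, Integrable fun ξ => Real.sin (τ * ξ) * φ ξ := fun τ =>
    h1.bdd_mul (c := 1) (by fun_prop)
      (Eventually.of_forall fun ξ => by simpa using Real.abs_sin_le_one (τ * ξ))
  have hF : ∀ τ, ‖FourierTransform.fourier f (τ / (2 * π))‖ ^ 2 =
      (∫ ξ, Real.cos (τ * ξ) * φ ξ) ^ 2 + (∫ ξ, Real.sin (τ * ξ) * φ ξ) ^ 2 := by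
    intro τ
    have e : FourierTransform.fourier f (τ / (2 * π)) =
        ((∫ ξ, Real.cos (τ * ξ) * φ ξ : ℝ) : ℂ) -
          ((∫ ξ, Real.sin (τ * ξ) * φ ξ : ℝ) : ℂ) * Complex.I := by
      rw [Real.fourier_real_eq_integral_exp_smul, ← integral_complex_ofReal,
        ← integral_complex_ofReal, ← integral_mul_const, ← integral_sub (hcos τ).ofReal
          ((hsin τ).ofReal.mul_const _)]
      congr 1; ext ξ
      have : (((-2 * π * ξ * (τ / (2 * π)) : ℝ) : ℂ) * Complex.I) =
          -((τ * ξ : ℝ) : ℂ) * Complex.I := by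
        have : -2 * π * ξ * (τ / (2 * π)) = -(τ * ξ) := by field_simp
        rw [this]; push_cast; ring
      rw [this, Complex.exp_mul_I, Complex.cos_neg, Complex.sin_neg]
      simp only [f, smul_eq_mul]
      push_cast
      ring
    rw [e, Complex.sq_norm, Complex.normSq_apply]
    simp
    ring
  obtain ⟨hm, hP⟩ := integral_norm_fourier_sq hf1 hf2
  have hint : Integrable fun w => ‖FourierTransform.fourier f w‖ ^ 2 :=
    (memLp_two_iff_integrable_sq_norm hm.1).1 hm
  simp_rw [← hF]
  refine ⟨hint.comp_div hπ.ne', ?_⟩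
  rw [Measure.integral_comp_div (fun w => ‖FourierTransform.fourier f w‖ ^ 2), hP,
    abs_of_pos hπ, smul_eq_mul]
  simp [f]

theorem integral_sin_mul_even {φ : ℝ → ℝ} (h : ∀ ξ, φ (-ξ) = φ ξ) (τ : ℝ) :
    ∫ ξ, Real.sin (τ * ξ) * φ ξ = 0 := by
  have := integral_neg_eq_self (fun ξ : ℝ => Real.sin (τ * ξ) * φ ξ) volume
  simp only [h, mul_neg, Real.sin_neg, neg_mul, integral_neg] at this
  linarith

theorem integral_cos_mul_odd {φ : ℝ → ℝ} (h : ∀ ξ, φ (-ξ) = -φ ξ) (τ : ℝ) :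
    ∫ ξ, Real.cos (τ * ξ) * φ ξ = 0 := by
  have := integral_neg_eq_self (fun ξ : ℝ => Real.cos (τ * ξ) * φ ξ) volume
  simp only [h, mul_neg, Real.cos_neg, integral_neg] at this
  linarith

/-- The integral of an even function over `[0, x]` tends to half its integral. -/
theorem tendsto_integral_even {f : ℝ → ℝ} (hf : Integrable f) (he : ∀ x, f (-x) = f x) :
    Tendsto (fun x => ∫ t in (0 : ℝ)..x, f t) atTop (𝓝 ((∫ t, f t) / 2)) := by
  have h1 := intervalIntegral_tendsto_integral_Ioi 0 hf.integrableOn tendsto_id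
  have h2 : ∫ t, f t = 2 * ∫ t in Ioi (0 : ℝ), f t := by
    rw [← integral_comp_abs]
    congr 1; ext t
    rcases abs_choice t with h | h <;> rw [h]
    rw [he]
  rw [h2, mul_div_cancel_left₀ _ two_ne_zero]
  exact h1

/-- The limit at infinity of `∫_0^T c²`, after subtraction of the diverging part. -/
noncomputable def covSqLimit (α : ℝ) : ℝ :=
  specCov α 0 ^ 2 * Real.sin (π * α / 2) ^ 2 / π *
    (Real.Gamma (3 / 2 - α) * Real.Gamma (1 / 2 + α))

theorem integrable_rpow_div_sq {b : ℝ} (h1 : -1 < b) (h3 : b < 3) :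
    Integrable (fun ξ : ℝ => |ξ| ^ b / (1 + ξ ^ 2) ^ 2) ∧
    ∫ ξ : ℝ, |ξ| ^ b / (1 + ξ ^ 2) ^ 2 =
      Real.Gamma ((b + 1) / 2) * Real.Gamma (2 - (b + 1) / 2) := by
  obtain ⟨hi, hv⟩ := integral_rpow_div_one_add_sq_pow (b := b) (n := 2) h1
    (by push_cast; linarith)
  have e : (fun ξ : ℝ => |ξ| ^ b / (1 + ξ ^ 2) ^ 2) =
      fun ξ : ℝ => (fun x : ℝ => x ^ b / (1 + x ^ 2) ^ 2) |ξ| := by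
    ext ξ; simp
  rw [e]
  refine ⟨integrable_comp_abs_of_integrableOn hi, ?_⟩
  rw [integral_comp_abs (f := fun x : ℝ => x ^ b / (1 + x ^ 2) ^ 2), hv, Nat.cast_ofNat,
    Real.Gamma_two]
  ring

/-- Below 3/2 the spectral density is square integrable, so Plancherel and the beta integral with n
= 2 evaluate ∫ c². -/
theorem tendsto_covSqInt_of_lt {α : ℝ} (h0 : 0 < α) (h : α < 3 / 2) :
    Tendsto (covSqInt α) atTop (𝓝 (covSqLimit α)) := by
  have h2 : α < 2 := by linarith
  have e : ∀ ξ : ℝ, specDensity α ξ ^ 2 = |ξ| ^ (2 - 2 * α) / (1 + ξ ^ 2) ^ 2 := by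
    intro ξ
    rw [specDensity, div_pow, ← Real.rpow_natCast, ← Real.rpow_mul (abs_nonneg ξ)]
    congr 2; push_cast; ring
  obtain ⟨hi, hv⟩ := integrable_rpow_div_sq (b := 2 - 2 * α) (by linarith) (by linarith)
  simp_rw [← e] at hi hv
  obtain ⟨hI, hV⟩ := integral_cos_sin_transform_sq (integrable_specDensity h0 h2)
    hi
  rw [hv] at hV
  simp only [integral_sin_mul_even (specDensity_neg α), ne_eq, OfNat.ofNat_ne_zero,
    not_false_eq_true, zero_pow, add_zero] at hI hV
  have hsq : (fun τ => specCov α τ ^ 2) = fun τ => (specConst α)⁻¹ ^ 2 *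
      (∫ ξ, Real.cos (τ * ξ) * specDensity α ξ) ^ 2 := by
    ext τ; rw [specCov, mul_pow]
  have ht := tendsto_integral_even (f := fun τ => specCov α τ ^ 2)
    (by rw [hsq]; exact hI.const_mul _) (fun τ => by rw [specCov_neg])
  have hval : ∫ τ, specCov α τ ^ 2 = (specConst α)⁻¹ ^ 2 *
      (2 * π * (Real.Gamma ((2 - 2 * α + 1) / 2) * Real.Gamma (2 - (2 - 2 * α + 1) / 2))) := by
    rw [hsq, integral_const_mul, hV]
  rw [hval, inv_specConst h0 h2] at ht
  have hlim : covSqLimit α = (specCov α 0 * Real.sin (π * α / 2) / π) ^ 2 * (2 * π *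
      (Real.Gamma ((2 - 2 * α + 1) / 2) * Real.Gamma (2 - (2 - 2 * α + 1) / 2))) / 2 := by
    rw [covSqLimit, show (2 - 2 * α + 1) / 2 = 3 / 2 - α by ring,
      show 2 - (3 / 2 - α) = 1 / 2 + α by ring]
    field_simp
  rw [hlim]
  exact ht

/-- The reflection formula gives Γ(3/2-α)Γ(1/2+α) = (1/2-α)π / cos πα, and sin²(πα/2) = (1 - cos
πα)/2. At α = 1/2 the gamma form is regular and is evaluated directly. -/
theorem covSqLimit_eq {α : ℝ} (h0 : 0 < α) (h2 : α < 2) (h : α ≠ 3 / 2) :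
    covSqLimit α = specCov α 0 ^ 2 * slopeFactor (α / 2) / 4 := by
  rw [covSqLimit, slopeFactor, show 2 * (α / 2) * π = π * α by ring]
  have hs : Real.sin (π * α / 2) ^ 2 = (1 - Real.cos (π * α)) / 2 := by
    have := Real.cos_sq (π * α / 2)
    rw [show 2 * (π * α / 2) = π * α by ring] at this
    have h3 := Real.sin_sq_add_cos_sq (π * α / 2)
    linarith
  rw [hs]
  split_ifs with h4
  · have : α = 1 / 2 := by linarith
    subst this
    rw [show π * (1 / 2) = π / 2 by ring, Real.cos_pi_div_two]
    norm_num
    field_simp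
    ring
  · have h5 : (1 : ℝ) / 2 - α ≠ 0 := fun h' => h4 (by linarith)
    have hr := Real.Gamma_mul_Gamma_one_sub (1 / 2 + α)
    rw [show 1 - (1 / 2 + α) = 1 / 2 - α by ring,
      show π * (1 / 2 + α) = π * α + π / 2 by ring, Real.sin_add_pi_div_two] at hr
    have hg : Real.Gamma (3 / 2 - α) = (1 / 2 - α) * Real.Gamma (1 / 2 - α) := by
      rw [← Real.Gamma_add_one h5]; congr 1; ring
    have hc : Real.cos (π * α) ≠ 0 := by
      rw [Real.cos_ne_zero_iff]
      intro k hk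
      have hk' : α = (2 * k + 1) / 2 := by
        have := Real.pi_ne_zero
        field_simp at hk ⊢
        linarith
      have k1 : (-1 : ℝ) < k := by linarith
      have k2 : (k : ℝ) < 2 := by linarith
      have k1' : (-1 : ℤ) < k := by exact_mod_cast k1
      have k2' : k < (2 : ℤ) := by exact_mod_cast k2
      interval_cases k
      · exact h5 (by rw [hk']; norm_num)
      · exact h (by rw [hk']; norm_num)
    rw [hg, show (1 / 2 - α) * Real.Gamma (1 / 2 - α) * Real.Gamma (1 / 2 + α) =
      (1 / 2 - α) * (Real.Gamma (1 / 2 + α) * Real.Gamma (1 / 2 - α)) by ring, hr]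
    field_simp
    ring

/-- `∫_0^x c'²` for the stationary covariance `c`. -/
noncomputable def covDerivSqInt (α x : ℝ) : ℝ := ∫ t in (0 : ℝ)..x, covDeriv α t ^ 2

theorem integrable_mul_specDensity {α : ℝ} (h1 : 1 < α) (h2 : α < 2) :
    Integrable fun ξ => ξ * specDensity α ξ := by
  obtain ⟨hi, -⟩ := integral_rpow_div_one_add_sq_pow (b := 2 - α) (n := 1) (by linarith)
    (by push_cast; linarith)
  have h := integrable_comp_abs_of_integrableOn hi
  refine h.mono' (by have := measurable_specDensity α; fun_prop) ?_
  refine Eventually.of_forall fun ξ => le_of_eq ?_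
  rw [norm_mul, Real.norm_of_nonneg (specDensity_nonneg α ξ), specDensity, Real.norm_eq_abs,
    pow_one, sq_abs]
  rcases eq_or_ne ξ 0 with rfl | hξ
  · simp [Real.zero_rpow (by linarith : 2 - α ≠ 0)]
  · rw [show 2 - α = 1 + (1 - α) by ring, Real.rpow_add (abs_pos.2 hξ), Real.rpow_one]
    ring

theorem covDeriv_eq_integral {α τ : ℝ} (h1 : 1 < α) (h2 : α < 2) (hτ : 0 < τ) :
    covDeriv α τ = -((specConst α)⁻¹ * ∫ ξ, Real.sin (τ * ξ) * (ξ * specDensity α ξ)) := by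
  have h0 : 0 < α := by linarith
  have hm := measurable_specDensity α
  have h := (hasDerivAt_integral_of_dominated_loc_of_deriv_le (μ := volume) (x₀ := τ)
    (s := Set.univ) (F := fun τ ξ => Real.cos (τ * ξ) * specDensity α ξ)
    (F' := fun τ ξ => -(Real.sin (τ * ξ) * (ξ * specDensity α ξ)))
    (bound := fun ξ => ‖ξ * specDensity α ξ‖) Filter.univ_mem
    (Eventually.of_forall fun x => (integrable_cos_mul_specDensity h0 h2 x).1)
    (integrable_cos_mul_specDensity h0 h2 τ)
    (Measurable.aestronglyMeasurable (by fun_prop))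
    (Eventually.of_forall fun ξ x _ => by
      rw [norm_neg, norm_mul]
      exact mul_le_of_le_one_left (norm_nonneg _) (by simpa using Real.abs_sin_le_one _))
    (integrable_mul_specDensity h1 h2).norm
    (Eventually.of_forall fun ξ x _ => by
      have e0 : HasDerivAt (fun x : ℝ => x * ξ) ξ x := by
        simpa using (hasDerivAt_id x).mul_const ξ
      refine (e0.cos.mul_const (specDensity α ξ)).congr_deriv ?_
      ring)).2
  have h3 := (hasDerivAt_specCov h0 h2 hτ).unique (h.const_mul (specConst α)⁻¹)
  rw [h3, integral_neg]; ring

/-- The extra factor ξ from differentiation tames the density at zero frequency, so Plancherel for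
c' works up to α = 2; α > 1 makes ξ times the density integrable at infinity. -/
theorem tendsto_covDerivSqInt {α : ℝ} (h1 : 1 < α) (h2 : α < 2) :
    (∀ x, 0 ≤ x → IntervalIntegrable (fun t => covDeriv α t ^ 2) volume 0 x) ∧
    Tendsto (covDerivSqInt α) atTop (𝓝 ((specConst α)⁻¹ ^ 2 * π *
      (Real.Gamma (5 / 2 - α) * Real.Gamma (α - 1 / 2)))) := by
  have h0 : 0 < α := by linarith
  have e : ∀ ξ : ℝ, (ξ * specDensity α ξ) ^ 2 = |ξ| ^ (4 - 2 * α) / (1 + ξ ^ 2) ^ 2 := by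
    intro ξ
    rcases eq_or_ne ξ 0 with rfl | hξ
    · simp [Real.zero_rpow (by linarith : 4 - 2 * α ≠ 0)]
    · rw [specDensity, mul_pow, div_pow, ← sq_abs ξ, ← mul_div_assoc, ← Real.rpow_natCast,
        ← Real.rpow_natCast (|ξ| ^ (1 - α)), ← Real.rpow_mul (abs_nonneg ξ),
        ← Real.rpow_add (abs_pos.2 hξ)]
      congr 2; push_cast; ring
  obtain ⟨hi, hv⟩ := integrable_rpow_div_sq (b := 4 - 2 * α) (by linarith) (by linarith)
  simp_rw [← e] at hi hv
  obtain ⟨hI, hV⟩ := integral_cos_sin_transform_sq (integrable_mul_specDensity h1 h2) hi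
  have hodd : ∀ ξ, -ξ * specDensity α (-ξ) = -(ξ * specDensity α ξ) := fun ξ => by
    rw [specDensity_neg]; ring
  rw [hv] at hV
  simp only [integral_cos_mul_odd (φ := fun ξ => ξ * specDensity α ξ) hodd, ne_eq, OfNat.ofNat_ne_zero,
    not_false_eq_true, zero_pow, zero_add] at hI hV
  have ht := (tendsto_integral_even hI (fun τ => by simp [integral_neg])).const_mul
    ((specConst α)⁻¹ ^ 2)
  rw [hV] at ht
  have hval : (specConst α)⁻¹ ^ 2 * π * (Real.Gamma (5 / 2 - α) * Real.Gamma (α - 1 / 2)) =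
      (specConst α)⁻¹ ^ 2 * (2 * π * (Real.Gamma ((4 - 2 * α + 1) / 2) *
        Real.Gamma (2 - (4 - 2 * α + 1) / 2)) / 2) := by
    rw [show (4 - 2 * α + 1) / 2 = 5 / 2 - α by ring,
      show 2 - (5 / 2 - α) = α - 1 / 2 by ring]
    ring
  rw [hval]
  constructor
  · intro x hx
    rw [intervalIntegrable_iff_integrableOn_Ioc_of_le hx]
    refine (hI.const_mul ((specConst α)⁻¹ ^ 2)).integrableOn.congr_fun (fun t ht => ?_)
      measurableSet_Ioc
    rw [covDeriv_eq_integral h1 h2 ht.1]; ring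
  refine ht.congr' ?_
  filter_upwards [eventually_ge_atTop 0] with x hx
  rw [covDerivSqInt, ← intervalIntegral.integral_const_mul, intervalIntegral.integral_of_le hx,
    intervalIntegral.integral_of_le hx]
  refine setIntegral_congr_fun measurableSet_Ioc fun t ht => ?_
  rw [covDeriv_eq_integral h1 h2 ht.1]; ring

/-- A virial identity: differentiating the right-hand side and using c'' = c - κ with κ homogeneous,
the products with κ cancel. It trades ∫ c² for ∫ c'², which converges also when ∫ c² does not. -/
theorem covSqInt_add_covDerivSqInt {α x : ℝ} (h1 : 1 < α) (h2 : α < 2) (hx : 0 < x) :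
    (α - 3 / 2) * covSqInt α x + (α - 1 / 2) * covDerivSqInt α x =
      x * noiseCov α x * specCov α x + (α - 1) * (specCov α x * covDeriv α x) -
        x * (specCov α x ^ 2 - covDeriv α x ^ 2) / 2 := by
  have h0 : 0 < α := by linarith
  have hk : ∀ y : ℝ, 0 < y → y * noiseCov α y = α / 2 * (α - 1) * y ^ (α - 1) := fun y hy => by
    rw [noiseCov, rpow_sub_one_eq hy]; ring
  have hd : ∀ y, 0 < y → HasDerivAt (fun y => α / 2 * (α - 1) * y ^ (α - 1) * specCov α y +
      (α - 1) * (specCov α y * covDeriv α y) - y * (specCov α y ^ 2 - covDeriv α y ^ 2) / 2)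
      ((α - 3 / 2) * specCov α y ^ 2 + (α - 1 / 2) * covDeriv α y ^ 2) y := by
    intro y hy
    have hc := hasDerivAt_specCov h0 h2 hy
    have hd := hasDerivAt_covDeriv h0 h2 hy
    have h := ((((hasDerivAt_rpow_sub_one (α := α) hy).const_mul (α / 2 * (α - 1))).mul hc).add
      ((hc.mul hd).const_mul (α - 1))).sub
      (((hasDerivAt_id y).mul ((hc.pow 2).sub (hd.pow 2))).div_const 2)
    refine h.congr_deriv ?_
    simp only [id, Pi.sub_apply, Pi.pow_apply]
    rw [noiseCov, rpow_sub_one_eq hy]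
    push_cast
    ring
  have hs : Tendsto (fun y : ℝ => y ^ (α - 1)) (𝓝[>] 0) (𝓝 0) := by
    have := ((Real.continuous_rpow_const (q := α - 1) (by linarith)).tendsto 0).mono_left
      (nhdsWithin_le_nhds (s := Set.Ioi (0 : ℝ)))
    rwa [Real.zero_rpow (by linarith)] at this
  have hd0 : Tendsto (covDeriv α) (𝓝[>] 0) (𝓝 0) := by
    have := (tendsto_covDeriv_add_zero h0 h2).sub (hs.const_mul (α / 2))
    simpa using this
  have hc0 := tendsto_specCov_zero h0 h2
  have hlim := (((hs.const_mul (α / 2 * (α - 1))).mul hc0).add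
    ((hc0.mul hd0).const_mul (α - 1))).sub
    ((tendsto_id_zero.mul ((hc0.pow 2).sub (hd0.pow 2))).div_const 2)
  simp only [mul_zero, zero_mul, add_zero, sub_zero, zero_div] at hlim
  have hJ := (tendsto_covDerivSqInt h1 h2).1 x hx.le
  have hI : IntervalIntegrable (fun t => specCov α t ^ 2) volume 0 x :=
    ((continuous_specCov h0 h2).pow 2).intervalIntegrable _ _
  have h := intervalIntegral.integral_eq_sub_of_hasDerivAt_of_tendsto hx
    (fun y hy => hd y hy.1) ((hI.const_mul _).add (hJ.const_mul _)) hlim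
    ((hd x hx).continuousAt.tendsto.mono_left nhdsWithin_le_nhds)
  rw [intervalIntegral.integral_add (hI.const_mul _) (hJ.const_mul _),
    intervalIntegral.integral_const_mul, intervalIntegral.integral_const_mul, sub_zero] at h
  rw [hk x hx, ← h, covSqInt, covDerivSqInt]

theorem isBigO_covDeriv {α : ℝ} (h0 : 0 < α) (h2 : α < 2) :
    covDeriv α =O[atTop] fun x => x ^ (α - 3) :=
  IsBigO.of_bound (covErr α + |α / 2 * (α - 1) * (α - 2)|) (by
    filter_upwards [eventually_ge_atTop 1] with x hx
    have hx0 : 0 < x := by linarith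
    have h := abs_covDeriv_sub_le h0 h2 hx
    have h3 : x ^ (α - 5) ≤ x ^ (α - 3) := Real.rpow_le_rpow_of_exponent_le hx (by linarith)
    have h4 : |α / 2 * (α - 1) * (α - 2) * x ^ (α - 3)| =
        |α / 2 * (α - 1) * (α - 2)| * x ^ (α - 3) := by
      rw [abs_mul _ (x ^ (α - 3)), abs_of_pos (by positivity : 0 < x ^ (α - 3))]
    have e : covDeriv α x = (covDeriv α x - α / 2 * (α - 1) * (α - 2) * x ^ (α - 3)) +
      α / 2 * (α - 1) * (α - 2) * x ^ (α - 3) := by ring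
    rw [Real.norm_of_nonneg (Real.rpow_nonneg hx0.le _), Real.norm_eq_abs, e, add_mul, ← h4]
    have hE := covErr_nonneg h0 h2
    exact (abs_add_le _ _).trans (add_le_add (h.trans (by gcongr)) le_rfl))

theorem isBigO_specCov_sub_noiseCov {α : ℝ} (h0 : 0 < α) (h2 : α < 2) :
    (fun x => specCov α x - noiseCov α x) =O[atTop] fun x => x ^ (α - 4) :=
  IsBigO.of_bound (covErr α + |α / 2 * (α - 1) * (α - 2) * (α - 3)|) (by
    filter_upwards [eventually_ge_atTop 1] with x hx
    rw [Real.norm_of_nonneg (Real.rpow_nonneg (by linarith) _)]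
    exact abs_specCov_sub_noiseCov_le h0 h2 hx)

theorem tendsto_covSqInt_of_gt {α : ℝ} (h1 : 3 / 2 < α) (h2 : α < 2) :
    Tendsto (fun x => covSqInt α x - (α / 2 * (α - 1)) ^ 2 / (2 * α - 3) * x ^ (2 * α - 3))
      atTop (𝓝 (covSqLimit α)) := by
  have h0 : 0 < α := by linarith
  have hJ := (tendsto_covDerivSqInt (by linarith : 1 < α) h2).2
  have hT : ∀ s : ℝ, s < 0 → Tendsto (fun x : ℝ => x ^ s) atTop (𝓝 0) := fun s hs => by
    simpa using tendsto_rpow_neg_atTop (y := -s) (by linarith)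
  have hid := isBigO_refl (fun x : ℝ => x) atTop
  have hd := isBigO_covDeriv h0 h2
  have hcκ := isBigO_specCov_sub_noiseCov h0 h2
  have e1 : Tendsto (fun x => x * (specCov α x - noiseCov α x) ^ 2) atTop (𝓝 0) := by
    refine (hid.mul (hcκ.pow 2)).trans_tendsto ((hT (2 * α - 7) (by linarith)).congr' ?_)
    filter_upwards [eventually_gt_atTop 0] with x hx
    rw [← Real.rpow_natCast, ← Real.rpow_mul hx.le, ← Real.rpow_one_add' hx.le (by
      push_cast; linarith)]
    congr 1; push_cast; ring
  have e2 : Tendsto (fun x => x * covDeriv α x ^ 2) atTop (𝓝 0) := by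
    refine (hid.mul (hd.pow 2)).trans_tendsto ((hT (2 * α - 5) (by linarith)).congr' ?_)
    filter_upwards [eventually_gt_atTop 0] with x hx
    rw [← Real.rpow_natCast, ← Real.rpow_mul hx.le, ← Real.rpow_one_add' hx.le (by
      push_cast; linarith)]
    congr 1; push_cast; ring
  have e3 : Tendsto (fun x => specCov α x * covDeriv α x) atTop (𝓝 0) := by
    refine ((isBigO_specCov_one h0 h2 atTop).mul hd).trans_tendsto
      ((hT (α - 3) (by linarith)).congr fun x => ?_)
    rw [one_mul]
  have h3 : α - 3 / 2 ≠ 0 := by linarith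
  have hlim := ((((e3.const_mul (α - 1)).add (e2.const_mul (1 / 2))).sub
    (e1.const_mul (1 / 2))).sub (hJ.const_mul (α - 1 / 2))).div_const (α - 3 / 2)
  -- The recurrence of Γ turns the constant obtained from c' into the formula found below 3/2.
  have hval : covSqLimit α = ((α - 1) * 0 + 1 / 2 * 0 - 1 / 2 * 0 -
      (α - 1 / 2) * ((specConst α)⁻¹ ^ 2 * π *
        (Real.Gamma (5 / 2 - α) * Real.Gamma (α - 1 / 2)))) / (α - 3 / 2) := by
    have g1 : Real.Gamma (5 / 2 - α) = (3 / 2 - α) * Real.Gamma (3 / 2 - α) := by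
      rw [← Real.Gamma_add_one (by linarith)]; congr 1; ring
    have g2 : Real.Gamma (1 / 2 + α) = (α - 1 / 2) * Real.Gamma (α - 1 / 2) := by
      rw [← Real.Gamma_add_one (by linarith)]; congr 1; ring
    rw [eq_div_iff h3, covSqLimit, g1, g2, inv_specConst h0 h2]
    field_simp
    ring
  rw [hval]
  refine hlim.congr' ?_
  filter_upwards [eventually_gt_atTop 0] with x hx
  have h := covSqInt_add_covDerivSqInt (by linarith : 1 < α) h2 hx
  have hk : x ^ (2 * α - 3) * (α / 2 * (α - 1)) ^ 2 = x * noiseCov α x ^ 2 := by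
    rw [noiseCov, mul_pow _ (x ^ (α - 2)), ← Real.rpow_natCast (x ^ (α - 2)),
      ← Real.rpow_mul hx.le, show 2 * α - 3 = 1 + (α - 2) * (2 : ℕ) by push_cast; ring,
      Real.rpow_add hx, Real.rpow_one]
    ring
  have h4 : (α / 2 * (α - 1)) ^ 2 / (2 * α - 3) * x ^ (2 * α - 3) =
      x * noiseCov α x ^ 2 / 2 / (α - 3 / 2) := by
    rw [← hk, div_mul_eq_mul_div, div_div, mul_comm (x ^ _)]; congr 1; ring
  -- Completing the square, xκc - xc²/2 = xκ²/2 - x(c - κ)²/2, exhibits the divergent power as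
  -- xκ²/2.
  rw [h4, eq_sub_iff_add_eq, ← add_div, div_eq_iff h3]
  linear_combination -h

theorem tendsto_covSqInt_sub {α : ℝ} (h0 : 0 < α) (h2 : α < 2) (h : α ≠ 3 / 2) :
    Tendsto (fun x => covSqInt α x - (α / 2 * (α - 1)) ^ 2 / (2 * α - 3) * x ^ (2 * α - 3))
      atTop (𝓝 (covSqLimit α)) := by
  rcases lt_or_gt_of_ne h with h | h
  · have h1 := tendsto_rpow_neg_atTop (y := -(2 * α - 3)) (by linarith)
    have := (tendsto_covSqInt_of_lt h0 h).sub
      (h1.const_mul ((α / 2 * (α - 1)) ^ 2 / (2 * α - 3)))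
    simpa using this
  · exact tendsto_covSqInt_of_gt h h2

theorem abs_covSqInt_sub_le {α x : ℝ} (h0 : 0 < α) (h2 : α < 2) (h : α ≠ 3 / 2) (hx : 1 ≤ x) :
    |covSqInt α x - (α / 2 * (α - 1)) ^ 2 / (2 * α - 3) * x ^ (2 * α - 3) - covSqLimit α| ≤
      covSqErr α / (5 - 2 * α) * x ^ (2 * α - 5) := by
  obtain ⟨L, h1, h3⟩ := exists_covSqInt_limit h0 h2 h
  rw [tendsto_nhds_unique (tendsto_covSqInt_sub h0 h2 h) h1]
  exact h3 x hx

/-! ### The critical exponent by passing to the limit in α. -/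

theorem tendsto_specCov_param (τ : ℝ) :
    Tendsto (fun α => specCov α τ) (𝓝[<] (3 / 2)) (𝓝 (specCov (3 / 2) τ)) := by
  have hev : ∀ᶠ α : ℝ in 𝓝[<] (3 / 2), α ∈ Set.Ioo (5 / 4 : ℝ) (3 / 2) :=
    Ioo_mem_nhdsLT (by norm_num)
  have hint : Tendsto (fun α => ∫ ξ, Real.cos (τ * ξ) * specDensity α ξ) (𝓝[<] (3 / 2))
      (𝓝 (∫ ξ, Real.cos (τ * ξ) * specDensity (3 / 2) ξ)) := by
    refine tendsto_integral_filter_of_dominated_convergence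
      -- For 5/4 < α < 3/2 the density is below that of 3/2 when |ξ| ≤ 1 and below that of 5/4 when
      -- |ξ| ≥ 1.
      (fun ξ => specDensity (3 / 2) ξ + specDensity (5 / 4) ξ) ?_ ?_
      ((integrable_specDensity (by norm_num) (by norm_num)).add
        (integrable_specDensity (by norm_num) (by norm_num))) ?_
    · filter_upwards [hev] with α hα
      exact (integrable_cos_mul_specDensity (by linarith [hα.1]) (by linarith [hα.2]) τ).1
    · filter_upwards [hev] with α hα
      filter_upwards [show ∀ᵐ x : ℝ, x ≠ 0 by simp [ae_iff, measure_singleton]] with ξ hξ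
      rw [norm_mul, Real.norm_of_nonneg (specDensity_nonneg α ξ)]
      refine (mul_le_of_le_one_left (specDensity_nonneg α ξ)
        (by simpa using Real.abs_cos_le_one _)).trans ?_
      have hx := abs_pos.2 hξ
      simp only [specDensity]
      rw [← add_div]
      refine div_le_div_of_nonneg_right ?_ (by positivity)
      rcases le_total 1 |ξ| with h | h
      · have := Real.rpow_le_rpow_of_exponent_le h (show 1 - α ≤ 1 - 5 / 4 by linarith [hα.1])
        have h2 : 0 ≤ |ξ| ^ ((1 : ℝ) - 3 / 2) := by positivity
        linarith
      · have := Real.rpow_le_rpow_of_exponent_ge hx h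
          (show 1 - 3 / 2 ≤ 1 - α by linarith [hα.2])
        have h2 : 0 ≤ |ξ| ^ ((1 : ℝ) - 5 / 4) := by positivity
        linarith
    · filter_upwards [show ∀ᵐ x : ℝ, x ≠ 0 by simp [ae_iff, measure_singleton]] with ξ hξ
      have hx := abs_pos.2 hξ
      have hc : ContinuousAt (fun α => Real.cos (τ * ξ) * specDensity α ξ) (3 / 2) := by
        unfold specDensity
        refine continuousAt_const.mul (ContinuousAt.div_const ?_ _)
        exact continuousAt_const.rpow (by fun_prop) (Or.inl hx.ne')
      exact hc.tendsto.mono_left nhdsWithin_le_nhds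
  have hcst : Tendsto (fun α => Real.Gamma (α + 1) / 2 * Real.sin (π * α / 2) / π) (𝓝[<] (3 / 2))
      (𝓝 (Real.Gamma (3 / 2 + 1) / 2 * Real.sin (π * (3 / 2) / 2) / π)) := by
    have hG : ContinuousAt (fun α : ℝ => Real.Gamma (α + 1)) (3 / 2) := by
      have := (Real.differentiableAt_Gamma (s := 3 / 2 + 1) (fun m => by
        have : (0 : ℝ) ≤ m := Nat.cast_nonneg m
        linarith)).continuousAt
      exact ContinuousAt.comp (f := fun α : ℝ => α + 1) this (by fun_prop)
    have hc : ContinuousAt (fun α => Real.Gamma (α + 1) / 2 * Real.sin (π * α / 2) / π)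
        (3 / 2) := ((hG.div_const 2).mul (by fun_prop)).div_const π
    exact hc.tendsto.mono_left nhdsWithin_le_nhds
  have key : ∀ α : ℝ, 0 < α → α < 2 → Real.Gamma (α + 1) / 2 * Real.sin (π * α / 2) / π *
      ∫ ξ, Real.cos (τ * ξ) * specDensity α ξ = specCov α τ := fun α h0 h2 => by
    rw [specCov, inv_specConst h0 h2, specCov_zero h0 h2]
  rw [← key (3 / 2) (by norm_num) (by norm_num)]
  refine (hcst.mul hint).congr' ?_
  filter_upwards [hev] with α hα
  exact key α (by linarith [hα.1]) (by linarith [hα.2])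

theorem tendsto_covSqInt_param {x : ℝ} :
    Tendsto (fun α => covSqInt α x) (𝓝[<] (3 / 2)) (𝓝 (covSqInt (3 / 2) x)) := by
  have hev : ∀ᶠ α : ℝ in 𝓝[<] (3 / 2), α ∈ Set.Ioo (5 / 4 : ℝ) (3 / 2) :=
    Ioo_mem_nhdsLT (by norm_num)
  have h0 := (tendsto_specCov_param 0).eventually_lt_const
    (lt_add_one (specCov (3 / 2) 0))
  refine intervalIntegral.tendsto_integral_filter_of_dominated_convergence
    (fun _ => (specCov (3 / 2) 0 + 1) ^ 2) ?_ ?_ (by simp) ?_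
  · filter_upwards [hev] with α hα
    exact ((continuous_specCov (by linarith [hα.1]) (by linarith [hα.2])).pow 2).aestronglyMeasurable
  · filter_upwards [hev, h0] with α hα hα0
    refine Eventually.of_forall fun t _ => ?_
    rw [norm_pow]
    exact pow_le_pow_left₀ (norm_nonneg _)
      ((abs_specCov_le (by linarith [hα.1]) (by linarith [hα.2]) t).trans hα0.le) 2
  · exact Eventually.of_forall fun t _ => (tendsto_specCov_param t).pow 2

theorem tendsto_covSqErr_param :
    Tendsto covSqErr (𝓝[<] (3 / 2)) (𝓝 (covSqErr (3 / 2))) := by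
  have hid : Tendsto (fun α : ℝ => α) (𝓝[<] (3 / 2)) (𝓝 (3 / 2)) :=
    tendsto_id.mono_left nhdsWithin_le_nhds
  have h1 : Tendsto covErr (𝓝[<] (3 / 2)) (𝓝 (covErr (3 / 2))) := by
    unfold covErr
    exact (tendsto_const_nhds.add (tendsto_const_nhds.div hid (by norm_num))).add
      ((tendsto_specCov_param 0).const_mul 120)
  have hk : Tendsto (fun α : ℝ => |α / 2 * (α - 1)|) (𝓝[<] (3 / 2))
      (𝓝 |(3 / 2 : ℝ) / 2 * (3 / 2 - 1)|) :=
    ((by fun_prop : Continuous fun α : ℝ => |α / 2 * (α - 1)|).tendsto _).mono_left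
      nhdsWithin_le_nhds
  have hk2 : Tendsto (fun α : ℝ => |α / 2 * (α - 1) * (α - 2) * (α - 3)|) (𝓝[<] (3 / 2))
      (𝓝 |(3 / 2 : ℝ) / 2 * (3 / 2 - 1) * (3 / 2 - 2) * (3 / 2 - 3)|) :=
    ((by fun_prop : Continuous fun α : ℝ => |α / 2 * (α - 1) * (α - 2) * (α - 3)|).tendsto
      _).mono_left nhdsWithin_le_nhds
  exact (h1.add hk2).mul ((hk.const_mul 2).add (h1.add hk2))

theorem hasDerivAt_Gamma_of_sub_one {s G : ℝ} (hs : s ≠ 1)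
    (h : HasDerivAt Real.Gamma G (s - 1)) :
    HasDerivAt Real.Gamma (Real.Gamma (s - 1) + (s - 1) * G) s := by
  have h1 := ((hasDerivAt_id s).sub_const 1).mul (h.comp_sub_const s 1)
  refine (h1.congr_of_eventuallyEq ?_).congr_deriv (by simp only [id]; ring)
  filter_upwards [isOpen_ne.mem_nhds hs] with y hy
  have := Real.Gamma_add_one (s := y - 1) (sub_ne_zero.2 hy)
  rw [sub_add_cancel] at this
  simpa using this

/-- The regularized limit of the squared covariance integral at the critical exponent. -/
theorem tendsto_covSqLimit_add {x : ℝ} (hx : 0 < x) :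
    Tendsto (fun α => (α / 2 * (α - 1)) ^ 2 / (2 * α - 3) * x ^ (2 * α - 3) + covSqLimit α)
      (𝓝[<] (3 / 2)) (𝓝 (9 / 64 * (Real.log x +
        (2 * Real.log 2 + Real.eulerMascheroniConstant + (π - 1) / 2)))) := by
  set γ := Real.eulerMascheroniConstant with hγ
  have hsπ : √π * √π = π := Real.mul_self_sqrt Real.pi_pos.le
  have hG12 := Real.hasDerivAt_Gamma_one_half
  have hG1 := Real.hasDerivAt_Gamma_one
  have hid := hasDerivAt_id (3 / 2 : ℝ)
  have hG32 : HasDerivAt Real.Gamma (√π - √π * (γ + 2 * Real.log 2) / 2) (3 / 2) := by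
    have h1 : HasDerivAt Real.Gamma (-√π * (γ + 2 * Real.log 2)) (3 / 2 - 1) := by
      rw [show (3 / 2 - 1 : ℝ) = 1 / 2 by norm_num]; exact hG12
    refine (hasDerivAt_Gamma_of_sub_one (by norm_num) h1).congr_deriv ?_
    rw [show (3 / 2 - 1 : ℝ) = 1 / 2 by norm_num, Real.Gamma_one_half_eq]; ring
  have hG2 : HasDerivAt Real.Gamma (1 - γ) 2 := by
    have h1 : HasDerivAt Real.Gamma (-γ) (2 - 1) := by
      rw [show (2 - 1 : ℝ) = 1 by norm_num]; exact hG1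
    refine (hasDerivAt_Gamma_of_sub_one (by norm_num) h1).congr_deriv ?_
    rw [show (2 - 1 : ℝ) = 1 by norm_num, Real.Gamma_one]; ring
  have hv32 : Real.Gamma (3 / 2) = √π / 2 := by
    rw [show (3 / 2 : ℝ) = 1 / 2 + 1 by norm_num, Real.Gamma_add_one (by norm_num),
      Real.Gamma_one_half_eq]; ring
  have hsc : Real.sin (π * (3 / 2) / 2) = √2 / 2 ∧ Real.cos (π * (3 / 2) / 2) = -(√2 / 2) := by
    have : π * (3 / 2) / 2 = π - π / 4 := by ring
    rw [this, Real.sin_pi_sub, Real.cos_pi_sub, Real.sin_pi_div_four, Real.cos_pi_div_four]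
    exact ⟨rfl, rfl⟩
  have hs2 : √2 * √2 = 2 := Real.mul_self_sqrt (by norm_num)
  have hsin : HasDerivAt (fun α : ℝ => Real.sin (π * α / 2))
      (Real.cos (π * (3 / 2) / 2) * (π / 2)) (3 / 2) := by
    have : HasDerivAt (fun α : ℝ => π * α / 2) (π / 2) (3 / 2) := by
      simpa using (hid.const_mul π).div_const 2
    exact this.sin
  have hGa : HasDerivAt (fun α : ℝ => Real.Gamma (5 / 2 - α)) (γ) (3 / 2) := by
    have h2 : HasDerivAt Real.Gamma (-γ) (5 / 2 - 3 / 2) := by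
      rw [show (5 / 2 - 3 / 2 : ℝ) = 1 by norm_num]; exact hG1
    exact (h2.comp_const_sub (5 / 2) (3 / 2)).congr_deriv (neg_neg γ)
  have hGb : HasDerivAt (fun α : ℝ => Real.Gamma (1 / 2 + α)) (1 - γ) (3 / 2) := by
    have h2 : HasDerivAt Real.Gamma (1 - γ) (1 / 2 + 3 / 2) := by
      rw [show (1 / 2 + 3 / 2 : ℝ) = 2 by norm_num]; exact hG2
    exact h2.comp_const_add (1 / 2) (3 / 2)
  have hpow : HasDerivAt (fun α : ℝ => x ^ (2 * α - 3)) (2 * Real.log x) (3 / 2) := by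
    have h1 : HasDerivAt (fun α : ℝ => 2 * α - 3) 2 (3 / 2) := by
      simpa using (hid.const_mul 2).sub_const 3
    have := h1.const_rpow hx
    rw [show (2 * (3 / 2) - 3 : ℝ) = 0 by norm_num, Real.rpow_zero] at this
    exact this.congr_deriv (by ring)
  have hk : HasDerivAt (fun α : ℝ => (α / 2 * (α - 1)) ^ 2) (3 / 4) (3 / 2) := by
    have := ((hid.div_const 2).mul (hid.sub_const 1)).pow 2
    refine this.congr_deriv ?_
    simp only [id, Pi.mul_apply]
    norm_num
  have hB := (((((hid.div_const 2).mul hG32).pow 2).mul (hsin.pow 2)).mul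
    (hGa.mul hGb)).const_mul (2 / π)
  have hh := hB.sub (hk.mul hpow)
  have hπ := Real.pi_ne_zero
  -- Writing Γ(3/2-α) = Γ(5/2-α)/(3/2-α) puts both terms over α - 3/2, and their sum is -h(α)/(2(α -
  -- 3/2)). Since h vanishes at 3/2, the limit is -h'(3/2)/2.
  set h : ℝ → ℝ := fun α => 2 / π * ((α / 2 * Real.Gamma α) ^ 2 * Real.sin (π * α / 2) ^ 2 *
    (Real.Gamma (5 / 2 - α) * Real.Gamma (1 / 2 + α))) - (α / 2 * (α - 1)) ^ 2 * x ^ (2 * α - 3)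
    with hhd
  have hder : HasDerivAt h (-2 * (9 / 64 * (Real.log x +
        (2 * Real.log 2 + γ + (π - 1) / 2)))) (3 / 2) := by
    refine hh.congr_deriv ?_
    simp only [id, Pi.mul_apply, Pi.pow_apply]
    rw [hv32, hsc.1, hsc.2, show (5 / 2 - 3 / 2 : ℝ) = 1 by norm_num,
      show (1 / 2 + 3 / 2 : ℝ) = 2 by norm_num, Real.Gamma_one, Real.Gamma_two,
      show (2 * (3 / 2) - 3 : ℝ) = 0 by norm_num, Real.rpow_zero]
    have hsπ' : √π ^ 2 = π := by rw [pow_two, hsπ]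
    have hs2' : √2 ^ 2 = 2 := by rw [pow_two, hs2]
    field_simp
    ring_nf
    rw [hsπ', hs2']
    ring
  have hzero : h (3 / 2) = 0 := by
    simp only [hhd]
    rw [hv32, hsc.1, show (5 / 2 - 3 / 2 : ℝ) = 1 by norm_num,
      show (1 / 2 + 3 / 2 : ℝ) = 2 by norm_num, Real.Gamma_one, Real.Gamma_two,
      show (2 * (3 / 2) - 3 : ℝ) = 0 by norm_num, Real.rpow_zero]
    have e1 : 2 / π * ((3 / 2 / 2 * (√π / 2)) ^ 2 * (√2 / 2) ^ 2 * (1 * 1)) =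
      9 / 256 * (2 / π * ((√π * √π) * (√2 * √2))) := by ring
    rw [e1, hsπ, hs2]
    field_simp
    norm_num
  have hslope := ((hasDerivAt_iff_tendsto_slope.1 hder).mono_left
    (nhdsWithin_mono _ (fun y (hy : y < 3 / 2) => ne_of_lt hy : Iio (3 / 2 : ℝ) ⊆ _))).const_mul
      (-(1 / 2))
  have hval : -(1 / 2) * (-2 * (9 / 64 * (Real.log x + (2 * Real.log 2 + γ + (π - 1) / 2)))) =
    9 / 64 * (Real.log x + (2 * Real.log 2 + γ + (π - 1) / 2)) := by ring
  rw [hval] at hslope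
  refine hslope.congr' ?_
  have hev : ∀ᶠ α : ℝ in 𝓝[<] (3 / 2), α ∈ Set.Ioo (5 / 4 : ℝ) (3 / 2) :=
    Ioo_mem_nhdsLT (by norm_num)
  filter_upwards [hev] with α hα
  have h1 : 3 / 2 - α ≠ 0 := by linarith [hα.2]
  have h3 : 2 * α - 3 ≠ 0 := by linarith [hα.2]
  have h4 : α - 3 / 2 ≠ 0 := by linarith [hα.2]
  have g1 : Real.Gamma (5 / 2 - α) = (3 / 2 - α) * Real.Gamma (3 / 2 - α) := by
    rw [← Real.Gamma_add_one h1]; congr 1; ring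
  rw [slope_def_field, hzero, sub_zero, covSqLimit, specCov_zero_eq (by linarith [hα.1])
    (by linarith [hα.2])]
  simp only [hhd]
  rw [g1]
  have e2 : 2 * α - 3 = 2 * (α - 3 / 2) := by ring
  generalize x ^ (2 * α - 3) = X
  rw [e2, show 3 / 2 - α = -(α - 3 / 2) by ring]
  generalize hz : α - 3 / 2 = z at *
  field_simp
  ring

/-- The generic estimate holds for α below 3/2 with a constant that converges as α → 3/2, so the
inequality survives the limit at each fixed x. -/
theorem abs_covSqInt_three_halves_sub_le {x : ℝ} (hx : 1 ≤ x) :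
    |covSqInt (3 / 2) x - 9 / 64 * (Real.log x +
      (2 * Real.log 2 + Real.eulerMascheroniConstant + (π - 1) / 2))| ≤
      covSqErr (3 / 2) / 2 * x ^ (-2 : ℝ) := by
  have h1 := ((tendsto_covSqInt_param (x := x)).sub (tendsto_covSqLimit_add (by linarith : 0 < x))).abs
  have hid : Tendsto (fun α : ℝ => α) (𝓝[<] (3 / 2)) (𝓝 (3 / 2)) :=
    tendsto_id.mono_left nhdsWithin_le_nhds
  have h2 : Tendsto (fun α => covSqErr α / (5 - 2 * α) * x ^ (2 * α - 5)) (𝓝[<] (3 / 2))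
      (𝓝 (covSqErr (3 / 2) / (5 - 2 * (3 / 2)) * x ^ (2 * (3 / 2) - 5 : ℝ))) := by
    refine (tendsto_covSqErr_param.div ((hid.const_mul 2).const_sub 5) (by norm_num)).mul ?_
    exact tendsto_const_nhds.rpow ((hid.const_mul 2).sub_const 5) (Or.inl (by linarith : x ≠ 0))
  rw [show (2 * (3 / 2) - 5 : ℝ) = -2 by norm_num,
    show (5 - 2 * (3 / 2) : ℝ) = 2 by norm_num] at h2
  refine le_of_tendsto_of_tendsto h1 h2 ?_
  have hev : ∀ᶠ α : ℝ in 𝓝[<] (3 / 2), α ∈ Set.Ioo (5 / 4 : ℝ) (3 / 2) :=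
    Ioo_mem_nhdsLT (by norm_num)
  filter_upwards [hev] with α hα
  have := abs_covSqInt_sub_le (by linarith [hα.1]) (by linarith [hα.2])
    (by linarith [hα.2] : α ≠ 3 / 2) hx
  rwa [sub_sub] at this

/-! ### Assembly of the asymptotic expansions. -/

theorem normSqFT_sub_normSqMain_rpow {α : ℝ} (h0 : 0 < α) (h2 : α < 2) (s : ℝ) :
    (fun T => normSqFT α T - normSqMain α T) =O[atTop] fun T => T ^ s := by
  refine (normSqFT_sub_normSqMain h0 h2).trans ?_
  refine ((isBigO_refl (fun T : ℝ => T) atTop).mul (isBigO_exp_neg_rpow (s - 1))).congr'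
    EventuallyEq.rfl ?_
  filter_upwards [eventually_gt_atTop 0] with T hT
  rw [Real.rpow_sub_one hT.ne']; field_simp

theorem isBigO_rpow_rpow {a b : ℝ} (h : a ≤ b) :
    (fun T : ℝ => T ^ a) =O[atTop] fun T => T ^ b := IsBigO.of_bound 1 (by
  filter_upwards [eventually_ge_atTop 1] with x hx
  rw [one_mul, Real.norm_of_nonneg (Real.rpow_nonneg (by linarith) _),
    Real.norm_of_nonneg (Real.rpow_nonneg (by linarith) _)]
  exact Real.rpow_le_rpow_of_exponent_le hx h)

theorem isBigO_linear_mul {ρ : ℝ → ℝ} {s : ℝ} (h : ρ =O[atTop] fun T => T ^ s) (b c : ℝ) :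
    (fun T => (b * T - c) * ρ T) =O[atTop] fun T => T ^ (s + 1) := by
  have hid : (fun T : ℝ => b * T - c) =O[atTop] fun T => T :=
    ((isBigO_refl _ _).const_mul_left b).sub (IsBigO.of_bound |c| (by
      filter_upwards [eventually_ge_atTop 1] with x hx
      rw [Real.norm_of_nonneg (by linarith : 0 ≤ x), Real.norm_eq_abs]
      exact le_mul_of_one_le_right (abs_nonneg c) hx))
  refine (hid.mul h).congr' EventuallyEq.rfl ?_
  filter_upwards [eventually_gt_atTop 0] with T hT
  rw [Real.rpow_add_one hT.ne', mul_comm]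

/-- The limit constant times 8T - 4(2α-1) gives the linear part. The error of `covSqInt` is
multiplied by T and so determines the order T^{2α-4}; the explicit T^{2α-4} term is absorbed into
it. -/
theorem normSqFT_isBigO {α : ℝ} (h0 : 0 < α) (h2 : α < 2) (h : α ≠ 3 / 2) :
    (fun T => normSqFT α T - (2 * specCov α 0 ^ 2 * (slopeFactor (α / 2) *
      (T - (2 * α - 1) / 2) - (α - 1) * (α + 1)) +
      (α / 2) ^ 2 * (4 * (α - 1) / (2 * α - 3) * T ^ (2 * α - 2) -
        8 * (α - 1) ^ 2 / (2 * α - 3) * T ^ (2 * α - 3)))) =O[atTop] fun T => T ^ (2 * α - 4) := by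
  have h3 : 2 * α - 3 ≠ 0 := fun h' => h (by linarith)
  have hρ : (fun T => covSqInt α T - (α / 2 * (α - 1)) ^ 2 / (2 * α - 3) * T ^ (2 * α - 3) -
      covSqLimit α) =O[atTop] fun T => T ^ (2 * α - 5) :=
    IsBigO.of_bound (covSqErr α / (5 - 2 * α)) (by
      filter_upwards [eventually_ge_atTop 1] with x hx
      rw [Real.norm_of_nonneg (Real.rpow_nonneg (by linarith) _)]
      exact abs_covSqInt_sub_le h0 h2 h hx)
  have h1 := isBigO_linear_mul hρ 8 (4 * (2 * α - 1))
  rw [show 2 * α - 5 + 1 = 2 * α - 4 by ring] at h1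
  have h4 := (isBigO_refl (fun T : ℝ => T ^ (2 * α - 4)) atTop).const_mul_left
    ((α / 2 * (α - 1)) ^ 2 * (26 - 8 * α))
  refine ((((normSqFT_sub_normSqMain_rpow h0 h2 _).add ((normSqMain_expansion h0 h2).trans
    (isBigO_rpow_rpow (by linarith)))).add h1).add h4).congr' ?_ EventuallyEq.rfl
  filter_upwards [eventually_gt_atTop 0] with T hT
  have hG : Real.Gamma (α + 1) = 2 * specCov α 0 := by rw [specCov_zero h0 h2]; ring
  have hT2 : T ^ (2 * α - 2) = T * T ^ (2 * α - 3) := by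
    rw [show 2 * α - 2 = 2 * α - 3 + 1 by ring, Real.rpow_add_one hT.ne', mul_comm]
  rw [hG, covSqLimit_eq h0 h2 h, hT2]
  generalize specCov α 0 = c0
  generalize T ^ (2 * α - 3) = X
  generalize slopeFactor (α / 2) = s
  field_simp
  ring

theorem normSqFT_three_halves_isBigO :
    (fun T => normSqFT (3 / 2) T - 9 / 8 * ((T - 1) * Real.log T +
      (2 * Real.log 2 + Real.eulerMascheroniConstant + (π - 3) / 2) * T + 1 -
      (2 * Real.log 2 + Real.eulerMascheroniConstant) - 13 * π / 16 + 1 / T)) =O[atTop]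
      fun T => T ^ (-2 : ℝ) := by
  have h0 : (0 : ℝ) < 3 / 2 := by norm_num
  have h2 : (3 / 2 : ℝ) < 2 := by norm_num
  set c := 2 * Real.log 2 + Real.eulerMascheroniConstant with hc
  obtain ⟨L, M, hL, hM⟩ := exists_covSqInt_limit_three_halves
  -- The sharp expansion only asserts that some L exists; the cruder estimate with explicit constant
  -- identifies it.
  have hLv : L = 9 / 64 * (c + (π - 1) / 2) := by
    refine tendsto_nhds_unique hL ?_
    have ht := (tendsto_rpow_neg_atTop (y := 2) (by norm_num)).const_mul (covSqErr (3 / 2) / 2)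
    rw [mul_zero] at ht
    rw [tendsto_iff_dist_tendsto_zero]
    refine squeeze_zero' (Eventually.of_forall fun _ => dist_nonneg) ?_ ht
    filter_upwards [eventually_ge_atTop 1] with x hx
    have := abs_covSqInt_three_halves_sub_le hx
    rw [Real.dist_eq]
    convert this using 2
    ring
  have hρ : (fun x => covSqInt (3 / 2) x - 9 / 64 * Real.log x + 27 / 256 * x ^ (-2 : ℝ) - L)
      =O[atTop] fun T => T ^ (-3 : ℝ) := IsBigO.of_bound M (by
    filter_upwards [eventually_ge_atTop 1] with x hx
    rw [Real.norm_of_nonneg (Real.rpow_nonneg (by linarith) _)]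
    exact hM x hx)
  have h1 := isBigO_linear_mul hρ 8 (4 * (2 * (3 / 2) - 1))
  rw [show (-3 + 1 : ℝ) = -2 by norm_num] at h1
  -- The factor 8T - 8 meets -(27/256)T^{-2}: the T part enters the 1/T coefficient 63/32 - 27/32 =
  -- 9/8, and the constant part leaves (27/32)T^{-2} as error.
  have h4 := (isBigO_refl (fun T : ℝ => T ^ (-2 : ℝ)) atTop).const_mul_left (27 / 32)
  have hexp := normSqMain_expansion h0 h2
  rw [show (2 * (3 / 2) - 5 : ℝ) = -2 by norm_num] at hexp
  refine ((((normSqFT_sub_normSqMain_rpow h0 h2 (-2)).add hexp).add h1).add h4).congr' ?_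
    EventuallyEq.rfl
  filter_upwards [eventually_gt_atTop 0] with T hT
  have hG : Real.Gamma (3 / 2 + 1) = 2 * specCov (3 / 2) 0 := by rw [specCov_zero h0 h2]; ring
  have hc0 : specCov (3 / 2) 0 ^ 2 = 9 / 64 * π := by
    have hv32 : Real.Gamma (3 / 2) = √π / 2 := by
      rw [show (3 / 2 : ℝ) = 1 / 2 + 1 by norm_num, Real.Gamma_add_one (by norm_num),
        Real.Gamma_one_half_eq]; ring
    rw [specCov_zero_eq h0 h2, hv32]
    linear_combination 9 / 64 * Real.sq_sqrt Real.pi_pos.le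
  have e2 : T ^ (-2 : ℝ) = (T ^ 2)⁻¹ := by rw [Real.rpow_neg hT.le, Real.rpow_two]
  rw [hG, hLv, show (2 * (3 / 2) - 2 : ℝ) = 1 by norm_num,
    show (2 * (3 / 2) - 3 : ℝ) = 0 by norm_num, show (2 * (3 / 2) - 4 : ℝ) = -1 by norm_num,
    Real.rpow_zero, Real.rpow_one, Real.rpow_neg_one, e2]
  generalize specCov (3 / 2) 0 = c0 at *
  field_simp
  ring_nf
  rw [hc0]
  ring

/-- Both numerator and denominator vanish at 1/4, so the quotient is 4 over the negated difference
quotient of cos(2πh), whose derivative there is -2π. -/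
theorem tendsto_slopeFactor_quotient :
    Tendsto (fun h : ℝ => (4 * h - 1) / (-Real.cos (2 * h * π))) (𝓝[≠] (1 / 4))
      (𝓝 (2 / π)) := by
  have hd : HasDerivAt (fun h : ℝ => Real.cos (2 * h * π)) (-(2 * π)) (1 / 4) := by
    have h1 : HasDerivAt (fun h : ℝ => 2 * h * π) (2 * π) (1 / 4) := by
      simpa using ((hasDerivAt_id (1 / 4 : ℝ)).const_mul 2).mul_const π
    refine h1.cos.congr_deriv ?_
    rw [show 2 * (1 / 4) * π = π / 2 by ring, Real.sin_pi_div_two]; ring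
  have hs := (hasDerivAt_iff_tendsto_slope.1 hd).neg.inv₀ (by simp [Real.pi_ne_zero])
  have hs4 := hs.const_mul 4
  rw [neg_neg, show 4 * (2 * π)⁻¹ = 2 / π by field_simp; norm_num] at hs4
  refine hs4.congr' ?_
  filter_upwards [self_mem_nhdsWithin] with h hh
  rw [slope_def_field, show 2 * (1 / 4) * π = π / 2 by ring, Real.cos_pi_div_two, sub_zero,
    ← neg_div, inv_div]
  ring

end FBM

theorem theorem1p2 (H : ℝ) (hH0 : 0 < H) (hH1 : H < 1) :
    -- `f_T` is symmetric
    (∀ T t s : ℝ, FBM.fT T (t, s) = FBM.fT T (s, t)) ∧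
    -- `f_T` lies in the tensor square, with a well-defined squared norm `N T`
    (∃ N : ℝ → ℝ,
      (∀ T : ℝ, 0 < T → ∀ x : ℝ, FBM.HasTensorNormSq H T (FBM.fT T) x ↔ x = N T) ∧
      (H ≠ 3 / 4 →
        (fun T : ℝ => N T -
          (2 * H ^ 2 * Real.Gamma (2 * H) ^ 2 *
              (FBM.slopeFactor H * (T - (4 * H - 1) / 2) - (2 * H - 1) * (2 * H + 1))
            + H ^ 2 * (4 * (2 * H - 1) / (4 * H - 3) * T ^ (4 * H - 2)
              - 8 * (2 * H - 1) ^ 2 / (4 * H - 3) * T ^ (4 * H - 3))))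
          =O[atTop] fun T : ℝ => T ^ (4 * H - 4)) ∧
      (H = 3 / 4 → ∀ c : ℝ, c = 2 * Real.log 2 + Real.eulerMascheroniConstant →
        (fun T : ℝ => N T -
          9 / 8 * ((T - 1) * Real.log T + (c + (Real.pi - 3) / 2) * T + 1 - c
            - 13 * Real.pi / 16 + 1 / T))
          =O[atTop] fun T : ℝ => T ^ (-2 : ℝ))) ∧
    -- the value used in `slopeFactor` at `H = 1/4` is the limit there
    Tendsto (fun h : ℝ => (4 * h - 1) / (-Real.cos (2 * h * Real.pi))) (𝓝[≠] (1 / 4))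
      (𝓝 (2 / Real.pi)) := by
  have h0 : 0 < 2 * H := by linarith
  have h2 : 2 * H < 2 := by linarith
  refine ⟨fun T t s => ?_, ⟨FBM.normSqFT (2 * H), fun T hT x =>
    FBM.hasTensorNormSq_fT_iff_normSqFT hH0 hH1 hT.le x, fun h => ?_, fun h c hc => ?_⟩,
    FBM.tendsto_slopeFactor_quotient⟩
  · simp only [FBM.fT, Set.indicator_apply, Set.mem_prod, abs_sub_comm t s]
    simp only [and_comm]
  · have := FBM.normSqFT_isBigO h0 h2 (fun h' => h (by linarith))
    rw [FBM.specCov_zero_eq h0 h2, show 2 * H / 2 = H by ring,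
      show 2 * (2 * H) = 4 * H by ring] at this
    refine this.congr_left fun T => ?_
    ring
  · subst h hc
    have := FBM.normSqFT_three_halves_isBigO
    rwa [show (3 / 2 : ℝ) = 2 * (3 / 4) by norm_num] at this
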